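/- **Theorem 3.1.** Let $N\ge 2$, $n,m\ge 0$, $b(x)=\dfrac{x}{x-2/N}$, $c(x)=\dfrac{-2/N}{x-2/N}$. For $d\ge1$ and $1\le i\neq j\le n$ let $P_{ij}$ be the permutation of the $i$-th and $j$-th factor of $(\mathbb C^d)^{\otimes n}$ and $R_{ij}(x)=b(x)\,\mathbf 1+c(x)P_{ij}$ (with the same $b,c$, i.e. the same $N$, for every $d$). Put $$Q(x;i)=R_{i+1,i}(x_{i+1}-x_i-2)\cdots R_{n,i}(x_n-x_i-2)\,R_{1,i}(x_1-x_i)\cdots R_{i-1,i}(x_{i-1}-x_i).$$ Say that a function $f$ with values in $(\mathbb C^d)^{\otimes n}$ satisfies on a set $D\subseteq\mathbb C^n$ * (i) if $f^{\dots ji\dots}(\dots,x_j,x_i,\dots)=R_{ij}(x_i-x_j)\,f^{\dots ij\dots}(\dots,x_i,x_j,\dots)$ for all neighbouring $i,j=i+1$ (spaces and variables are exchanged simultaneously), whenever both arguments lie in $D$ and $x_i-x_j\ne 2/N$; * (ii) if $f(\dots,x_i+2,\dots)=Q(x;i)\,f(\dots,x_i,\dots)$ for $i=1,\dots,n$, whenever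 both arguments lie in $D$ and no factor of $Q(x;i)$ has a pole, i.e. is evaluated at $2/N$. Let $e_1,\dots,e_N$ be the canonical basis of $\mathbb C^N$, $V=(\mathbb C^N)^{\otimes n}$, $\Omega=e_1\otimes\dots\otimes e_1\in V$, and let $V_0=\mathbb C^N$ be an auxiliary space. Let $T_0(x,u)=R_{10}(x_1-u)\cdots R_{n0}(x_n-u)$ act on $V\otimes V_0$, and for $2\le\beta\le N$ let $B_\beta(x,u)$ be the operator on $V$ that sends $v$ to the coefficient of $e_1\in V_0$ in $T_0(x,u)(v\otimes e_\beta)$. Let $\tilde u\in\mathbb C^m$ be such that $\tilde u_i-\tilde u_j\notin \frac2N+2\mathbb Z$ for $i\ne j$. Let $\psi,\tau:\mathbb C\to\mathbb C$ satisfy $$b(x)\,\psi(x)=\psi(x-2)\quad(x\neq\tfrac2N),\qquad \frac{\tau(x)}{b(x)}=\frac{\tau(x-2)}{b(2-x)}\quad(x\ne 0,\,2,\,\tfrac2N,\,2-\tfrac2N);$$ if $\tilde u_i-\tilde u_j\in2\mathbb Z$ for some $i\neq j$, let $\tau$ moreover be continuous at the points of $2\mathbb Z$. Let $f^{(1)}:\mathbb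 C^m\to(\mathbb C^{N-1})^{\otimes m}$ (the basis of $\mathbb C^{N-1}$ being indexed by $2,\dots,N$), put $$g(x,u)=\prod_{i=1}^n\prod_{j=1}^m\psi(x_i-u_j)\prod_{1\le i<j\le m}\tau(u_i-u_j)\;f^{(1)}(u),$$ and let $f$ be given by the off-shell Bethe Ansatz $$f(x)=\sum_{u}\ \sum_{\beta_1,\dots,\beta_m=2}^{N}B_{\beta_m}(x,u_m)\cdots B_{\beta_1}(x,u_1)\,\Omega\;g^{\beta_1\dots\beta_m}(x,u),\qquad u_j\in\tilde u_j-2\mathbb Z .$$ Let $D$ be the set of all $x\in\mathbb C^n$ with $x_i-\tilde u_j\notin\frac2N+2\mathbb Z$ for all $i,j$ and $$\sum_{u}|g^{\beta_1\dots\beta_m}(x,u)|\prod_{j=1}^m\frac1{1+|u_j|}<\infty\quad\text{for all }\beta_1,\dots,\beta_m.$$ (For $n\ge1$ the norm of $B_\beta(x,u_j)$ on the lattice is exactly of order $1/(1+|u_j|)$, so this says that the sum converges absolutely, in the sense that $\sum_u\sum_\beta|g^\beta(x,u)|\prod_j\|B_{\beta_j}(x,u_j)\|<\infty$.) If $f^{(1)}$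 satisfies (i) and (ii) on the set of all $u\in\mathbb C^m$ whose coordinates lie, in some order, in $\tilde u_1+2\mathbb Z,\dots,\tilde u_m+2\mathbb Z$, then the sum over $u$ defining $f(x)$ is absolutely convergent for every $x\in D$, and $f$ satisfies (i) and (ii) on $D$; that is, $f$ has the $R$-matrix symmetry and solves the $SU(N)$ matrix difference equations $f(\dots,x_i+2,\dots)=Q(x;i)f(x)$. -/

import Mathlib

noncomputable section

namespace OffShellBethe

/-- The tensor product `(ℂ^d)^{⊗n}`; a vector is given by its components
`v^{α_1 … α_n}` in the canonical basis. -/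
abbrev TensorVec (d n : ℕ) : Type := (Fin n → Fin d) → ℂ

/-- `b(x) = x / (x - 2/N)`. -/
def bFun (N : ℕ) (x : ℂ) : ℂ := x / (x - 2 / (N : ℂ))

/-- `c(x) = (-2/N) / (x - 2/N)`. -/
def cFun (N : ℕ) (x : ℂ) : ℂ := (-2 / (N : ℂ)) / (x - 2 / (N : ℂ))

/-- The permutation operator `P_{ij}`, exchanging the tensor factors `i` and `j`. -/
def permOp {d n : ℕ} (i j : Fin n) : Module.End ℂ (TensorVec d n) :=
  LinearMap.funLeft ℂ ℂ (fun α : Fin n → Fin d => α ∘ Equiv.swap i j)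

/-- `R_{ij}(x) = b(x) 1 + c(x) P_{ij}` on `(ℂ^d)^{⊗n}`. The number `N` in `b` and `c` is a parameter
separate from the dimension `d` of the factors, because the same `b` and `c` are used
for the smaller factors `ℂ^{N-1}`. -/
def rMat (N : ℕ) {d n : ℕ} (i j : Fin n) (x : ℂ) : Module.End ℂ (TensorVec d n) :=
  bFun N x • 1 + cFun N x • permOp i j

/-- The monodromy matrix `T_{1…n,0}(x, u) = R_{10}(x_1 - u) ⋯ R_{n0}(x_n - u)`. The auxiliary space
is the factor with index `0 : Fin (n + 1)`, the quantum space `V_i` the one with index `i.succ`. -/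
def monodromy (N d : ℕ) {n : ℕ} (x : Fin n → ℂ) (u : ℂ) : Module.End ℂ (TensorVec d (n + 1)) :=
  (List.ofFn fun i : Fin n => rMat N i.succ 0 (x i - u)).prod

/-- `v ↦ v ⊗ e_b`, with `e_b` in the auxiliary space. -/
def auxIn {d n : ℕ} (b : Fin d) : TensorVec d n →ₗ[ℂ] TensorVec d (n + 1) where
  toFun v := fun γ => if γ 0 = b then v (Fin.tail γ) else 0
  map_add' v w := by funext γ; by_cases h : γ 0 = b <;> simp [h]
  map_smul' s v := by funext γ; by_cases h : γ 0 = b <;> simp [h]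

/-- The component along `e_a` of the auxiliary space. -/
def auxOut {d n : ℕ} (a : Fin d) : TensorVec d (n + 1) →ₗ[ℂ] TensorVec d n :=
  LinearMap.funLeft ℂ ℂ (fun α : Fin n → Fin d => (Fin.cons a α : Fin (n + 1) → Fin d))

/-- The block `T^a_b(x, u)` of the monodromy matrix, an operator on the quantum space. -/
def monodromyBlock (N : ℕ) {d n : ℕ} (a b : Fin d) (x : Fin n → ℂ) (u : ℂ) :
    Module.End ℂ (TensorVec d n) :=
  auxOut a ∘ₗ monodromy N d x u ∘ₗ auxIn b

/-- The operators `B_β(x, u) = T^1_β(x, u)`, `β = 2, …, N`, where `N = r + 1`. The basis of `ℂ^N` is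
indexed by `Fin (r + 1)` (its first vector by `0`), and the indices `2, …, N` correspond to
`Fin r` through `Fin.succ`. -/
def bOp {r n : ℕ} (β : Fin r) (x : Fin n → ℂ) (u : ℂ) : Module.End ℂ (TensorVec (r + 1) n) :=
  monodromyBlock (r + 1) 0 β.succ x u

/-- The reference state `Ω = |1 … 1⟩`. -/
def refState (r n : ℕ) : TensorVec (r + 1) n := Pi.single (fun _ => 0) 1

/-- `B_{β_m}(x, u_m) ⋯ B_{β_1}(x, u_1) Ω`. -/
def betheVector {r n m : ℕ} (x : Fin n → ℂ) (u : Fin m → ℂ) (β : Fin m → Fin r) :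
    TensorVec (r + 1) n :=
  (List.ofFn fun j : Fin m => bOp (β j) x (u j)).reverse.prod (refState r n)

/-- `g^β(x, u) = ∏_{i,j} ψ(x_i - u_j) ∏_{i<j} τ(u_i - u_j) f⁽¹⁾^β(u)`. -/
def gFun {r n m : ℕ} (ψ τ : ℂ → ℂ) (f₁ : (Fin m → ℂ) → TensorVec r m)
    (x : Fin n → ℂ) (u : Fin m → ℂ) : TensorVec r m :=
  ((∏ i : Fin n, ∏ j : Fin m, ψ (x i - u j)) *
    ∏ j : Fin m, ∏ i ∈ Finset.Iio j, τ (u i - u j)) • f₁ u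

/-- The summation points `u_j = ũ_j - 2 l_j`. -/
def latticePoint {m : ℕ} (u₀ : Fin m → ℂ) (l : Fin m → ℤ) : Fin m → ℂ :=
  fun j => u₀ j - 2 * (l j : ℂ)

/-- The term of the Bethe Ansatz sum that belongs to `u`, summed over `β_1, …, β_m`. -/
def betheTerm {r n m : ℕ} (ψ τ : ℂ → ℂ) (f₁ : (Fin m → ℂ) → TensorVec r m)
    (x : Fin n → ℂ) (u : Fin m → ℂ) : TensorVec (r + 1) n :=
  ∑ β : Fin m → Fin r, gFun ψ τ f₁ x u β • betheVector x u β

/-- The off-shell Bethe Ansatz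
`f(x) = ∑_u B_{β_m}(x, u_m) ⋯ B_{β_1}(x, u_1) Ω g^{β_1 … β_m}(x, u)`. -/
def betheAnsatz {r n m : ℕ} (ψ τ : ℂ → ℂ) (f₁ : (Fin m → ℂ) → TensorVec r m) (u₀ : Fin m → ℂ)
    (x : Fin n → ℂ) : TensorVec (r + 1) n :=
  ∑' l : Fin m → ℤ, betheTerm ψ τ f₁ x (latticePoint u₀ l)

/-- The points `x` at which no `x_i - u_j` meets the pole `2/N` of `B` and the sum over `u` converges
absolutely. As a function of `u_j`, the operator `B_β(x, u_j)` has exact order `1/|u_j|` on the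
lattice (for `n ≥ 1`), so the second clause says that
`∑_u ∑_β |g^β(x, u)| ∏_j ‖B_{β_j}(x, u_j)‖` is finite. -/
def convergenceDomain {r m : ℕ} (n : ℕ) (ψ τ : ℂ → ℂ) (f₁ : (Fin m → ℂ) → TensorVec r m)
    (u₀ : Fin m → ℂ) : Set (Fin n → ℂ) :=
  {x | (∀ (i : Fin n) (j : Fin m) (k : ℤ),
          x i - u₀ j ≠ 2 / ((r + 1 : ℕ) : ℂ) + 2 * (k : ℂ)) ∧
       ∀ β : Fin m → Fin r, Summable fun l : Fin m → ℤ =>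
          ‖gFun ψ τ f₁ x (latticePoint u₀ l) β‖ * ∏ j, (1 + ‖latticePoint u₀ l j‖)⁻¹}

/-- The symmetry condition
`f^{… ji …}(…, x_j, x_i, …) = R_{ij}(x_i - x_j) f^{… ij …}(…, x_i, x_j, …)` for neighbouring `i, j`,
wherever both points lie in `D` and `R_{ij}(x_i - x_j)` is regular. -/
def SymmetryCondition (N : ℕ) {d n : ℕ} (D : Set (Fin n → ℂ))
    (f : (Fin n → ℂ) → TensorVec d n) : Prop :=
  ∀ x ∈ D, ∀ i j : Fin n, (j : ℕ) = i + 1 → x ∘ Equiv.swap i j ∈ D →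
    x i - x j ≠ 2 / (N : ℂ) →
    ∀ α : Fin n → Fin d,
      f (x ∘ Equiv.swap i j) (α ∘ Equiv.swap i j) = rMat N i j (x i - x j) (f x) α

/-- `Q(x; i) = R_{i+1,i}(x_{i+1} - x_i - 2) ⋯ R_{n,i}(x_n - x_i - 2)
R_{1,i}(x_1 - x_i) ⋯ R_{i-1,i}(x_{i-1} - x_i)`. -/
def qMat (N : ℕ) {d n : ℕ} (x : Fin n → ℂ) (i : Fin n) : Module.End ℂ (TensorVec d n) :=
  (((List.finRange n).filter fun j => i < j).map fun j => rMat N j i (x j - (x i + 2))).prod *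
    (((List.finRange n).filter fun j => j < i).map fun j => rMat N j i (x j - x i)).prod

/-- The matrix difference equations `f(…, x_i + 2, …) = Q(x; i) f(x)`, `i = 1, …, n`,
wherever both points lie in `D` and `Q(x; i)` is regular. -/
def DifferenceEquations (N : ℕ) {d n : ℕ} (D : Set (Fin n → ℂ))
    (f : (Fin n → ℂ) → TensorVec d n) : Prop :=
  ∀ x ∈ D, ∀ i : Fin n, Function.update x i (x i + 2) ∈ D →
    (∀ j, i < j → x j - (x i + 2) ≠ 2 / (N : ℂ)) →
    (∀ j, j < i → x j - x i ≠ 2 / (N : ℂ)) →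
    f (Function.update x i (x i + 2)) = qMat N x i (f x)

/-- The points whose coordinates lie, in some order, in the classes `ũ_1 + 2ℤ, …, ũ_m + 2ℤ`. -/
def permutedLattice {m : ℕ} (u₀ : Fin m → ℂ) : Set (Fin m → ℂ) :=
  {u | ∃ σ : Equiv.Perm (Fin m), ∀ j, ∃ k : ℤ, u j = u₀ (σ j) + 2 * (k : ℂ)}

end OffShellBethe

end

/-! Write η = 2/N. The `R`-matrix symmetry holds term by term in the sum over u. By the Yang–Baxter
equation the braid form P R intertwines the operators B(x, u) with those for exchanged arguments
(`monodromyBlock_rCheck`). It fixes Ω, and the scalar weight is symmetric in x.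

On a permutation invariant domain, symmetry reduces all difference equations to one cyclicity
relation: moving the first argument to the last place, together with its tensor factor, and adding 2
to it leaves f unchanged (`Cyclic.differenceEquations`). Conversely, f⁽¹⁾ is cyclic on the lattice
(`DifferenceEquations.cyclic`). It remains to compare, for each basis vector of the moved factor, a
component along the last site with one along the first.

For e_1 the two agree term by term, by the equation for ψ. For an excited vector the denominators
are cleared and the argument of the split site becomes a free variable z. The component is then a
polynomial in z of degree less than the number of u's. Lagrange interpolation writes it as a sum
over the magnon j that sits on the site (`auxOut_succ_bethe`, `lastOut_succ_bethe`). The values at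
the nodes are accessible because the symmetry of f⁽¹⁾ makes the Bethe vector symmetric in u
(`bethe_perm`), so that any u_j may act first. Cyclicity of f⁽¹⁾ and the equations for ψ and τ
identify the last-site term at u_j + 2 with the first-site term at u_j (`lastTerm_update`), and a
translation of the lattice finishes.

Interpolation needs distinct nodes, while classes ũ_j + 2ℤ may coincide. Then continuity gives τ(0)
= 0, so coinciding coordinates have weight zero. It also gives τ(-2) = -τ(2), so the points at which
the shift of u_j runs into some u_k cancel in pairs (`sum_tsum_eq_of_swap`). All rearrangements are
legitimate because B, and also the coefficient c of a split-off magnon, decay like 1/(1+|u_j|), so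
one majorant serves every sum. -/

noncomputable section

namespace OffShellBethe

/-! ### Splitting the monodromy matrix at its first and last site. -/

/-- The component along `e_a` of the last tensor factor. -/
def lastOut {d n : ℕ} (a : Fin d) : TensorVec d (n + 1) →ₗ[ℂ] TensorVec d n :=
  LinearMap.funLeft ℂ ℂ (fun α : Fin n → Fin d => (Fin.snoc α a : Fin (n + 1) → Fin d))

theorem auxOut_apply {d n : ℕ} (a : Fin d) (v : TensorVec d (n + 1)) (α : Fin n → Fin d) :
    auxOut a v α = v (Fin.cons a α) := rfl

theorem lastOut_apply {d n : ℕ} (a : Fin d) (v : TensorVec d (n + 1)) (α : Fin n → Fin d) :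
    lastOut a v α = v (Fin.snoc α a) := rfl

theorem lastOut_auxOut {d n : ℕ} (a e : Fin d) (w : TensorVec d (n + 2)) :
    lastOut e (auxOut a w) = auxOut a (lastOut e w) := by
  funext α
  simp only [lastOut_apply, auxOut_apply, Fin.cons_snoc_eq_snoc_cons]

theorem auxIn_apply {d n : ℕ} (b : Fin d) (v : TensorVec d n) (γ : Fin (n + 1) → Fin d) :
    auxIn b v γ = if γ 0 = b then v (Fin.tail γ) else 0 := rfl

theorem rMat_apply (N : ℕ) {d n : ℕ} (i j : Fin n) (x : ℂ) (v : TensorVec d n)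
    (α : Fin n → Fin d) :
    rMat N i j x v α = bFun N x * v α + cFun N x * v (α ∘ Equiv.swap i j) := rfl

/-- Reindexing of the components intertwines `R`-matrices. -/
theorem funLeft_rMat (N : ℕ) {d p q : ℕ} (g : (Fin p → Fin d) → (Fin q → Fin d))
    (i j : Fin p) (i' j' : Fin q)
    (hg : ∀ α, g (α ∘ Equiv.swap i j) = g α ∘ Equiv.swap i' j') (x : ℂ) (v : TensorVec d q) :
    LinearMap.funLeft ℂ ℂ g (rMat N i' j' x v) = rMat N i j x (LinearMap.funLeft ℂ ℂ g v) := by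
  funext α
  simp only [LinearMap.funLeft_apply, rMat_apply, hg]

theorem list_prod_intertwine {V W : Type*} [AddCommGroup V] [Module ℂ V] [AddCommGroup W]
    [Module ℂ W] {n : ℕ} (Φ : V →ₗ[ℂ] W) (F : Fin n → Module.End ℂ V)
    (G : Fin n → Module.End ℂ W) (h : ∀ i v, Φ (F i v) = G i (Φ v)) (v : V) :
    Φ ((List.ofFn F).prod v) = (List.ofFn G).prod (Φ v) := by
  induction n generalizing v with
  | zero => simp
  | succ n ih =>
    simp only [List.ofFn_succ, List.prod_cons, Module.End.mul_apply]
    rw [h, ih (fun i => F i.succ) (fun i => G i.succ) (fun i v => h _ _)]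

theorem cons_comp_swap_succ {β : Type*} {n : ℕ} (a : β) (α : Fin n → β) (i j : Fin n) :
    (Fin.cons a (α ∘ Equiv.swap i j) : Fin (n + 1) → β) =
      (Fin.cons a α : Fin (n + 1) → β) ∘ Equiv.swap i.succ j.succ := by
  funext k
  refine Fin.cases ?_ (fun k => ?_) k
  · have : Equiv.swap i.succ j.succ (0 : Fin (n + 1)) = 0 :=
      Equiv.swap_apply_of_ne_of_ne (Fin.succ_ne_zero _).symm (Fin.succ_ne_zero _).symm
    simp [this]
  · have : Equiv.swap i.succ j.succ k.succ = (Equiv.swap i j k).succ := by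
      simp only [Equiv.swap_apply_def, Fin.succ_inj]
      split_ifs <;> rfl
    simp [this]

theorem snoc_comp_swap_castSucc {β : Type*} {n : ℕ} (a : β) (α : Fin n → β) (i j : Fin n) :
    (Fin.snoc (α ∘ Equiv.swap i j) a : Fin (n + 1) → β) =
      (Fin.snoc α a : Fin (n + 1) → β) ∘ Equiv.swap i.castSucc j.castSucc := by
  funext k
  refine Fin.lastCases ?_ (fun k => ?_) k
  · have : Equiv.swap i.castSucc j.castSucc (Fin.last n) = Fin.last n :=
      Equiv.swap_apply_of_ne_of_ne (Fin.castSucc_lt_last _).ne' (Fin.castSucc_lt_last _).ne'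
    simp [this]
  · have : Equiv.swap i.castSucc j.castSucc k.castSucc = (Equiv.swap i j k).castSucc := by
      simp only [Equiv.swap_apply_def, Fin.castSucc_inj]
      split_ifs <;> rfl
    simp [this]

theorem monodromyBlock_apply (N : ℕ) {d n : ℕ} (a b : Fin d) (x : Fin n → ℂ) (u : ℂ)
    (v : TensorVec d n) (α : Fin n → Fin d) :
    monodromyBlock N a b x u v α = monodromy N d x u (auxIn b v) (Fin.cons a α) := rfl

theorem tail_comp_swap {β : Type*} {n : ℕ} (α : Fin (n + 1) → β) (i j : Fin n) :
    Fin.tail (α ∘ Equiv.swap i.succ j.succ) = Fin.tail α ∘ Equiv.swap i j := by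
  have := cons_comp_swap_succ (α 0) (Fin.tail α) i j
  rw [Fin.cons_self_tail] at this
  rw [← this, Fin.tail_cons]

/-- Splitting off the first site, `T = R_{10} S`. -/
theorem auxOut_monodromyBlock (N : ℕ) {d n : ℕ} (a b e : Fin d) (x : Fin (n + 1) → ℂ) (u : ℂ)
    (v : TensorVec d (n + 1)) :
    auxOut e (monodromyBlock N a b x u v) =
      bFun N (x 0 - u) • monodromyBlock N a b (Fin.tail x) u (auxOut e v) +
      cFun N (x 0 - u) • monodromyBlock N e b (Fin.tail x) u (auxOut a v) := by
  -- The reindexing freezes the first quantum site at `e` and keeps the auxiliary space in place;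
  -- the remaining factors do not touch that site.
  have key : ∀ (e : Fin d) (w : TensorVec d (n + 2)),
      LinearMap.funLeft ℂ ℂ (fun γ : Fin (n + 1) → Fin d =>
        (Fin.cons (γ 0) (Fin.cons e (Fin.tail γ) : Fin (n + 1) → Fin d) : Fin (n + 2) → Fin d))
        ((List.ofFn fun i : Fin n => rMat N i.succ.succ 0 (x i.succ - u)).prod w) =
      monodromy N d (Fin.tail x) u (LinearMap.funLeft ℂ ℂ (fun γ : Fin (n + 1) → Fin d =>
        (Fin.cons (γ 0) (Fin.cons e (Fin.tail γ) : Fin (n + 1) → Fin d) : Fin (n + 2) → Fin d))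
        w) := by
    intro e w
    refine list_prod_intertwine _ _ _ (fun i v => ?_) _
    refine funLeft_rMat N _ _ _ _ _ (fun α => ?_) _ _
    funext k
    have h2 : ∀ (j : Fin n), Equiv.swap i.succ.succ (0 : Fin (n + 2)) j.succ.succ =
        if j = i then 0 else j.succ.succ := by
      intro j
      simp only [Equiv.swap_apply_def, Fin.succ_inj]
      have := (Fin.succ_ne_zero j.succ)
      simp [this]
    have h3 : ∀ (j : Fin n), Equiv.swap i.succ (0 : Fin (n + 1)) j.succ =
        if j = i then 0 else j.succ := by
      intro j
      simp only [Equiv.swap_apply_def, Fin.succ_inj]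
      have := (Fin.succ_ne_zero j)
      simp [this]
    have h4 : Equiv.swap i.succ.succ (0 : Fin (n + 2)) 1 = 1 := by
      apply Equiv.swap_apply_of_ne_of_ne
      · rw [← Fin.succ_zero_eq_one]
        intro h
        exact (Fin.succ_ne_zero i) (Fin.succ_injective _ h).symm
      · simp
    refine Fin.cases ?_ (fun k => ?_) k
    · simp [Fin.tail]
    · refine Fin.cases ?_ (fun k => ?_) k
      · simp only [Function.comp, Fin.succ_zero_eq_one, h4]
        rw [← Fin.succ_zero_eq_one]; simp
      · simp only [Fin.cons_succ, Function.comp, Fin.tail, h2, h3]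
        split_ifs <;> simp [Fin.tail]
  have hin : ∀ e : Fin d, LinearMap.funLeft ℂ ℂ (fun γ : Fin (n + 1) → Fin d =>
        (Fin.cons (γ 0) (Fin.cons e (Fin.tail γ) : Fin (n + 1) → Fin d) : Fin (n + 2) → Fin d))
        (auxIn b v) = auxIn b (auxOut e v) := by
    intro e
    funext γ
    simp [LinearMap.funLeft_apply, auxIn_apply, auxOut_apply]
  funext α
  rw [auxOut_apply, monodromyBlock_apply, monodromy, List.ofFn_succ, List.prod_cons,
    Module.End.mul_apply, rMat_apply]
  have hsw : (Fin.cons a (Fin.cons e α : Fin (n + 1) → Fin d) : Fin (n + 2) → Fin d) ∘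
      Equiv.swap (Fin.succ 0) 0 = Fin.cons e (Fin.cons a α : Fin (n + 1) → Fin d) := by
    funext k
    refine Fin.cases ?_ (fun k => ?_) k
    · simp only [Function.comp, Equiv.swap_apply_right]; simp
    · refine Fin.cases ?_ (fun k => ?_) k
      · simp only [Function.comp, Equiv.swap_apply_left]; simp
      · have : Equiv.swap (Fin.succ 0) (0 : Fin (n + 2)) k.succ.succ = k.succ.succ := by
          apply Equiv.swap_apply_of_ne_of_ne
          · intro h
            exact (Fin.succ_ne_zero k) (Fin.succ_injective _ h)
          · exact Fin.succ_ne_zero _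
        simp only [Function.comp, this, Fin.cons_succ]
  rw [hsw]
  have k1 := congrFun (key e (auxIn b v)) (Fin.cons a α)
  have k2 := congrFun (key a (auxIn b v)) (Fin.cons e α)
  rw [hin] at k1 k2
  simp only [LinearMap.funLeft_apply, Fin.cons_zero, Fin.tail_cons] at k1 k2
  rw [k1, k2]
  rfl

/-- Splitting off the last site, `T = S R_{n0}`. -/
theorem lastOut_monodromyBlock (N : ℕ) {d n : ℕ} (a b e : Fin d) (x : Fin (n + 1) → ℂ) (u : ℂ)
    (v : TensorVec d (n + 1)) :
    lastOut e (monodromyBlock N a b x u v) =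
      bFun N (x (Fin.last n) - u) • monodromyBlock N a b (Fin.init x) u (lastOut e v) +
      if e = b then cFun N (x (Fin.last n) - u) •
        ∑ c, monodromyBlock N a c (Fin.init x) u (lastOut c v) else 0 := by
  have key : ∀ (w : TensorVec d (n + 2)),
      lastOut e ((List.ofFn fun i : Fin n =>
        rMat N i.castSucc.succ 0 (x i.castSucc - u)).prod w) =
      monodromy N d (Fin.init x) u (lastOut e w) := by
    intro w
    refine list_prod_intertwine _ _ _ (fun i v => ?_) _
    refine funLeft_rMat N _ _ _ _ _ (fun α => ?_) _ _
    exact snoc_comp_swap_castSucc _ _ _ _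
  have hin : lastOut e (rMat N (Fin.last n).succ 0 (x (Fin.last n) - u) (auxIn b v)) =
      bFun N (x (Fin.last n) - u) • auxIn b (lastOut e v) +
      if e = b then cFun N (x (Fin.last n) - u) • ∑ c, auxIn c (lastOut c v) else 0 := by
    funext γ
    rw [lastOut_apply, rMat_apply]
    have h0 : (Fin.snoc γ e : Fin (n + 2) → Fin d) 0 = γ 0 := by
      rw [← Fin.castSucc_zero, Fin.snoc_castSucc]
    have h1 : Fin.tail (Fin.snoc γ e : Fin (n + 2) → Fin d) = Fin.snoc (Fin.tail γ) e := by
      funext k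
      refine Fin.lastCases ?_ (fun k => ?_) k
      · simp only [Fin.tail, Fin.succ_last, Fin.snoc_last]
      · simp only [Fin.tail, Fin.succ_castSucc, Fin.snoc_castSucc]
    have h2 : Fin.tail ((Fin.snoc γ e : Fin (n + 2) → Fin d) ∘
        Equiv.swap (Fin.last (n + 1)) 0) = Fin.snoc (Fin.tail γ) (γ 0) := by
      funext k
      refine Fin.lastCases ?_ (fun k => ?_) k
      · simp only [Fin.tail, Function.comp, Fin.succ_last, Equiv.swap_apply_left, h0,
          Fin.snoc_last]
      · have : Equiv.swap (Fin.last (n + 1)) (0 : Fin (n + 2)) k.succ.castSucc =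
            k.succ.castSucc :=
          Equiv.swap_apply_of_ne_of_ne (Fin.castSucc_lt_last _).ne
            (by rw [← Fin.succ_castSucc]; exact Fin.succ_ne_zero _)
        simp only [Fin.tail, Function.comp, Fin.succ_castSucc, this, Fin.snoc_castSucc]
    have h3 : ((Fin.snoc γ e : Fin (n + 2) → Fin d) ∘ Equiv.swap (Fin.last (n + 1)) 0) 0 = e := by
      simp
    simp only [auxIn_apply, h0, h1, Fin.succ_last, h2, h3]
    by_cases heb : e = b
    · simp only [heb, if_true, Pi.add_apply, Pi.smul_apply, smul_eq_mul, auxIn_apply,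
        lastOut_apply, Finset.sum_apply]
      simp
    · simp [heb, auxIn_apply, lastOut_apply]
  have hmono : ∀ w, monodromy N d x u w = (List.ofFn fun i : Fin n =>
        rMat N i.castSucc.succ 0 (x i.castSucc - u)).prod
        (rMat N (Fin.last n).succ 0 (x (Fin.last n) - u) w) := by
    intro w
    rw [monodromy, List.ofFn_succ', List.concat_eq_append, List.prod_append,
      List.prod_singleton, Module.End.mul_apply]
  change lastOut e (auxOut a (monodromy N d x u (auxIn b v))) = _
  rw [lastOut_auxOut, hmono, key, hin, map_add, map_smul, map_add, map_smul]
  congr 1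
  split_ifs
  · rw [map_smul, map_smul, map_sum, map_sum]; rfl
  · simp

theorem monodromyBlock_zero_sites (N : ℕ) {d : ℕ} (a b : Fin d) (x : Fin 0 → ℂ) (u : ℂ)
    (w : TensorVec d 0) : monodromyBlock N a b x u w = if a = b then w else 0 := by
  funext α
  rw [monodromyBlock_apply]
  simp only [monodromy, List.ofFn_zero, List.prod_nil, Module.End.one_apply, auxIn_apply,
    Fin.cons_zero, Fin.tail_cons]
  split_ifs <;> rfl

theorem tensorVec_ext_auxOut {d n : ℕ} {v w : TensorVec d (n + 1)}
    (h : ∀ a, auxOut a v = auxOut a w) : v = w := by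
  funext α
  have := congrFun (h (α 0)) (Fin.tail α)
  simpa [auxOut_apply] using this

/-! ### Exchange relations of the monodromy blocks. -/

section Exchange

variable {V : Type*} [AddCommGroup V] [Module ℂ V] {d : ℕ}

/-- The `RTT` relations at the spectral parameters `u`, `v`. -/
def RTT (η : ℂ) (S : Fin d → Fin d → ℂ → Module.End ℂ V) (u v : ℂ) : Prop :=
  ∀ (a b c e : Fin d) (w : V),
    (u - v) • (S a c u (S b e v w) - S b e v (S a c u w)) =
      η • (S a e u (S b c v w) - S a e v (S b c u w))

/-- The exchange relations of a row of operators at the spectral parameters `u`, `v`. -/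
def RowExchange {ι : Type*} (η : ℂ) (B : ι → ℂ → Module.End ℂ V) (u v : ℂ) : Prop :=
  ∀ (β β' : ι) (w : V),
    (u - v) • B β u (B β' v w) - η • B β' u (B β v w) = (u - v - η) • B β' v (B β u w)

theorem RTT.rowExchange {η : ℂ} {S : Fin d → Fin d → ℂ → Module.End ℂ V} {u v : ℂ}
    (h : RTT η S u v) (a : Fin d) : RowExchange η (S a) u v := by
  intro β β' w
  have := h a a β β' w
  linear_combination (norm := module) this

/-- The numerator of `R_{10}(z - u) S(u)` on the components along the site that is added. -/
def opL (η z : ℂ) (S : Fin d → Fin d → ℂ → Module.End ℂ V) (a b : Fin d) (u : ℂ) :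
    Module.End ℂ (Fin d → V) :=
  LinearMap.pi fun e => (z - u) • (S a b u ∘ₗ LinearMap.proj e) -
    η • (S e b u ∘ₗ LinearMap.proj a)

theorem opL_apply (η z : ℂ) (S : Fin d → Fin d → ℂ → Module.End ℂ V) (a b : Fin d) (u : ℂ)
    (w : Fin d → V) (e : Fin d) :
    opL η z S a b u w e = (z - u) • S a b u (w e) - η • S e b u (w a) := rfl

/-- The numerator of `S(u) R_{n0}(z - u)` on the components along the site that is added. -/
def opR (η z : ℂ) (S : Fin d → Fin d → ℂ → Module.End ℂ V) (a b : Fin d) (u : ℂ) :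
    Module.End ℂ (Fin d → V) :=
  LinearMap.pi fun e => (z - u) • (S a b u ∘ₗ LinearMap.proj e) -
    if e = b then η • ∑ c, S a c u ∘ₗ LinearMap.proj c else 0

theorem opR_apply (η z : ℂ) (S : Fin d → Fin d → ℂ → Module.End ℂ V) (a b : Fin d) (u : ℂ)
    (w : Fin d → V) (e : Fin d) :
    opR η z S a b u w e = (z - u) • S a b u (w e) -
      if e = b then η • ∑ c, S a c u (w c) else 0 := by
  by_cases h : e = b <;> simp [opR, h, LinearMap.pi_apply]

/-- One site is added on the left. Working with numerators keeps z unrestricted, which matters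
later: interpolation evaluates at z = u_j + η, where the `R`-matrix itself has a pole. -/
theorem RTT.opL {η : ℂ} {S : Fin d → Fin d → ℂ → Module.End ℂ V} {u v : ℂ}
    (h : RTT η S u v) (z : ℂ) : RTT η (opL η z S) u v := by
  intro a b c f w
  funext e
  have h1 := h a b c f (w e)
  have h2 := h a e c f (w b)
  have h3 := h e a c f (w b)
  have h4 := h e b c f (w a)
  simp only [Pi.smul_apply, Pi.sub_apply, opL_apply, map_sub, map_smul]
  linear_combination (norm := module) ((z - u) * (z - v)) • h1 - (η * (z - u)) • h2 + (η ^ 2) • h3 -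
    (η * (z - v)) • h4

/-- A site added on the right mixes only blocks of the same row, so the row relations alone are
inherited from the row relations, again for arbitrary z. -/
theorem RowExchange.opR {η : ℂ} {S : Fin d → Fin d → ℂ → Module.End ℂ V} {a : Fin d} {u v : ℂ}
    (h : RowExchange η (S a) u v) (z : ℂ) : RowExchange η (opR η z S a) u v := by
  intro b c w
  funext e
  have h1 := h b c (w e)
  have hb : (u - v) • ∑ f, S a f u (S a c v (w f)) - η • S a c u (∑ f, S a f v (w f)) =
      (u - v - η) • S a c v (∑ f, S a f u (w f)) := by
    simp only [map_sum, Finset.smul_sum, ← Finset.sum_sub_distrib]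
    exact Finset.sum_congr rfl fun f _ => h f c (w f)
  have hb' : (u - v) • ∑ f, S a f u (S a b v (w f)) - η • S a b u (∑ f, S a f v (w f)) =
      (u - v - η) • S a b v (∑ f, S a f u (w f)) := by
    simp only [map_sum, Finset.smul_sum, ← Finset.sum_sub_distrib]
    exact Finset.sum_congr rfl fun f _ => h f b (w f)
  have hc : (u - v) • S a b u (∑ f, S a f v (w f)) - η • ∑ f, S a f u (S a b v (w f)) =
      (u - v - η) • ∑ f, S a f v (S a b u (w f)) := by
    simp only [map_sum, Finset.smul_sum, ← Finset.sum_sub_distrib]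
    exact Finset.sum_congr rfl fun f _ => h b f (w f)
  have e1 : ∀ (x y : ℂ) (c : Fin d), ∑ f, S a f x (OffShellBethe.opR η z S a c y w f) =
      (z - y) • ∑ f, S a f x (S a c y (w f)) - η • S a c x (∑ f, S a f y (w f)) := by
    intro x y c
    simp only [opR_apply, map_sub, map_smul, Finset.sum_sub_distrib, Finset.smul_sum]
    congr 1
    rw [Finset.sum_eq_single c]
    · simp [Finset.smul_sum]
    · intro f _ hf; simp [hf]
    · simp
  have e2 : ∀ (x y : ℂ) (b c : Fin d),
      OffShellBethe.opR η z S a b x (OffShellBethe.opR η z S a c y w) e =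
      (z - x) • ((z - y) • S a b x (S a c y (w e)) -
        if e = c then η • S a b x (∑ f, S a f y (w f)) else 0) -
      if e = b then η • ((z - y) • ∑ f, S a f x (S a c y (w f)) -
        η • S a c x (∑ f, S a f y (w f))) else 0 := by
    intro x y b c
    rw [opR_apply, e1, opR_apply]
    split_ifs <;> simp only [map_sub, map_smul, sub_zero]
  simp only [Pi.smul_apply, Pi.sub_apply, e2]
  by_cases hbe : e = b <;> by_cases hce : e = c
  · subst hbe; subst hce
    simp only [if_true]
    linear_combination (norm := module) ((z - u) * (z - v)) • h1 - (η * (z - u)) • hc - (η * (z - v)) • hb +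
      (η ^ 2) • hb
  · subst hbe
    simp only [if_true, hce, if_false]
    linear_combination (norm := module) ((z - u) * (z - v)) • h1 - (η * (z - v)) • hb
  · subst hce
    simp only [if_true, hbe, if_false]
    linear_combination (norm := module) ((z - u) * (z - v)) • h1 - (η * (z - u)) • hc + (η ^ 2) • hb'
  · simp only [hbe, hce, if_false]
    linear_combination (norm := module) ((z - u) * (z - v)) • h1

end Exchange

/-- Induction on the sites: without sites the blocks are δ_{ab}, and `RTT.opL` at z = x_1 adds a
site. Regularity lets the factors x_1 - u - η and x_1 - v - η be cancelled. -/
theorem RTT_monodromyBlock (N : ℕ) {d n : ℕ} (x : Fin n → ℂ) (u v : ℂ)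
    (hu : ∀ i, x i - u ≠ 2 / (N : ℂ)) (hv : ∀ i, x i - v ≠ 2 / (N : ℂ)) :
    RTT (2 / (N : ℂ)) (fun a b u => monodromyBlock N (d := d) a b x u) u v := by
  induction n with
  | zero =>
    intro a b c e w
    simp only [monodromyBlock_zero_sites]
    split_ifs <;> simp
  | succ n ih =>
    intro a b c e w
    set η : ℂ := 2 / (N : ℂ) with hη
    have ih' := (ih (Fin.tail x) (fun i => hu i.succ) (fun i => hv i.succ)).opL (x 0)
    have hslice : ∀ (a b : Fin d) (u : ℂ) (w : TensorVec d (n + 1)), x 0 - u ≠ η →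
        opL η (x 0) (fun a b u => monodromyBlock N (d := d) a b (Fin.tail x) u) a b u
          (fun e => auxOut e w) =
        fun e => (x 0 - u - η) • auxOut e (monodromyBlock N a b x u w) := by
      intro a b u w h
      have h' := sub_ne_zero.mpr h
      funext e
      rw [opL_apply, auxOut_monodromyBlock, bFun, cFun, ← hη]
      match_scalars
      · field_simp
      · rw [neg_div, ← hη]; field_simp

    have hu0 := hu 0
    have hv0 := hv 0
    refine tensorVec_ext_auxOut fun f => ?_
    have := congrFun (ih' a b c e (fun f => auxOut f w)) f
    simp only [hslice _ _ _ _ hu0, hslice _ _ _ _ hv0] at this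
    have hsm : ∀ (a b : Fin d) (u : ℂ) (k : ℂ) (w : TensorVec d (n + 1)), x 0 - u ≠ η →
        opL η (x 0) (fun a b u => monodromyBlock N (d := d) a b (Fin.tail x) u) a b u
          (fun e => k • auxOut e w) =
        fun e => k • (x 0 - u - η) • auxOut e (monodromyBlock N a b x u w) := by
      intro a b u k w h
      have := hslice a b u w h
      have e1 : (fun e => k • auxOut e w) = k • fun e => auxOut (n := n) e w := rfl
      rw [e1, map_smul, this]
      rfl
    simp only [hsm _ _ _ _ _ hu0, hsm _ _ _ _ _ hv0, Pi.smul_apply, Pi.sub_apply] at this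
    have hp := sub_ne_zero.mpr hu0
    have hq := sub_ne_zero.mpr hv0
    simp only [map_smul, map_sub]
    have hpq := mul_ne_zero hp hq
    refine smul_right_injective _ hpq ?_
    simp only
    linear_combination (norm := module) this

/-! ### Yang–Baxter: exchanging neighbouring quantum sites. -/

/-- The braid form `P_{ij} R_{ij}(x)` of the `R`-matrix. -/
def rCheck (N : ℕ) {d n : ℕ} (i j : Fin n) (x : ℂ) : Module.End ℂ (TensorVec d n) :=
  permOp i j * rMat N i j x

theorem rCheck_apply (N : ℕ) {d n : ℕ} (i j : Fin n) (x : ℂ) (v : TensorVec d n)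
    (α : Fin n → Fin d) :
    rCheck N i j x v α = bFun N x * v (α ∘ Equiv.swap i j) + cFun N x * v α := by
  have : (α ∘ Equiv.swap i j) ∘ Equiv.swap i j = α := by
    funext k; simp
  change rMat N i j x v (α ∘ Equiv.swap i j) = _
  rw [rMat_apply, this]

theorem auxOut_rCheck_succ (N : ℕ) {d n : ℕ} (i j : Fin n) (x : ℂ) (v : TensorVec d (n + 1))
    (a : Fin d) : auxOut a (rCheck N i.succ j.succ x v) = rCheck N i j x (auxOut a v) := by
  funext α
  simp only [auxOut_apply, rCheck_apply, cons_comp_swap_succ]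

theorem cons_cons_comp_swap {β : Type*} {n : ℕ} (a b : β) (α : Fin n → β) :
    (Fin.cons a (Fin.cons b α : Fin (n + 1) → β) : Fin (n + 2) → β) ∘ Equiv.swap 0 1 =
      Fin.cons b (Fin.cons a α : Fin (n + 1) → β) := by
  funext k
  refine Fin.cases ?_ (fun k => ?_) k
  · simp only [Function.comp, Equiv.swap_apply_left, Fin.cons_zero, Fin.cons_one]
  · refine Fin.cases ?_ (fun k => ?_) k
    · simp only [Function.comp, Fin.succ_zero_eq_one, Equiv.swap_apply_right, Fin.cons_zero,
        Fin.cons_one]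
    · have : Equiv.swap (0 : Fin (n + 2)) 1 k.succ.succ = k.succ.succ :=
        Equiv.swap_apply_of_ne_of_ne (Fin.succ_ne_zero _) (by
          rw [← Fin.succ_zero_eq_one]
          exact fun h => Fin.succ_ne_zero k (Fin.succ_injective _ h))
      simp only [Function.comp, this, Fin.cons_succ]

theorem auxOut_auxOut_rCheck (N : ℕ) {d n : ℕ} (x : ℂ) (v : TensorVec d (n + 2))
    (a b : Fin d) : auxOut b (auxOut a (rCheck N 0 1 x v)) =
      bFun N x • auxOut a (auxOut b v) + cFun N x • auxOut b (auxOut a v) := by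
  funext α
  simp only [auxOut_apply, rCheck_apply, cons_cons_comp_swap, Pi.add_apply, Pi.smul_apply,
    smul_eq_mul]

/-- Stripping first sites reduces to the exchange of the first two. There the claim is the
Yang–Baxter equation in components, an identity of rational functions of the arguments. -/
theorem monodromyBlock_rCheck (N : ℕ) {d n : ℕ} (a b : Fin d) (x : Fin n → ℂ) (u : ℂ)
    (i j : Fin n) (hij : (j : ℕ) = i + 1) (hx : x i - x j ≠ 2 / (N : ℂ))
    (hu : ∀ i, x i - u ≠ 2 / (N : ℂ)) (v : TensorVec d n) :
    monodromyBlock N a b (x ∘ Equiv.swap i j) u (rCheck N i j (x i - x j) v) =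
      rCheck N i j (x i - x j) (monodromyBlock N a b x u v) := by
  induction n generalizing a with
  | zero => exact i.elim0
  | succ n ih =>
    obtain rfl | ⟨i, rfl⟩ := Fin.eq_zero_or_eq_succ i
    · obtain _ | n := n
      · exact absurd j.2 (by rw [hij]; simp)
      obtain rfl : j = 1 := Fin.ext (by simpa using hij)
      refine tensorVec_ext_auxOut fun e => tensorVec_ext_auxOut fun f => ?_
      have ht : Fin.tail (Fin.tail (x ∘ Equiv.swap 0 1)) = Fin.tail (Fin.tail x) := by
        funext k
        have : Equiv.swap (0 : Fin (n + 2)) 1 k.succ.succ = k.succ.succ :=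
          Equiv.swap_apply_of_ne_of_ne (Fin.succ_ne_zero _) (by
            rw [← Fin.succ_zero_eq_one]
            exact fun h => Fin.succ_ne_zero k (Fin.succ_injective _ h))
        simp only [Fin.tail, Function.comp, this]
      have h0 : (x ∘ Equiv.swap 0 1) 0 = x 1 := by simp
      have h1 : Fin.tail (x ∘ Equiv.swap 0 1) 0 = x 0 := by simp [Fin.tail]
      have h2 : Fin.tail x 0 = x 1 := by simp [Fin.tail]
      have hp := sub_ne_zero.mpr (hu 0)
      have hq := sub_ne_zero.mpr (hu 1)
      have hr := sub_ne_zero.mpr hx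
      rw [auxOut_auxOut_rCheck]
      simp only [auxOut_monodromyBlock, map_add, map_smul, auxOut_auxOut_rCheck, ht, h0, h1, h2,
        bFun, cFun, neg_div]
      generalize (2 / (N : ℂ)) = η at *
      match_scalars <;> field_simp
      all_goals ring
    · obtain ⟨j, rfl⟩ : ∃ j', j = Fin.succ j' :=
        ⟨j.pred (by intro h; simp [h] at hij), by simp⟩
      have hij' : (j : ℕ) = i + 1 := by simpa using hij
      refine tensorVec_ext_auxOut fun e => ?_
      have h0 : (x ∘ Equiv.swap i.succ j.succ) 0 = x 0 := by
        simp [Equiv.swap_apply_of_ne_of_ne (Fin.succ_ne_zero i).symm (Fin.succ_ne_zero j).symm]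
      rw [auxOut_monodromyBlock, auxOut_rCheck_succ, auxOut_rCheck_succ, auxOut_rCheck_succ,
        auxOut_monodromyBlock, tail_comp_swap, h0]
      have := fun a v => ih a (Fin.tail x) i j hij' hx (fun i => hu i.succ) v
      simp only [Fin.tail] at this
      rw [map_add, map_smul, map_smul, ← this, ← this]

/-! ### Action of the blocks on the reference state. -/

theorem refState_apply (r n : ℕ) (α : Fin n → Fin (r + 1)) :
    refState r n α = if α = fun _ => 0 then 1 else 0 := by
  rw [refState, Pi.single_apply]

theorem rCheck_refState (N r n : ℕ) (i j : Fin n) (x : ℂ) (hx : x ≠ 2 / (N : ℂ)) :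
    rCheck N i j x (refState r n) = refState r n := by
  funext α
  have h : (α ∘ Equiv.swap i j = fun _ => 0) ↔ α = fun _ => 0 := by
    constructor
    · intro h; funext k; simpa using congrFun h (Equiv.swap i j k)
    · rintro rfl; rfl
  have hx := sub_ne_zero.mpr hx
  rw [rCheck_apply, refState_apply, refState_apply]
  simp only [h, bFun, cFun]
  split_ifs
  · field_simp; ring
  · simp

theorem auxOut_refState (r n : ℕ) (a : Fin (r + 1)) :
    auxOut a (refState r (n + 1)) = if a = 0 then refState r n else 0 := by
  funext α
  have : ((Fin.cons a α : Fin (n + 1) → Fin (r + 1)) = fun _ => 0) ↔ a = 0 ∧ α = fun _ => 0 := by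
    simp [funext_iff, Fin.forall_fin_succ]
  rw [auxOut_apply, refState_apply]
  simp only [this]
  by_cases ha : a = 0 <;> simp [ha, refState_apply]

theorem lastOut_refState (r n : ℕ) (a : Fin (r + 1)) :
    lastOut a (refState r (n + 1)) = if a = 0 then refState r n else 0 := by
  funext α
  have : ((Fin.snoc α a : Fin (n + 1) → Fin (r + 1)) = fun _ => 0) ↔ a = 0 ∧ α = fun _ => 0 := by
    simp [funext_iff, Fin.forall_fin_succ', and_comm]
  rw [lastOut_apply, refState_apply]
  simp only [this]
  by_cases ha : a = 0 <;> simp [ha, refState_apply]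

/-- `C^γ(x, u) Ω = 0`. -/
theorem monodromyBlock_succ_zero_refState (N r n : ℕ) (x : Fin n → ℂ) (u : ℂ) (γ : Fin r) :
    monodromyBlock N γ.succ 0 x u (refState r n) = 0 := by
  induction n with
  | zero => simp [monodromyBlock_zero_sites]
  | succ n ih =>
    refine tensorVec_ext_auxOut fun e => ?_
    rw [auxOut_monodromyBlock]
    simp only [auxOut_refState, Fin.succ_ne_zero, if_false, map_zero, smul_zero, add_zero]
    split_ifs
    · rw [ih, smul_zero]
    · simp

/-- `A(x, u) Ω = Ω`. -/
theorem monodromyBlock_zero_zero_refState (N r n : ℕ) (x : Fin n → ℂ) (u : ℂ)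
    (hu : ∀ i, x i - u ≠ 2 / (N : ℂ)) :
    monodromyBlock N 0 0 x u (refState r n) = refState r n := by
  induction n with
  | zero => simp [monodromyBlock_zero_sites]
  | succ n ih =>
    refine tensorVec_ext_auxOut fun e => ?_
    have hx := sub_ne_zero.mpr (hu 0)
    have := ih (Fin.tail x) fun i => hu i.succ
    rw [auxOut_monodromyBlock]
    simp only [auxOut_refState, if_true]
    split_ifs with he
    · subst he
      rw [this, ← add_smul, bFun, cFun, ← add_div, neg_div, ← sub_eq_add_neg, div_self hx,
        one_smul]
    · obtain ⟨γ, rfl⟩ := Fin.exists_succ_eq.mpr he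
      simp [monodromyBlock_succ_zero_refState]

/-- `D^γ_β(x, u) Ω = δ_{γβ} ∏ b(x_i - u) Ω`. -/
theorem monodromyBlock_succ_succ_refState (N r n : ℕ) (x : Fin n → ℂ) (u : ℂ) (γ β : Fin r) :
    monodromyBlock N γ.succ β.succ x u (refState r n) =
      if γ = β then (∏ i, bFun N (x i - u)) • refState r n else 0 := by
  induction n with
  | zero => simp [monodromyBlock_zero_sites]
  | succ n ih =>
    refine tensorVec_ext_auxOut fun e => ?_
    rw [auxOut_monodromyBlock]
    simp only [auxOut_refState, Fin.succ_ne_zero, if_false, map_zero, smul_zero, add_zero]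
    split_ifs with he h h
    · rw [ih, if_pos h, Fin.prod_univ_succ, mul_smul, map_smul, map_smul, auxOut_refState,
        if_pos he]
      rfl
    · rw [ih, if_neg h, smul_zero, map_zero]
    · simp [auxOut_refState, he]
    · simp

/-! ### Bethe vectors and their symmetry in the spectral parameters. -/

theorem perm_induction_adjacent {m : ℕ} {C : Equiv.Perm (Fin m) → Prop} (h1 : C 1)
    (hs : ∀ (σ : Equiv.Perm (Fin m)) (i j : Fin m), (j : ℕ) = i + 1 → C σ →
      C (σ * Equiv.swap i j)) (σ : Equiv.Perm (Fin m)) : C σ := by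
  obtain _ | m := m
  · rwa [Subsingleton.elim σ 1]
  · have hσ : σ ∈ Submonoid.closure
        (Set.range fun i : Fin m => Equiv.swap i.castSucc i.succ) := by
      rw [Equiv.Perm.mclosure_swap_castSucc_succ]; trivial
    induction hσ using Submonoid.closure_induction_right with
    | one => exact h1
    | mul_right σ _ τ hτ ih =>
      obtain ⟨i, rfl⟩ := hτ
      exact hs σ _ _ (by simp) ih

section Bethe

variable {V W : Type*} [AddCommGroup V] [Module ℂ V] [AddCommGroup W] [Module ℂ W] {r : ℕ}

/-- `∑_β w^{β_1 … β_m} B_{β_m}(u_m) ⋯ B_{β_1}(u_1) v`. -/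
def bethe (B : Fin r → ℂ → Module.End ℂ V) :
    ∀ {m : ℕ}, (Fin m → ℂ) → TensorVec r m →ₗ[ℂ] V →ₗ[ℂ] V
  | 0, _ => LinearMap.smulRight (LinearMap.proj default) LinearMap.id
  | _ + 1, u => ∑ β, ((bethe B (Fin.tail u)).compl₂ (B β (u 0))) ∘ₗ auxOut β

theorem bethe_zero (B : Fin r → ℂ → Module.End ℂ V) (u : Fin 0 → ℂ) (w : TensorVec r 0) (v : V) :
    bethe B u w v = w default • v := rfl

theorem bethe_succ (B : Fin r → ℂ → Module.End ℂ V) {m : ℕ} (u : Fin (m + 1) → ℂ)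
    (w : TensorVec r (m + 1)) (v : V) :
    bethe B u w v = ∑ β, bethe B (Fin.tail u) (auxOut β w) (B β (u 0) v) := by
  simp [bethe, LinearMap.sum_apply]

theorem sum_smul_prod_eq_bethe (B : Fin r → ℂ → Module.End ℂ V) {m : ℕ} (u : Fin m → ℂ)
    (w : TensorVec r m) (v : V) :
    ∑ β : Fin m → Fin r, w β • (List.ofFn fun j => B (β j) (u j)).reverse.prod v =
      bethe B u w v := by
  induction m generalizing v with
  | zero => simp [bethe_zero]
  | succ m ih =>
    rw [bethe_succ, ← (Fin.consEquiv fun _ => Fin r).sum_comp, Fintype.sum_prod_type]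
    refine Finset.sum_congr rfl fun β _ => ?_
    rw [← ih]
    refine Finset.sum_congr rfl fun β' _ => ?_
    simp [Fin.consEquiv, List.ofFn_succ, auxOut_apply, Fin.tail]

/-- An intertwiner of two families of operators intertwines the Bethe vectors. -/
theorem bethe_intertwine {B : Fin r → ℂ → Module.End ℂ V} {B' : Fin r → ℂ → Module.End ℂ W}
    (Φ : V →ₗ[ℂ] W) (c : ℂ → ℂ) {m : ℕ} (u : Fin m → ℂ)
    (h : ∀ k β v, B' β (u k) (Φ v) = c (u k) • Φ (B β (u k) v)) (w : TensorVec r m) (v : V) :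
    bethe B' u w (Φ v) = (∏ k, c (u k)) • Φ (bethe B u w v) := by
  induction m generalizing v with
  | zero => simp [bethe_zero]
  | succ m ih =>
    rw [bethe_succ, bethe_succ, map_sum, Finset.smul_sum, Fin.prod_univ_succ]
    refine Finset.sum_congr rfl fun β _ => ?_
    rw [h, map_smul, ih (Fin.tail u) (fun k => h k.succ), smul_smul]
    rfl

/-- Divided by u_i - u_j - η, the exchange relation of two neighbouring operators has the
coefficients b and c of the braided `R`-matrix. Reordering the operators is therefore undone by
acting on the colour vector. -/
theorem bethe_rCheck (N : ℕ) {B : Fin r → ℂ → Module.End ℂ V} {m : ℕ} (u : Fin m → ℂ)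
    (i j : Fin m) (hij : (j : ℕ) = i + 1) (hu : u i - u j ≠ 2 / (N : ℂ))
    (hB : RowExchange (2 / (N : ℂ)) B (u i) (u j)) (w : TensorVec r m) (v : V) :
    bethe B (u ∘ Equiv.swap i j) (rCheck N i j (u i - u j) w) v = bethe B u w v := by
  induction m generalizing v with
  | zero => exact i.elim0
  | succ m ih =>
    obtain rfl | ⟨i, rfl⟩ := Fin.eq_zero_or_eq_succ i
    · obtain _ | m := m
      · exact absurd j.2 (by rw [hij]; simp)
      obtain rfl : j = 1 := Fin.ext (by simpa using hij)
      have ht : Fin.tail (Fin.tail (u ∘ Equiv.swap 0 1)) = Fin.tail (Fin.tail u) := by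
        funext k
        have : Equiv.swap (0 : Fin (m + 2)) 1 k.succ.succ = k.succ.succ :=
          Equiv.swap_apply_of_ne_of_ne (Fin.succ_ne_zero _) (by
            rw [← Fin.succ_zero_eq_one]
            exact fun h => Fin.succ_ne_zero k (Fin.succ_injective _ h))
        simp only [Fin.tail, Function.comp, this]
      have h0 : (u ∘ Equiv.swap 0 1) 0 = u 1 := by simp
      have h1 : Fin.tail (u ∘ Equiv.swap 0 1) 0 = u 0 := by simp [Fin.tail]
      have h2 : Fin.tail u 0 = u 1 := by simp [Fin.tail]
      simp only [bethe_succ, auxOut_auxOut_rCheck, ht, h0, h1, h2, map_add, map_smul,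
        LinearMap.add_apply, LinearMap.smul_apply, Finset.sum_add_distrib]
      rw [Finset.sum_comm, ← Finset.sum_add_distrib]
      refine Finset.sum_congr rfl fun β _ => ?_
      rw [← Finset.sum_add_distrib]
      refine Finset.sum_congr rfl fun β' _ => ?_
      have hne := sub_ne_zero.mpr hu
      have key : B β' (u 1) (B β (u 0) v) = bFun N (u 0 - u 1) • B β (u 0) (B β' (u 1) v) +
          cFun N (u 0 - u 1) • B β' (u 0) (B β (u 1) v) := by
        have := hB β β' v
        refine smul_right_injective _ hne ?_
        simp only
        rw [← this, bFun, cFun]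
        match_scalars <;> field_simp
      rw [key, map_add, map_smul, map_smul]
    · obtain ⟨j, rfl⟩ : ∃ j', j = Fin.succ j' :=
        ⟨j.pred (by intro h; simp [h] at hij), by simp⟩
      have hij' : (j : ℕ) = i + 1 := by simpa using hij
      have h0 : (u ∘ Equiv.swap i.succ j.succ) 0 = u 0 := by
        simp [Equiv.swap_apply_of_ne_of_ne (Fin.succ_ne_zero i).symm (Fin.succ_ne_zero j).symm]
      rw [bethe_succ, bethe_succ]
      refine Finset.sum_congr rfl fun β _ => ?_
      rw [auxOut_rCheck_succ, tail_comp_swap, h0]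
      exact ih (Fin.tail u) i j hij' hu hB _ _

/-- A permutation invariant set on which all `R_{ij}(u_i - u_j)` are regular. -/
structure RegularSet (N : ℕ) {m : ℕ} (P : Set (Fin m → ℂ)) : Prop where
  perm : ∀ u ∈ P, ∀ σ : Equiv.Perm (Fin m), u ∘ σ ∈ P
  ne : ∀ u ∈ P, ∀ i j, i ≠ j → u i - u j ≠ 2 / (N : ℂ)

theorem SymmetryCondition.comp_swap {N d m : ℕ} {P : Set (Fin m → ℂ)}
    {f : (Fin m → ℂ) → TensorVec d m} (hf : SymmetryCondition N P f) {u : Fin m → ℂ} (hu : u ∈ P)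
    {i j : Fin m} (hij : (j : ℕ) = i + 1) (hu' : u ∘ Equiv.swap i j ∈ P)
    (hne : u i - u j ≠ 2 / (N : ℂ)) :
    f (u ∘ Equiv.swap i j) = rCheck N i j (u i - u j) (f u) := by
  funext α
  have := hf u hu i j hij hu' hne (α ∘ Equiv.swap i j)
  have h : (α ∘ Equiv.swap i j) ∘ Equiv.swap i j = α := by
    funext k; simp
  rw [h] at this
  exact this

theorem RegularSet.comp_swap {N d m : ℕ} {P : Set (Fin m → ℂ)} (hP : RegularSet N P)
    {f : (Fin m → ℂ) → TensorVec d m} (hf : SymmetryCondition N P f) {u : Fin m → ℂ} (hu : u ∈ P)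
    {i j : Fin m} (hij : (j : ℕ) = i + 1) :
    f (u ∘ Equiv.swap i j) = rCheck N i j (u i - u j) (f u) :=
  hf.comp_swap hu hij (hP.perm u hu _) (hP.ne u hu i j fun h => by simp [h] at hij)

/-- Condition (i) on f says that f transforms by exactly the matrix that `bethe_rCheck` absorbs, so
each adjacent transposition leaves the Bethe vector alone. -/
theorem bethe_perm {N : ℕ} {B : Fin r → ℂ → Module.End ℂ V} {m : ℕ} {P : Set (Fin m → ℂ)}
    (hP : RegularSet N P) {f : (Fin m → ℂ) → TensorVec r m} (hf : SymmetryCondition N P f)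
    {u : Fin m → ℂ} (hu : u ∈ P)
    (hB : ∀ i j, i ≠ j → RowExchange (2 / (N : ℂ)) B (u i) (u j)) (σ : Equiv.Perm (Fin m))
    (v : V) : bethe B (u ∘ σ) (f (u ∘ σ)) v = bethe B u (f u) v := by
  induction σ using perm_induction_adjacent with
  | h1 => rfl
  | hs σ i j hij ih =>
    have hne : i ≠ j := fun h => by simp [h] at hij
    have huσ := hP.perm u hu σ
    have e : u ∘ ⇑(σ * Equiv.swap i j) = (u ∘ σ) ∘ Equiv.swap i j := rfl
    rw [e, hP.comp_swap hf huσ hij,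
      bethe_rCheck N (u ∘ σ) i j hij (hP.ne _ huσ i j hne) (hB _ _ (σ.injective.ne hne)), ih]

/-- With the first variable frozen, the remaining ones satisfy the same hypotheses. This drives the
inductions and the symmetry in the variables left after one magnon is split off. -/
theorem RegularSet.cons_preimage {N m : ℕ} {P : Set (Fin (m + 1) → ℂ)} (hP : RegularSet N P)
    (a : ℂ) : RegularSet N {u : Fin m → ℂ | (Fin.cons a u : Fin (m + 1) → ℂ) ∈ P} where
  perm u hu σ := by
    have : (Fin.cons a (u ∘ σ) : Fin (m + 1) → ℂ) =
        (Fin.cons a u : Fin (m + 1) → ℂ) ∘ Equiv.Perm.decomposeFin.symm (0, σ) := by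
      funext k
      refine Fin.cases ?_ (fun k => ?_) k <;> simp
    change (Fin.cons a (u ∘ σ) : Fin (m + 1) → ℂ) ∈ P
    rw [this]
    exact hP.perm _ hu _
  ne u hu i j hij := by
    simpa using hP.ne _ hu i.succ j.succ (by simpa using hij)

theorem SymmetryCondition.cons_preimage {N d m : ℕ} {P : Set (Fin (m + 1) → ℂ)}
    {f : (Fin (m + 1) → ℂ) → TensorVec d (m + 1)} (hf : SymmetryCondition N P f) (a : ℂ)
    (β : Fin d) :
    SymmetryCondition N {u : Fin m → ℂ | (Fin.cons a u : Fin (m + 1) → ℂ) ∈ P}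
      fun u => auxOut β (f (Fin.cons a u)) := by
  intro u hu i j hij hu' hne α
  have e := cons_comp_swap_succ a u i j
  have := hf _ hu i.succ j.succ (by simpa using hij) (by rw [← e]; exact hu') (by simpa using hne)
    (Fin.cons β α)
  rw [← e, ← cons_comp_swap_succ] at this
  beta_reduce
  rw [auxOut_apply, this, rMat_apply, rMat_apply, ← cons_comp_swap_succ]
  simp [auxOut_apply]

end Bethe

/-! ### Dependence on the argument of one site: polynomials and interpolation. -/

section PolyLT

variable {V W : Type*} [AddCommGroup V] [Module ℂ V] [AddCommGroup W] [Module ℂ W]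

/-- A vector valued function is a polynomial of degree less than `m`. -/
def PolyLT (m : ℕ) (F : ℂ → V) : Prop :=
  ∀ φ : V →ₗ[ℂ] ℂ, ∃ p : Polynomial ℂ, p.degree < m ∧ ∀ z, φ (F z) = p.eval z

theorem PolyLT.map {m : ℕ} {F : ℂ → V} (hF : PolyLT m F) (L : V →ₗ[ℂ] W) :
    PolyLT m fun z => L (F z) := fun φ => hF (φ ∘ₗ L)

theorem PolyLT.zero (m : ℕ) : PolyLT m fun _ => (0 : V) :=
  fun φ => ⟨0, by simp [Polynomial.degree_zero], by simp⟩

theorem PolyLT.const (v : V) : PolyLT 1 fun _ => v :=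
  fun φ => ⟨Polynomial.C (φ v), lt_of_le_of_lt Polynomial.degree_C_le (by norm_num), by simp⟩

theorem PolyLT.add {m : ℕ} {F G : ℂ → V} (hF : PolyLT m F) (hG : PolyLT m G) :
    PolyLT m fun z => F z + G z := fun φ => by
  obtain ⟨p, hp, hp'⟩ := hF φ
  obtain ⟨q, hq, hq'⟩ := hG φ
  exact ⟨p + q, (Polynomial.degree_add_le p q).trans_lt (max_lt hp hq), by simp [hp', hq']⟩

theorem PolyLT.const_smul {m : ℕ} {F : ℂ → V} (hF : PolyLT m F) (c : ℂ) :
    PolyLT m fun z => c • F z := hF.map (c • LinearMap.id)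

theorem PolyLT.sub {m : ℕ} {F G : ℂ → V} (hF : PolyLT m F) (hG : PolyLT m G) :
    PolyLT m fun z => F z - G z := by
  simpa [sub_eq_add_neg] using hF.add (hG.const_smul (-1))

theorem PolyLT.sum {ι : Type*} {m : ℕ} (s : Finset ι) {F : ι → ℂ → V}
    (hF : ∀ i, PolyLT m (F i)) : PolyLT m fun z => ∑ i ∈ s, F i z := by
  classical
  induction s using Finset.induction_on with
  | empty => simpa using PolyLT.zero m
  | insert i s hi ih => simpa [Finset.sum_insert hi] using (hF i).add ih

theorem PolyLT.mono {m k : ℕ} {F : ℂ → V} (hF : PolyLT m F) (hk : m ≤ k) : PolyLT k F :=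
  fun φ => by
    obtain ⟨p, hp, hp'⟩ := hF φ
    exact ⟨p, hp.trans_le (by exact_mod_cast hk), hp'⟩

theorem PolyLT.sub_smul {m : ℕ} {F : ℂ → V} (hF : PolyLT m F) (u : ℂ) :
    PolyLT (m + 1) fun z => (z - u) • F z := fun φ => by
  obtain ⟨p, hp, hp'⟩ := hF φ
  refine ⟨(Polynomial.X - Polynomial.C u) * p, ?_, by simp [hp']⟩
  rw [Polynomial.degree_mul, Polynomial.degree_X_sub_C]
  by_cases h0 : p = 0
  · simp [h0]
  · rw [Polynomial.degree_eq_natDegree h0] at hp ⊢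
    have : p.natDegree < m := by exact_mod_cast hp
    exact_mod_cast (by omega : 1 + p.natDegree < m + 1)

theorem PolyLT.eq_sum_interpolate {ι : Type*} {m : ℕ} {F : ℂ → ι → ℂ} (hF : PolyLT m F)
    {a : Fin m → ℂ} (ha : Function.Injective a) (z : ℂ) :
    F z = ∑ j, (∏ k ∈ Finset.univ.erase j, (z - a k) / (a j - a k)) • F (a j) := by
  funext i
  obtain ⟨p, hp, hp'⟩ := hF (LinearMap.proj i)
  simp only [LinearMap.proj_apply] at hp'
  have := Lagrange.eq_interpolate (s := Finset.univ) (v := a) ha.injOn (f := p) (by simpa using hp)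
  rw [hp', this, Lagrange.interpolate_apply, Polynomial.eval_finsetSum, Finset.sum_apply]
  refine Finset.sum_congr rfl fun j _ => ?_
  rw [Pi.smul_apply, hp', Polynomial.eval_mul, Polynomial.eval_C, Lagrange.basis,
    Polynomial.eval_prod, smul_eq_mul, mul_comm]
  congr 1
  refine Finset.prod_congr rfl fun k _ => ?_
  simp only [Lagrange.basisDivisor, Polynomial.eval_mul, Polynomial.eval_C, Polynomial.eval_sub,
    Polynomial.eval_X]
  rw [div_eq_mul_inv, mul_comm]

end PolyLT

section Numerators

variable {V : Type*} [AddCommGroup V] [Module ℂ V] {r : ℕ}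

/-- The degrees of the components of the numerator of a Bethe vector after `k` steps. -/
def DegreeBound (k : ℕ) (s : ℂ → Fin (r + 1) → V) : Prop :=
  (PolyLT (k + 1) fun z => s z 0) ∧ ∀ γ : Fin r, PolyLT k fun z => s z γ.succ

theorem DegreeBound.bethe {M : ℂ → Fin r → ℂ → Module.End ℂ (Fin (r + 1) → V)}
    (hM : ∀ k s β u, DegreeBound k s → DegreeBound (k + 1) fun z => M z β u (s z)) {m : ℕ}
    (u : Fin m → ℂ) (w : TensorVec r m) {k : ℕ} {s : ℂ → Fin (r + 1) → V}
    (hs : DegreeBound k s) : DegreeBound (k + m) fun z => bethe (M z) u w (s z) := by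
  induction m generalizing k s with
  | zero => exact ⟨hs.1.const_smul _, fun γ => (hs.2 γ).const_smul _⟩
  | succ m ih =>
    have h := fun β => ih (Fin.tail u) (auxOut β w) (hM k s β (u 0) hs)
    have e : k + 1 + m = k + (m + 1) := by omega
    simp only [e] at h
    simp only [bethe_succ]
    exact ⟨by simpa only [Finset.sum_apply] using PolyLT.sum Finset.univ fun β => (h β).1,
      fun γ => by simpa only [Finset.sum_apply] using PolyLT.sum Finset.univ fun β => (h β).2 γ⟩

/-- `PolyLT 0` forces the zero polynomial. Since the added site starts unexcited, its excited
components stay one degree behind, so after m + 1 operators m + 1 nodes determine them. -/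
theorem degreeBound_single (v : V) :
    DegreeBound (r := r) 0 fun _ => Pi.single 0 v :=
  ⟨by simpa using PolyLT.const v, fun γ => by simpa using PolyLT.zero 0⟩

theorem DegreeBound.opL (η : ℂ) (S : Fin (r + 1) → Fin (r + 1) → ℂ → Module.End ℂ V) (k : ℕ)
    (s : ℂ → Fin (r + 1) → V) (β : Fin r) (u : ℂ) (hs : DegreeBound k s) :
    DegreeBound (k + 1) fun z => opL η z S 0 β.succ u (s z) := by
  simp only [DegreeBound, opL_apply]
  exact ⟨((hs.1.map _).sub_smul _).sub (((hs.1.map _).const_smul _).mono (by omega)),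
    fun γ => (((hs.2 γ).map _).sub_smul _).sub ((hs.1.map _).const_smul _)⟩

theorem DegreeBound.opR (η : ℂ) (S : Fin (r + 1) → Fin (r + 1) → ℂ → Module.End ℂ V) (k : ℕ)
    (s : ℂ → Fin (r + 1) → V) (β : Fin r) (u : ℂ) (hs : DegreeBound k s) :
    DegreeBound (k + 1) fun z => opR η z S 0 β.succ u (s z) := by
  simp only [DegreeBound, opR_apply]
  refine ⟨((hs.1.map _).sub_smul _).sub ?_, fun γ => (((hs.2 γ).map _).sub_smul _).sub ?_⟩
  · simp only [(Fin.succ_ne_zero β).symm, if_false]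
    exact PolyLT.zero _
  · split_ifs
    · refine (PolyLT.sum _ fun c => ?_).const_smul _
      refine Fin.cases ?_ (fun c => ?_) c
      · exact hs.1.map _
      · exact ((hs.2 c).map _).mono (by omega)
    · exact PolyLT.zero _

theorem prod_tail_comp_swap {M : Type*} [CommMonoid M] {m : ℕ} (g : Fin (m + 1) → M)
    (j : Fin (m + 1)) :
    ∏ k : Fin m, g (Equiv.swap 0 j k.succ) = ∏ k ∈ Finset.univ.erase j, g k := by
  have h1 : ∏ k : Fin m, g (Equiv.swap 0 j k.succ) =
      ∏ k ∈ Finset.univ.erase (0 : Fin (m + 1)), g (Equiv.swap 0 j k) := by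
    rw [Fin.univ_succ, Finset.erase_cons, Finset.prod_map]
    rfl
  rw [h1]
  refine Finset.prod_equiv (Equiv.swap 0 j) (fun k => ?_) (fun k _ => rfl)
  simp only [Finset.mem_erase, Finset.mem_univ, and_true]
  rw [not_iff_not, Equiv.swap_apply_eq_iff, Equiv.swap_apply_right]

/-- The residues of the components along the first site. -/
theorem bethe_opL_eval (η : ℂ) (S : Fin (r + 1) → Fin (r + 1) → ℂ → Module.End ℂ V) {m : ℕ}
    (u : Fin (m + 1) → ℂ) (w : TensorVec r (m + 1)) (Ω : V) (δ : ℂ)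
    (hD : ∀ γ β : Fin r, S γ.succ β.succ (u 0) Ω = if γ = β then δ • Ω else 0) (γ : Fin r) :
    bethe (fun β => opL η (u 0 + η) S 0 β.succ) u w (Pi.single 0 Ω) γ.succ =
      (-η * δ * ∏ k : Fin m, (u 0 + η - u k.succ)) •
        bethe (fun β => S 0 β.succ) (Fin.tail u) (auxOut γ w) Ω := by
  -- At z = u_0 + η both coefficients equal η, so the unexcited component cancels and the first
  -- operator always excites the added site.
  have h1 : ∀ β : Fin r, opL η (u 0 + η) S 0 β.succ (u 0) (Pi.single 0 Ω) =
      (-η * δ) • (LinearMap.single ℂ (fun _ : Fin (r + 1) => V) β.succ) Ω := by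
    intro β
    funext e
    rw [opL_apply, LinearMap.single_apply]
    refine Fin.cases ?_ (fun γ => ?_) e
    · simp [(Fin.succ_ne_zero β).symm]
    · by_cases h : γ = β
      · subst h; simp [hD, smul_smul]
      · simp [hD, h]
  rw [bethe_succ, Finset.sum_apply]
  simp only [h1, map_smul]
  -- On an excited site the component along e_1 is zero, so every later operator passes it with the
  -- scalar z - u_k only.
  have h2 := fun β => bethe_intertwine (B := fun β => S 0 β.succ)
    (B' := fun β => opL η (u 0 + η) S 0 β.succ)
    (LinearMap.single ℂ (fun _ : Fin (r + 1) => V) (Fin.succ β)) (fun t => u 0 + η - t)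
    (Fin.tail u) (fun k β' v => by
      funext e
      rw [opL_apply]
      refine Fin.cases ?_ (fun γ => ?_) e
      · simp [(Fin.succ_ne_zero β).symm]
      · by_cases h : γ = β
        · subst h; simp
        · simp [h]) (auxOut β w) Ω
  simp only [h2]
  rw [Finset.sum_eq_single γ]
  · simp [mul_smul, Fin.tail]
  · intro β _ h; simp [h.symm]
  · simp

/-- The last site already carries a colour. Each operator either keeps it, with coefficient z - u_k,
or trades it for its own, with coefficient -η: the numerators of b and c. The symmetry of f absorbs
these matrices while z moves through the u_k to the last place, leaving a factor z - u_k - η each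
time. -/
theorem sum_bethe_opR {N : ℕ} (S : Fin (r + 1) → Fin (r + 1) → ℂ → Module.End ℂ V) {m : ℕ}
    {P : Set (Fin (m + 1) → ℂ)} (hP : RegularSet N P)
    {f : (Fin (m + 1) → ℂ) → TensorVec r (m + 1)} (hf : SymmetryCondition N P f) (u : Fin m → ℂ)
    (z : ℂ) (hu : (Fin.cons z u : Fin (m + 1) → ℂ) ∈ P) (γ : Fin r) (v : V) :
    ∑ β, bethe (fun β => opR (2 / (N : ℂ)) z S 0 β.succ) u (auxOut β (f (Fin.cons z u)))
      (Pi.single β.succ v) γ.succ =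
      (∏ k, (z - u k - 2 / (N : ℂ))) •
        bethe (fun β => S 0 β.succ) u (lastOut γ (f (Fin.snoc u z))) v := by
  induction m generalizing v with
  | zero =>
    simp only [bethe_zero, Finset.univ_eq_empty, Finset.prod_empty, one_smul]
    rw [Finset.sum_eq_single γ]
    · have : (Fin.cons z u : Fin 1 → ℂ) = Fin.snoc u z := by
        funext k; rw [Fin.fin_one_eq_zero k]; simp [Fin.snoc]
      rw [this, auxOut_apply, lastOut_apply]
      have : (Fin.cons γ default : Fin 1 → Fin r) = Fin.snoc default γ := by
        funext k; rw [Fin.fin_one_eq_zero k]; simp [Fin.snoc]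
      rw [this]; simp
    · intro β _ h; simp [h.symm]
    · simp
  | succ m ih =>
    set η : ℂ := 2 / (N : ℂ) with hη
    obtain ⟨a, t, rfl⟩ : ∃ a t, u = Fin.cons a t := ⟨u 0, Fin.tail u, by simp⟩
    have hsw : (Fin.cons z (Fin.cons a t : Fin (m + 1) → ℂ) : Fin (m + 2) → ℂ) ∘
        Equiv.swap 0 1 = Fin.cons a (Fin.cons z t : Fin (m + 1) → ℂ) := cons_cons_comp_swap _ _ _
    have hmem : (Fin.cons a (Fin.cons z t : Fin (m + 1) → ℂ) : Fin (m + 2) → ℂ) ∈ P := by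
      rw [← hsw]; exact hP.perm _ hu _
    have hne : z - a - η ≠ 0 := sub_ne_zero.mpr (by simpa using hP.ne _ hu 0 1 (by simp))
    have hfs : f (Fin.cons a (Fin.cons z t : Fin (m + 1) → ℂ)) =
        rCheck N 0 1 (z - a) (f (Fin.cons z (Fin.cons a t : Fin (m + 1) → ℂ))) := by
      rw [← hsw, hP.comp_swap hf hu (by simp)]
      simp
    have h1 : ∀ β β' : Fin r, opR η z S 0 β'.succ a (Pi.single β.succ v) =
        (z - a) • (Pi.single β.succ (S 0 β'.succ a v) : Fin (r + 1) → V) -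
          η • (Pi.single β'.succ (S 0 β.succ a v) : Fin (r + 1) → V) := by
      intro β β'
      have hsum : ∑ c, S 0 c a ((Pi.single β.succ v : Fin (r + 1) → V) c) = S 0 β.succ a v := by
        rw [Finset.sum_eq_single β.succ]
        · simp
        · intro c _ h; simp [h]
        · simp
      funext e
      rw [opR_apply, hsum, Pi.sub_apply, Pi.smul_apply, Pi.smul_apply, Pi.single_apply,
        Pi.single_apply, Pi.single_apply]
      split_ifs <;> simp
    have ih' := fun β' : Fin r => ih (hP.cons_preimage a) (hf.cons_preimage a β') t hmem
      (S 0 β'.succ a v)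
    simp only [bethe_succ, Fin.tail_cons, Fin.cons_zero, Finset.sum_apply, h1, map_sub, map_smul,
      Pi.sub_apply, Pi.smul_apply, Finset.sum_sub_distrib, ← Finset.smul_sum]
    rw [Finset.sum_comm (f := fun β β' => bethe (fun β => opR η z S 0 β.succ) t
      (auxOut β' (auxOut β (f (Fin.cons z (Fin.cons a t : Fin (m + 1) → ℂ)))))
      (Pi.single β.succ (S 0 β'.succ a v)) γ.succ)]
    rw [Fin.prod_univ_succ, mul_smul, Finset.smul_sum, Finset.smul_sum, Finset.smul_sum,
      Finset.smul_sum, ← Finset.sum_sub_distrib]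
    refine Finset.sum_congr rfl fun β' _ => ?_
    have e1 : auxOut β' (f (Fin.snoc (Fin.cons a t : Fin (m + 1) → ℂ) z)) =
        auxOut β' (f (Fin.cons a (Fin.snoc t z : Fin (m + 1) → ℂ))) := by
      rw [Fin.cons_snoc_eq_snoc_cons]
    simp only [Fin.cons_zero, Fin.cons_succ]
    rw [← lastOut_auxOut, e1, ← ih' β', Finset.smul_sum, Finset.smul_sum, Finset.smul_sum,
      ← Finset.sum_sub_distrib]
    refine Finset.sum_congr rfl fun β _ => ?_
    rw [hfs, auxOut_auxOut_rCheck, map_add, map_smul, map_smul, bFun, cFun, ← hη]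
    simp only [LinearMap.add_apply, LinearMap.smul_apply, Pi.add_apply, Pi.smul_apply]
    match_scalars
    · field_simp
    · rw [neg_div, ← hη]; field_simp

end Numerators

/-! ### Components of Bethe vectors along the first and the last site. -/

theorem bFun_add_cFun {N : ℕ} {z : ℂ} (h : z ≠ 2 / (N : ℂ)) : bFun N z + cFun N z = 1 := by
  have := sub_ne_zero.mpr h
  rw [bFun, cFun, neg_div, ← add_div, ← sub_eq_add_neg, div_self this]

/-- For an unexcited first site the two terms of the splitting coincide, and b + c = 1 makes the
site transparent. -/
theorem auxOut_zero_bethe {r n m : ℕ} (x : Fin (n + 1) → ℂ) (u : Fin m → ℂ)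
    (hx : ∀ k, x 0 - u k ≠ 2 / ((r + 1 : ℕ) : ℂ)) (w : TensorVec r m) :
    auxOut 0 (bethe (fun β => bOp β x) u w (refState r (n + 1))) =
      bethe (fun β => bOp β (Fin.tail x)) u w (refState r n) := by
  have := bethe_intertwine (B := fun β => bOp β x) (B' := fun β : Fin r => bOp β (Fin.tail x))
    (auxOut 0) (fun _ => 1) u (fun k β v => by
      rw [one_smul, bOp, bOp, auxOut_monodromyBlock, ← add_smul, bFun_add_cFun (hx k), one_smul])
    w (refState r (n + 1))
  rw [auxOut_refState, if_pos rfl] at this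
  simpa using this.symm

/-- The column index of B is never 1, so at an unexcited last site only the term with b survives. -/
theorem lastOut_zero_bethe {r n m : ℕ} (x : Fin (n + 1) → ℂ) (u : Fin m → ℂ)
    (w : TensorVec r m) :
    lastOut 0 (bethe (fun β => bOp β x) u w (refState r (n + 1))) =
      (∏ k, bFun (r + 1) (x (Fin.last n) - u k)) •
        bethe (fun β => bOp β (Fin.init x)) u w (refState r n) := by
  set B' : Fin r → ℂ → Module.End ℂ (TensorVec (r + 1) n) :=
    fun β t => bFun (r + 1) (x (Fin.last n) - t) • bOp β (Fin.init x) t with hB'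
  have h1 := bethe_intertwine (B := fun β => bOp β x) (B' := B')
    (lastOut 0) (fun _ => 1) u (fun k β v => by
      rw [one_smul, bOp, lastOut_monodromyBlock, if_neg (Fin.succ_ne_zero β).symm, add_zero]
      rfl) w (refState r (n + 1))
  have h2 := bethe_intertwine (B := fun β : Fin r => bOp β (Fin.init x)) (B' := B')
    LinearMap.id (fun t => bFun (r + 1) (x (Fin.last n) - t)) u (fun k β v => rfl) w
    (refState r n)
  rw [lastOut_refState, if_pos rfl] at h1
  simp only [Finset.prod_const_one, one_smul] at h1
  rw [← h1]
  exact h2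

/-- The components along the first site. -/
def firstSlices (d n : ℕ) : TensorVec d (n + 1) →ₗ[ℂ] Fin d → TensorVec d n :=
  LinearMap.pi fun e => auxOut e

/-- The components along the last site. -/
def lastSlices (d n : ℕ) : TensorVec d (n + 1) →ₗ[ℂ] Fin d → TensorVec d n :=
  LinearMap.pi fun e => lastOut e

theorem opL_firstSlices (N : ℕ) {d n : ℕ} (x : Fin (n + 1) → ℂ) (a b : Fin d) (u : ℂ)
    (hx : x 0 - u ≠ 2 / (N : ℂ)) (w : TensorVec d (n + 1)) :
    opL (2 / (N : ℂ)) (x 0) (fun a b => monodromyBlock N (d := d) a b (Fin.tail x)) a b u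
      (firstSlices d n w) =
    (x 0 - u - 2 / (N : ℂ)) • firstSlices d n (monodromyBlock N a b x u w) := by
  have h' := sub_ne_zero.mpr hx
  funext e
  change _ = (x 0 - u - 2 / (N : ℂ)) • auxOut e (monodromyBlock N a b x u w)
  rw [opL_apply, auxOut_monodromyBlock, bFun, cFun]
  simp only [firstSlices, LinearMap.pi_apply]
  match_scalars
  · field_simp
  · rw [neg_div]; field_simp

theorem opR_lastSlices (N : ℕ) {d n : ℕ} (x : Fin (n + 1) → ℂ) (a b : Fin d) (u : ℂ)
    (hx : x (Fin.last n) - u ≠ 2 / (N : ℂ)) (w : TensorVec d (n + 1)) :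
    opR (2 / (N : ℂ)) (x (Fin.last n))
      (fun a b => monodromyBlock N (d := d) a b (Fin.init x)) a b u (lastSlices d n w) =
    (x (Fin.last n) - u - 2 / (N : ℂ)) • lastSlices d n (monodromyBlock N a b x u w) := by
  have h' := sub_ne_zero.mpr hx
  funext e
  change _ = (x (Fin.last n) - u - 2 / (N : ℂ)) • lastOut e (monodromyBlock N a b x u w)
  rw [opR_apply, lastOut_monodromyBlock, bFun, cFun, neg_div]
  simp only [lastSlices, LinearMap.pi_apply]
  split_ifs
  · match_scalars
    · field_simp
    · field_simp
  · match_scalars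
    field_simp

theorem firstSlices_refState (r n : ℕ) :
    firstSlices (r + 1) n (refState r (n + 1)) = Pi.single 0 (refState r n) := by
  funext e
  simp only [firstSlices, LinearMap.pi_apply, auxOut_refState, Pi.single_apply]

theorem lastSlices_refState (r n : ℕ) :
    lastSlices (r + 1) n (refState r (n + 1)) = Pi.single 0 (refState r n) := by
  funext e
  simp only [lastSlices, LinearMap.pi_apply, lastOut_refState, Pi.single_apply]

/-- The excited components of a Bethe vector along the first site. -/
theorem auxOut_succ_bethe {r n m : ℕ} (x : Fin (n + 1) → ℂ) {P : Set (Fin (m + 1) → ℂ)}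
    (hP : RegularSet (r + 1) P) {f : (Fin (m + 1) → ℂ) → TensorVec r (m + 1)}
    (hf : SymmetryCondition (r + 1) P f) {u : Fin (m + 1) → ℂ} (hu : u ∈ P)
    (hinj : Function.Injective u) (hx : ∀ i k, x i - u k ≠ 2 / ((r + 1 : ℕ) : ℂ)) (γ : Fin r) :
    auxOut γ.succ (bethe (fun β => bOp β x) u (f u) (refState r (n + 1))) =
      ∑ j, (cFun (r + 1) (x 0 - u j) *
          (∏ k ∈ Finset.univ.erase j, (bFun (r + 1) (u k - u j))⁻¹) *
          ∏ i, bFun (r + 1) (Fin.tail x i - u j)) •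
        bethe (fun β => bOp β (Fin.tail x)) (Fin.tail (u ∘ Equiv.swap 0 j))
          (auxOut γ (f (u ∘ Equiv.swap 0 j))) (refState r n) := by
  set η : ℂ := 2 / ((r + 1 : ℕ) : ℂ) with hη
  set S : Fin (r + 1) → Fin (r + 1) → ℂ → Module.End ℂ (TensorVec (r + 1) n) :=
    fun a b => monodromyBlock (r + 1) a b (Fin.tail x) with hS
  -- The argument of the first site is freed from `x 0` in the numerator; u and the other arguments
  -- stay fixed.
  set F : ℂ → TensorVec (r + 1) n := fun z =>
    bethe (fun β => opL η z S 0 β.succ) u (f u) (Pi.single 0 (refState r n)) γ.succ with hF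
  have hFx : (∏ k, (x 0 - u k - η)) •
      auxOut γ.succ (bethe (fun β => bOp β x) u (f u) (refState r (n + 1))) = F (x 0) := by
    have := bethe_intertwine (B := fun β => bOp β x)
      (B' := fun β => opL η (x 0) S 0 β.succ) (firstSlices (r + 1) n) (fun t => x 0 - t - η) u
      (fun k β v => opL_firstSlices (r + 1) x 0 β.succ (u k) (hx 0 k) v) (f u)
      (refState r (n + 1))
    rw [firstSlices_refState] at this
    rw [hF]
    simp only [this]
    rfl
  have hpoly : PolyLT (m + 1) F := by
    have := (DegreeBound.bethe (M := fun z β => opL η z S 0 β.succ)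
      (fun k s β u hs => DegreeBound.opL η S k s β u hs) u (f u)
      (degreeBound_single (refState r n))).2 γ
    simpa using this
  have heval : ∀ j, F (u j + η) = (-η * (∏ i, bFun (r + 1) (Fin.tail x i - u j)) *
      ∏ k ∈ Finset.univ.erase j, (u j + η - u k)) •
        bethe (fun β => bOp β (Fin.tail x)) (Fin.tail (u ∘ Equiv.swap 0 j))
          (auxOut γ (f (u ∘ Equiv.swap 0 j))) (refState r n) := by
    intro j
    have hB : ∀ i k, i ≠ k →
        RowExchange η (fun β : Fin r => opL η (u j + η) S 0 β.succ) (u i) (u k) :=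
      fun i k _ β β' w => ((RTT_monodromyBlock (r + 1) (d := r + 1) (Fin.tail x) (u i) (u k)
        (fun l => hx l.succ i) (fun l => hx l.succ k)).opL (u j + η)).rowExchange 0 β.succ β'.succ w
    rw [hF]
    simp only
    -- The value at a node is computable when the operator with parameter u_j acts first; the
    -- exchange relations hold for the numerators even at this z.
    rw [← bethe_perm hP hf hu hB (Equiv.swap 0 j)]
    have h0 : (u ∘ Equiv.swap 0 j) 0 = u j := by simp
    have := bethe_opL_eval η S (u ∘ Equiv.swap 0 j) (f (u ∘ Equiv.swap 0 j)) (refState r n)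
      (∏ i, bFun (r + 1) (Fin.tail x i - u j))
      (fun γ β => by rw [h0]; exact monodromyBlock_succ_succ_refState _ _ _ _ _ _ _) γ
    rw [h0] at this
    rw [this, ← prod_tail_comp_swap (fun k => u j + η - u k)]
    rfl
  have hne : ∀ k, x 0 - u k - η ≠ 0 := fun k => sub_ne_zero.mpr (hx 0 k)
  have hprod : ∏ k, (x 0 - u k - η) ≠ 0 := Finset.prod_ne_zero_iff.mpr fun k _ => hne k
  refine smul_right_injective _ hprod ?_
  simp only
  rw [hFx, hpoly.eq_sum_interpolate (a := fun k => u k + η)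
    (fun i j h => hinj (add_right_cancel h)), Finset.smul_sum]
  refine Finset.sum_congr rfl fun j _ => ?_
  rw [heval, smul_smul, smul_smul]
  congr 1
  have e1 : (∏ k ∈ Finset.univ.erase j, (bFun (r + 1) (u k - u j))⁻¹) =
      ∏ k ∈ Finset.univ.erase j, ((u j + η - u k) / (u j - u k)) := by
    refine Finset.prod_congr rfl fun k hk => ?_
    have h1 : u k - u j ≠ 0 := sub_ne_zero.mpr (hinj.ne (Finset.ne_of_mem_erase hk))
    have h2 : u j - u k ≠ 0 := sub_ne_zero.mpr (hinj.ne (Finset.ne_of_mem_erase hk).symm)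
    rw [bFun, ← hη, inv_div, div_eq_div_iff h1 h2]
    ring
  have e2 : ∏ k ∈ Finset.univ.erase j, (x 0 - (u k + η)) / (u j + η - (u k + η)) =
      (∏ k ∈ Finset.univ.erase j, (x 0 - u k - η)) / ∏ k ∈ Finset.univ.erase j, (u j - u k) := by
    rw [← Finset.prod_div_distrib]
    refine Finset.prod_congr rfl fun k _ => ?_
    congr 1 <;> ring
  rw [e1, e2, Finset.prod_div_distrib, ← Finset.mul_prod_erase _ _ (Finset.mem_univ j), cFun, ← hη,
    neg_div, ← hη]
  have := hne j
  field_simp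

/-- The excited components of a Bethe vector along the last site. -/
theorem lastOut_succ_bethe {r n m : ℕ} (x : Fin (n + 1) → ℂ) {P : Set (Fin (m + 1) → ℂ)}
    (hP : RegularSet (r + 1) P) {f : (Fin (m + 1) → ℂ) → TensorVec r (m + 1)}
    (hf : SymmetryCondition (r + 1) P f) {u : Fin (m + 1) → ℂ} (hu : u ∈ P)
    (hinj : Function.Injective u) (hx : ∀ i k, x i - u k ≠ 2 / ((r + 1 : ℕ) : ℂ)) (γ : Fin r) :
    lastOut γ.succ (bethe (fun β => bOp β x) u (f u) (refState r (n + 1))) =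
      ∑ j, (cFun (r + 1) (x (Fin.last n) - u j) *
          ∏ k ∈ Finset.univ.erase j,
            (bFun (r + 1) (x (Fin.last n) - u k) * (bFun (r + 1) (u j - u k))⁻¹)) •
        bethe (fun β => bOp β (Fin.init x)) (Fin.tail (u ∘ Equiv.swap 0 j))
          (lastOut γ (f (Fin.snoc (Fin.tail (u ∘ Equiv.swap 0 j)) (u j)))) (refState r n) := by
  set η : ℂ := 2 / ((r + 1 : ℕ) : ℂ) with hη
  set y : ℂ := x (Fin.last n) with hy
  set S : Fin (r + 1) → Fin (r + 1) → ℂ → Module.End ℂ (TensorVec (r + 1) n) :=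
    fun a b => monodromyBlock (r + 1) a b (Fin.init x) with hS
  set F : ℂ → TensorVec (r + 1) n := fun z =>
    bethe (fun β => opR η z S 0 β.succ) u (f u) (Pi.single 0 (refState r n)) γ.succ with hF
  have hFx : (∏ k, (y - u k - η)) •
      lastOut γ.succ (bethe (fun β => bOp β x) u (f u) (refState r (n + 1))) = F y := by
    have := bethe_intertwine (B := fun β => bOp β x)
      (B' := fun β => opR η y S 0 β.succ) (lastSlices (r + 1) n) (fun t => y - t - η) u
      (fun k β v => opR_lastSlices (r + 1) x 0 β.succ (u k) (hx _ k) v) (f u)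
      (refState r (n + 1))
    rw [lastSlices_refState] at this
    rw [hF]
    simp only [this]
    rfl
  have hpoly : PolyLT (m + 1) F := by
    have := (DegreeBound.bethe (M := fun z β => opR η z S 0 β.succ)
      (fun k s β u hs => DegreeBound.opR η S k s β u hs) u (f u)
      (degreeBound_single (refState r n))).2 γ
    simpa using this
  -- For the last site the convenient nodes are the u_j themselves: there the part of the numerator
  -- with b vanishes, only the exchange with the auxiliary space remains, and AΩ = Ω.
  have heval : ∀ j, F (u j) = (-η * ∏ k ∈ Finset.univ.erase j, (u j - u k - η)) •
        bethe (fun β => bOp β (Fin.init x)) (Fin.tail (u ∘ Equiv.swap 0 j))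
          (lastOut γ (f (Fin.snoc (Fin.tail (u ∘ Equiv.swap 0 j)) (u j)))) (refState r n) := by
    intro j
    have hB : ∀ i k, i ≠ k →
        RowExchange η (fun β : Fin r => opR η (u j) S 0 β.succ) (u i) (u k) :=
      fun i k _ β β' w => (((RTT_monodromyBlock (r + 1) (d := r + 1) (Fin.init x) (u i) (u k)
        (fun l => hx l.castSucc i) (fun l => hx l.castSucc k)).rowExchange 0).opR (u j))
          β.succ β'.succ w
    rw [hF]
    simp only
    rw [← bethe_perm hP hf hu hB (Equiv.swap 0 j)]
    have h0 : (u ∘ Equiv.swap 0 j) 0 = u j := by simp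
    have hcons : u ∘ Equiv.swap 0 j = Fin.cons (u j) (Fin.tail (u ∘ Equiv.swap 0 j)) := by
      rw [← h0, Fin.cons_self_tail]
    have hmem := hP.perm u hu (Equiv.swap 0 j)
    rw [hcons] at hmem
    have h1 : ∀ β : Fin r, opR η (u j) S 0 β.succ (u j) (Pi.single 0 (refState r n)) =
        (-η) • (Pi.single β.succ (refState r n) : Fin (r + 1) → TensorVec (r + 1) n) := by
      intro β
      funext e
      rw [opR_apply, Finset.sum_eq_single 0 (fun c _ h => by simp [h]) (by simp)]
      have : S 0 0 (u j) (refState r n) = refState r n :=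
        monodromyBlock_zero_zero_refState _ _ _ _ _ fun i => hx i.castSucc j
      rw [Pi.smul_apply, Pi.single_apply, Pi.single_apply, Pi.single_apply, if_pos rfl, this,
        sub_self, zero_smul]
      split_ifs <;> simp
    have h2 := sum_bethe_opR S hP hf _ _ hmem γ (refState r n)
    rw [← hcons] at h2
    rw [bethe_succ, Finset.sum_apply]
    simp only [h0, h1, map_smul, Pi.smul_apply]
    rw [← Finset.smul_sum, h2, smul_smul, ← prod_tail_comp_swap (fun k => u j - u k - η)]
    rfl
  have hne : ∀ k, y - u k - η ≠ 0 := fun k => sub_ne_zero.mpr (hx _ k)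
  have hprod : ∏ k, (y - u k - η) ≠ 0 := Finset.prod_ne_zero_iff.mpr fun k _ => hne k
  refine smul_right_injective _ hprod ?_
  simp only
  rw [hFx, hpoly.eq_sum_interpolate hinj, Finset.smul_sum]
  refine Finset.sum_congr rfl fun j _ => ?_
  rw [heval, smul_smul, smul_smul]
  congr 1
  have e1 : (∏ k ∈ Finset.univ.erase j, (bFun (r + 1) (y - u k) * (bFun (r + 1) (u j - u k))⁻¹)) =
      (∏ k ∈ Finset.univ.erase j, (y - u k) / (u j - u k)) *
        (∏ k ∈ Finset.univ.erase j, (u j - u k - η)) /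
        (∏ k ∈ Finset.univ.erase j, (y - u k - η)) := by
    rw [← Finset.prod_mul_distrib, ← Finset.prod_div_distrib]
    refine Finset.prod_congr rfl fun k _ => ?_
    rw [bFun, bFun, ← hη, inv_div]
    ring
  have hprod' : ∏ k ∈ Finset.univ.erase j, (y - u k - η) ≠ 0 :=
    Finset.prod_ne_zero_iff.mpr fun k _ => hne k
  rw [e1, ← Finset.mul_prod_erase _ _ (Finset.mem_univ j), cFun, ← hη, neg_div, ← hη]
  have := hne j
  field_simp

/-! ### Difference equations versus cyclicity. -/

/-- `R_{1,i}(x_1 - x_i) ⋯ R_{i-1,i}(x_{i-1} - x_i)`. -/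
def frontProd (N : ℕ) {d n : ℕ} (x : Fin n → ℂ) (i : Fin n) : Module.End ℂ (TensorVec d n) :=
  (((List.finRange n).filter fun j => j < i).map fun j => rMat N j i (x j - x i)).prod

/-- `R_{i+1,i}(x_{i+1} - x_i) ⋯ R_{n,i}(x_n - x_i)`. -/
def endProd (N : ℕ) {d n : ℕ} (x : Fin n → ℂ) (i : Fin n) : Module.End ℂ (TensorVec d n) :=
  (((List.finRange n).filter fun j => i < j).map fun j => rMat N j i (x j - x i)).prod

theorem list_map_prod_intertwine {ι V W : Type*} [AddCommGroup V] [Module ℂ V] [AddCommGroup W]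
    [Module ℂ W] (Φ : V →ₗ[ℂ] W) (F : ι → Module.End ℂ V) (G : ι → Module.End ℂ W)
    (h : ∀ i v, Φ (F i v) = G i (Φ v)) (l : List ι) (v : V) :
    Φ ((l.map F).prod v) = (l.map G).prod (Φ v) := by
  induction l generalizing v with
  | nil => simp
  | cons i l ih =>
    simp only [List.map_cons, List.prod_cons, Module.End.mul_apply]
    rw [h, ih]

theorem auxOut_rMat_succ (N : ℕ) {d n : ℕ} (i j : Fin n) (x : ℂ) (v : TensorVec d (n + 1))
    (a : Fin d) : auxOut a (rMat N i.succ j.succ x v) = rMat N i j x (auxOut a v) :=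
  funLeft_rMat N _ _ _ _ _ (fun α => cons_comp_swap_succ a α i j) x v

theorem lastOut_rMat_castSucc (N : ℕ) {d n : ℕ} (i j : Fin n) (x : ℂ)
    (v : TensorVec d (n + 1)) (a : Fin d) :
    lastOut a (rMat N i.castSucc j.castSucc x v) = rMat N i j x (lastOut a v) :=
  funLeft_rMat N _ _ _ _ _ (fun α => snoc_comp_swap_castSucc a α i j) x v

theorem SymmetryCondition.snoc_preimage {N d m : ℕ} {P : Set (Fin (m + 1) → ℂ)}
    {f : (Fin (m + 1) → ℂ) → TensorVec d (m + 1)} (hf : SymmetryCondition N P f) (a : ℂ)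
    (β : Fin d) :
    SymmetryCondition N {u : Fin m → ℂ | (Fin.snoc u a : Fin (m + 1) → ℂ) ∈ P}
      fun u => lastOut β (f (Fin.snoc u a)) := by
  intro u hu i j hij hu' hne α
  have e := snoc_comp_swap_castSucc a u i j
  have := hf _ hu i.castSucc j.castSucc (by simpa using hij) (by rw [← e]; exact hu')
    (by simpa using hne) (Fin.snoc α β)
  rw [← e, ← snoc_comp_swap_castSucc] at this
  beta_reduce
  rw [lastOut_apply, this, rMat_apply, rMat_apply, ← snoc_comp_swap_castSucc]
  simp [lastOut_apply]

theorem tensorVec_ext_lastOut {d n : ℕ} {v w : TensorVec d (n + 1)}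
    (h : ∀ a, lastOut a v = lastOut a w) : v = w := by
  funext α
  have := congrFun (h (α (Fin.last n))) (Fin.init α)
  simpa [lastOut_apply] using this

/-- Permutation invariance of a set of tuples. -/
def PermInvariant {n : ℕ} (D : Set (Fin n → ℂ)) : Prop :=
  ∀ x ∈ D, ∀ σ : Equiv.Perm (Fin n), x ∘ σ ∈ D

theorem PermInvariant.cons_preimage {m : ℕ} {P : Set (Fin (m + 1) → ℂ)} (hP : PermInvariant P)
    (a : ℂ) : PermInvariant {u : Fin m → ℂ | (Fin.cons a u : Fin (m + 1) → ℂ) ∈ P} := by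
  intro u hu σ
  have : (Fin.cons a (u ∘ σ) : Fin (m + 1) → ℂ) =
      (Fin.cons a u : Fin (m + 1) → ℂ) ∘ Equiv.Perm.decomposeFin.symm (0, σ) := by
    funext k
    refine Fin.cases ?_ (fun k => ?_) k <;> simp
  change (Fin.cons a (u ∘ σ) : Fin (m + 1) → ℂ) ∈ P
  rw [this]
  exact hP _ hu _

theorem snoc_eq_cons_comp_finRotate {β : Type*} {n : ℕ} (a : β) (t : Fin n → β) :
    (Fin.snoc t a : Fin (n + 1) → β) = (Fin.cons a t : Fin (n + 1) → β) ∘ finRotate (n + 1) := by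
  funext k
  refine Fin.lastCases ?_ (fun k => ?_) k
  · simp
  · have : finRotate (n + 1) k.castSucc = k.succ := by
      rw [finRotate_of_lt (by simp)]; rfl
    simp only [Fin.snoc_castSucc, Function.comp, this, Fin.cons_succ]

theorem PermInvariant.snoc_mem_iff {m : ℕ} {P : Set (Fin (m + 1) → ℂ)} (hP : PermInvariant P)
    (a : ℂ) (t : Fin m → ℂ) :
    (Fin.snoc t a : Fin (m + 1) → ℂ) ∈ P ↔ (Fin.cons a t : Fin (m + 1) → ℂ) ∈ P := by
  constructor
  · intro h
    have := hP _ h (finRotate (m + 1)).symm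
    rw [snoc_eq_cons_comp_finRotate, Function.comp_assoc] at this
    simpa using this
  · intro h
    rw [snoc_eq_cons_comp_finRotate]
    exact hP _ h _

theorem PermInvariant.snoc_preimage {m : ℕ} {P : Set (Fin (m + 1) → ℂ)} (hP : PermInvariant P)
    (a : ℂ) : PermInvariant {u : Fin m → ℂ | (Fin.snoc u a : Fin (m + 1) → ℂ) ∈ P} := by
  intro u hu σ
  exact (hP.snoc_mem_iff a _).mpr (hP.cons_preimage a u ((hP.snoc_mem_iff a u).mp hu) σ)

theorem snoc_snoc_comp_swap {β : Type*} {n : ℕ} (a b : β) (α : Fin n → β) :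
    (Fin.snoc (Fin.snoc α a : Fin (n + 1) → β) b : Fin (n + 2) → β) ∘
        Equiv.swap (Fin.last n).castSucc (Fin.last (n + 1)) =
      Fin.snoc (Fin.snoc α b : Fin (n + 1) → β) a := by
  funext k
  refine Fin.lastCases ?_ (fun k => ?_) k
  · simp
  · refine Fin.lastCases ?_ (fun k => ?_) k
    · simp
    · have : Equiv.swap (Fin.last n).castSucc (Fin.last (n + 1)) k.castSucc.castSucc =
          k.castSucc.castSucc :=
        Equiv.swap_apply_of_ne_of_ne
          (fun h => (Fin.castSucc_lt_last k).ne (Fin.castSucc_injective _ h))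
          (Fin.castSucc_lt_last _).ne
      simp only [Function.comp, this, Fin.snoc_castSucc]

theorem cons_comp_succAbove_zero {β : Type*} {n : ℕ} (y : Fin (n + 1) → β) :
    (Fin.cons (y 0) (y ∘ Fin.succAbove 0) : Fin (n + 1) → β) = y := by
  funext k
  refine Fin.cases ?_ (fun k => ?_) k <;> simp

theorem snoc_comp_succAbove_last {β : Type*} {n : ℕ} (y : Fin (n + 1) → β) :
    (Fin.snoc (y ∘ (Fin.last n).succAbove) (y (Fin.last n)) : Fin (n + 1) → β) = y := by
  funext k
  refine Fin.lastCases ?_ (fun k => ?_) k <;> simp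

theorem comp_succ_succAbove {β : Type*} {n : ℕ} (y : Fin (n + 2) → β) (i : Fin (n + 1)) :
    y ∘ i.succ.succAbove = Fin.cons (y 0) (Fin.tail y ∘ i.succAbove) := by
  funext k
  refine Fin.cases ?_ (fun k => ?_) k <;> simp [Fin.tail]

theorem comp_castSucc_succAbove {β : Type*} {n : ℕ} (y : Fin (n + 2) → β) (i : Fin (n + 1)) :
    y ∘ i.castSucc.succAbove = Fin.snoc (Fin.init y ∘ i.succAbove) (y (Fin.last (n + 1))) := by
  funext k
  refine Fin.lastCases ?_ (fun k => ?_) k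
  · have : i.castSucc.succAbove (Fin.last n) = Fin.last (n + 1) := by
      rw [Fin.succAbove_of_le_castSucc _ _ (by
        rw [Fin.castSucc_le_castSucc_iff]; exact Fin.le_last i), Fin.succ_last]
    simp [this]
  · simp [Fin.init, Fin.castSucc_succAbove_castSucc]

theorem comp_swap_zero_succ {β : Type*} {n : ℕ} (y : Fin (n + 1) → β) (i : Fin n) :
    y ∘ Equiv.swap 0 i.succ = Fin.cons (y i.succ) (Function.update (Fin.tail y) i (y 0)) := by
  funext k
  refine Fin.cases ?_ (fun k => ?_) k
  · simp
  · by_cases h : k = i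
    · subst h; simp
    · have : Equiv.swap 0 i.succ k.succ = k.succ :=
        Equiv.swap_apply_of_ne_of_ne (Fin.succ_ne_zero _) (by simpa using h)
      simp [h, this, Fin.tail]

theorem update_comp_succAbove {β : Type*} {n : ℕ} (y : Fin (n + 1) → β) (i : Fin (n + 1)) (b : β) :
    Function.update y i b ∘ i.succAbove = y ∘ i.succAbove := by
  funext k
  simp

/-- Moving the argument `i` to the front. -/
theorem SymmetryCondition.move_front {N d n : ℕ} {D : Set (Fin (n + 1) → ℂ)}
    (hD : PermInvariant D) {f : (Fin (n + 1) → ℂ) → TensorVec d (n + 1)}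
    (hf : SymmetryCondition N D f) {x : Fin (n + 1) → ℂ} (hx : x ∈ D) (i : Fin (n + 1))
    (hreg : ∀ j, j < i → x j - x i ≠ 2 / (N : ℂ)) (α : Fin (n + 1) → Fin d) :
    f (Fin.cons (x i) (x ∘ i.succAbove)) (Fin.cons (α i) (α ∘ i.succAbove)) =
      frontProd N x i (f x) α := by
  obtain rfl | ⟨i, rfl⟩ := Fin.eq_zero_or_eq_succ i
  · rw [cons_comp_succAbove_zero, cons_comp_succAbove_zero]
    simp [frontProd]
  induction n with
  | zero => exact i.elim0
  | succ n ih =>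
    set v := (((List.finRange (n + 1)).filter fun j => j < i).map
          fun j => rMat N j.succ i.succ (x j.succ - x i.succ)).prod (f x) with hv
    have hfp : frontProd N x i.succ (f x) = rMat N 0 i.succ (x 0 - x i.succ) v := by
      rw [frontProd, List.finRange_succ, List.filter_cons_of_pos (by simp),
        List.map_cons, List.prod_cons, Module.End.mul_apply, List.filter_map, List.map_map]
      simp [Function.comp_def, hv]
    set t : Fin n → ℂ := Fin.tail x ∘ i.succAbove with ht
    have hxt : (Fin.cons (x 0) (Fin.tail x) : Fin (n + 2) → ℂ) ∈ D := by simpa using hx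
    have hmem : (Fin.cons (x 0) (Fin.cons (x i.succ) t : Fin (n + 1) → ℂ) : Fin (n + 2) → ℂ)
        ∈ D := by
      have := hD.cons_preimage (x 0) (Fin.tail x) hxt i.cycleRange.symm
      have e : Fin.tail x ∘ i.cycleRange.symm = Fin.cons (x i.succ) t := by
        funext k
        refine Fin.cases ?_ (fun k => ?_) k <;> simp [ht, Fin.tail]
      rw [e] at this
      exact this
    -- With the first argument frozen, the induction hypothesis brings x_i next to it; the last
    -- transposition of the places 0 and 1 then supplies the outermost factor.
    have key : ∀ (a : Fin d) (α : Fin (n + 1) → Fin d),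
        f (Fin.cons (x 0) (Fin.cons (x i.succ) t : Fin (n + 1) → ℂ))
          (Fin.cons a (Fin.cons (α i) (α ∘ i.succAbove) : Fin (n + 1) → Fin d)) =
        v (Fin.cons a α) := by
      intro a α
      have hR := list_map_prod_intertwine (auxOut a)
        (fun j : Fin (n + 1) => rMat N (d := d) j.succ i.succ (x j.succ - x i.succ))
        (fun j : Fin (n + 1) => rMat N j i (Fin.tail x j - Fin.tail x i))
        (fun j w => auxOut_rMat_succ N j i _ w a) ((List.finRange (n + 1)).filter fun j => j < i)
        (f x)
      have hv' : v (Fin.cons a α) = auxOut a v α := rfl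
      rw [hv', hv, hR]
      have hreg' : ∀ j, j < i → Fin.tail x j - Fin.tail x i ≠ 2 / (N : ℂ) :=
        fun j hj => hreg j.succ (by simpa using hj)
      have hD' := hD.cons_preimage (x 0)
      have hf' := hf.cons_preimage (x 0) a
      obtain rfl | ⟨k, rfl⟩ := Fin.eq_zero_or_eq_succ i
      · have e1 : (Fin.cons (x (Fin.succ 0)) t : Fin (n + 1) → ℂ) = Fin.tail x := by
          rw [ht]; exact cons_comp_succAbove_zero (Fin.tail x)
        rw [e1, cons_comp_succAbove_zero, Fin.cons_self_tail]
        simp [auxOut_apply]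
      · obtain _ | n := n
        · exact k.elim0
        have h1 := ih hD' hf' (x := Fin.tail x) hxt α k hreg'
        simp only [Fin.cons_self_tail] at h1
        exact h1
    have hne := hreg 0 (Fin.succ_pos i)
    have hy := hf.comp_swap (i := 0) (j := 1) hmem (by simp) (hD _ hmem _) (by simpa using hne)
    rw [cons_cons_comp_swap] at hy
    rw [comp_succ_succAbove, comp_succ_succAbove, hy, hfp, rCheck_apply, rMat_apply,
      cons_cons_comp_swap, comp_swap_zero_succ]
    have k1 := key (α 0) (Fin.tail α)
    have k2 := key (α i.succ) (Function.update (Fin.tail α) i (α 0))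
    rw [Function.update_self, update_comp_succAbove] at k2
    rw [Fin.cons_self_tail] at k1
    rw [← k1, ← k2]
    simp [Fin.tail]

theorem comp_swap_last_castSucc {β : Type*} {n : ℕ} (y : Fin n → β) (b : β) (i : Fin n) :
    (Fin.snoc y b : Fin (n + 1) → β) ∘ Equiv.swap (Fin.last n) i.castSucc =
      Fin.snoc (Function.update y i b) (y i) := by
  funext k
  refine Fin.lastCases ?_ (fun k => ?_) k
  · simp
  · by_cases h : k = i
    · subst h; simp
    · have : Equiv.swap (Fin.last n) i.castSucc k.castSucc = k.castSucc :=
        Equiv.swap_apply_of_ne_of_ne (Fin.castSucc_lt_last _).ne (by simpa using h)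
      simp [h, this]

theorem filter_last_lt (n : ℕ) :
    ((List.finRange (n + 1)).filter fun j => Fin.last n < j) = [] := by
  simp only [List.filter_eq_nil_iff, decide_eq_true_eq, not_lt]
  exact fun a _ => Fin.le_last a

theorem endProd_last (N : ℕ) {d n : ℕ} (x : Fin (n + 1) → ℂ) (v : TensorVec d (n + 1)) :
    endProd N x (Fin.last n) v = v := by
  rw [endProd, filter_last_lt, List.map_nil, List.prod_nil, Module.End.one_apply]

/-- Moving the last argument to the place `i`. -/
theorem SymmetryCondition.move_end {N d n : ℕ} {D : Set (Fin (n + 1) → ℂ)}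
    (hD : PermInvariant D) {f : (Fin (n + 1) → ℂ) → TensorVec d (n + 1)}
    (hf : SymmetryCondition N D f) {x : Fin (n + 1) → ℂ} (hx : x ∈ D) (i : Fin (n + 1))
    (hreg : ∀ j, i < j → x j - x i ≠ 2 / (N : ℂ)) :
    f x = endProd N x i fun β =>
      f (Fin.snoc (x ∘ i.succAbove) (x i)) (Fin.snoc (β ∘ i.succAbove) (β i)) := by
  induction n with
  | zero =>
    obtain rfl : i = Fin.last 0 := Fin.fin_one_eq_zero i
    simp only [snoc_comp_succAbove_last, endProd_last]
  | succ n ih =>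
    induction i using Fin.lastCases with
    | last =>
      simp only [snoc_comp_succAbove_last, endProd_last]
    | cast i =>
      set xl := x (Fin.last (n + 1)) with hxl
      set t : Fin n → ℂ := Fin.init x ∘ i.succAbove with ht
      set h : TensorVec d (n + 2) := fun β =>
        f (Fin.snoc (x ∘ i.castSucc.succAbove) (x i.castSucc))
          (Fin.snoc (β ∘ i.castSucc.succAbove) (β i.castSucc)) with hh
      have hep : endProd N x i.castSucc h =
          (((List.finRange (n + 1)).filter fun j => i < j).map
            fun j => rMat N j.castSucc i.castSucc (x j.castSucc - x i.castSucc)).prod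
          (rMat N (Fin.last (n + 1)) i.castSucc (xl - x i.castSucc) h) := by
        rw [endProd, List.finRange_succ_last, List.filter_append, List.map_append,
          List.prod_append, Module.End.mul_apply, List.filter_map, List.map_map]
        simp [Function.comp_def, hxl, Fin.castSucc_lt_last]
      have hne : xl - x i.castSucc ≠ 2 / (N : ℂ) := hreg _ (Fin.castSucc_lt_last i)
      have hxi : (Fin.snoc (Fin.init x) xl : Fin (n + 2) → ℂ) = x := Fin.snoc_init_self x
      have hY : (Fin.snoc (Fin.snoc t xl : Fin (n + 1) → ℂ) (x i.castSucc) : Fin (n + 2) → ℂ)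
          ∈ D := by
        rw [hD.snoc_mem_iff, ht, ← comp_castSucc_succAbove]
        have := hD x hx i.castSucc.cycleRange.symm
        have e : x ∘ i.castSucc.cycleRange.symm =
            Fin.cons (x i.castSucc) (x ∘ i.castSucc.succAbove) := by
          funext k
          refine Fin.cases ?_ (fun k => ?_) k <;> simp
        rwa [e] at this
      have hsw := hf.comp_swap (i := (Fin.last n).castSucc) (j := Fin.last (n + 1)) hY (by simp)
        (hD _ hY _) (by simpa using hne)
      rw [snoc_snoc_comp_swap] at hsw
      simp only [Fin.snoc_castSucc, Fin.snoc_last] at hsw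
      rw [hep]
      refine tensorVec_ext_lastOut fun b => ?_
      rw [list_map_prod_intertwine (lastOut b)
        (fun j : Fin (n + 1) => rMat N (d := d) j.castSucc i.castSucc
          (x j.castSucc - x i.castSucc))
        (fun j : Fin (n + 1) => rMat N j i (Fin.init x j - Fin.init x i))
        (fun j w => lastOut_rMat_castSucc N j i _ w b)]
      have h1 := ih (hD.snoc_preimage xl) (hf.snoc_preimage xl b) (x := Fin.init x)
        (by change _ ∈ D; rw [hxi]; exact hx) i
        (fun j hj => hreg j.castSucc (by simpa using hj))
      simp only [hxi] at h1
      rw [h1, endProd]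
      congr 1
      funext β
      have e2 : (Fin.snoc (Fin.init x ∘ i.succAbove) (Fin.init x i) : Fin (n + 1) → ℂ) =
        Fin.snoc t (x i.castSucc) := rfl
      rw [lastOut_apply, lastOut_apply, e2, hsw, rCheck_apply, rMat_apply, snoc_snoc_comp_swap,
        comp_swap_last_castSucc, hh]
      simp only [comp_castSucc_succAbove, Fin.init_snoc, Fin.snoc_last, Fin.snoc_castSucc,
        update_comp_succAbove, Function.update_self]
      rfl

/-- The cyclicity `f^{2 … n 1}(x_2, …, x_n, x_1 + 2) = f^{1 … n}(x_1, …, x_n)`. -/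
def Cyclic {d n : ℕ} (D : Set (Fin (n + 1) → ℂ)) (f : (Fin (n + 1) → ℂ) → TensorVec d (n + 1)) :
    Prop :=
  ∀ (a : ℂ) (t : Fin n → ℂ), (Fin.cons a t : Fin (n + 1) → ℂ) ∈ D →
    (Fin.snoc t (a + 2) : Fin (n + 1) → ℂ) ∈ D →
    ∀ e, lastOut e (f (Fin.snoc t (a + 2))) = auxOut e (f (Fin.cons a t))

/-- For the last index Q consists of its second product only, which is precisely the product that
symmetry produces when the last argument moves to the front. -/
theorem DifferenceEquations.cyclic {N d n : ℕ} {D : Set (Fin (n + 1) → ℂ)}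
    (hD : PermInvariant D) {f : (Fin (n + 1) → ℂ) → TensorVec d (n + 1)}
    (hf : SymmetryCondition N D f) (hd : DifferenceEquations N D f)
    (hne : ∀ x ∈ D, ∀ i j, i ≠ j → x i - x j ≠ 2 / (N : ℂ)) : Cyclic D f := by
  intro a t h1 h2 e
  have h3 : (Fin.snoc t a : Fin (n + 1) → ℂ) ∈ D := (hD.snoc_mem_iff a t).mpr h1
  set x : Fin (n + 1) → ℂ := Fin.snoc t a with hx
  have hup : Function.update x (Fin.last n) (x (Fin.last n) + 2) = Fin.snoc t (a + 2) := by
    simp [hx, Fin.update_snoc_last]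
  have hfr := fun α => hf.move_front hD h3 (Fin.last n) (fun j hj => hne x h3 _ _ hj.ne) α
  have hde := hd x h3 (Fin.last n) (by rw [hup]; exact h2)
    (fun j hj => absurd hj (Fin.le_last j).not_gt) (fun j hj => hne x h3 _ _ hj.ne)
  rw [hup, qMat, filter_last_lt, List.map_nil, List.prod_nil, one_mul] at hde
  funext α
  have := hfr (Fin.snoc α e)
  have e1 : x ∘ (Fin.last n).succAbove = t := by
    funext k; simp [hx]
  have e2 : (Fin.snoc α e : Fin (n + 1) → Fin d) ∘ (Fin.last n).succAbove = α := by
    funext k; simp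
  rw [e1, e2, frontProd, ← hde] at this
  rw [lastOut_apply, auxOut_apply, ← this]
  simp [hx]

/-- Moving x_i to the front gives the second product of Q, cyclicity carries it to the end as x_i +
2, and moving it back to the place i gives the first. Only factors of Q occur, so nothing beyond the
regularity of Q is required. -/
theorem Cyclic.differenceEquations {N d n : ℕ} {D : Set (Fin (n + 1) → ℂ)}
    (hD : PermInvariant D) {f : (Fin (n + 1) → ℂ) → TensorVec d (n + 1)}
    (hf : SymmetryCondition N D f) (hc : Cyclic D f) : DifferenceEquations N D f := by
  intro x hx i hx' hr1 hr2
  set x' := Function.update x i (x i + 2) with hx'd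
  have hxi : x' i = x i + 2 := by simp [hx'd]
  have hxj : ∀ j, j ≠ i → x' j = x j := fun j hj => by simp [hx'd, hj]
  have hs : x' ∘ i.succAbove = x ∘ i.succAbove := update_comp_succAbove _ _ _
  have hcyc : ∀ (y : Fin (n + 1) → ℂ), y ∘ i.cycleRange.symm =
      Fin.cons (y i) (y ∘ i.succAbove) := by
    intro y
    funext k
    refine Fin.cases ?_ (fun k => ?_) k <;> simp
  have h1 := hf.move_end hD hx' i (fun j hj => by rw [hxj j hj.ne', hxi]; exact hr1 j hj)
  rw [h1, qMat, Module.End.mul_apply]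
  have e1 : (fun β : Fin (n + 1) → Fin d =>
      f (Fin.snoc (x' ∘ i.succAbove) (x' i)) (Fin.snoc (β ∘ i.succAbove) (β i))) =
      frontProd N x i (f x) := by
    funext β
    have hm := hD x hx i.cycleRange.symm
    have hm' := hD x' hx' i.cycleRange.symm
    rw [hcyc] at hm hm'
    rw [hs, hxi, ← hD.snoc_mem_iff] at hm'
    have := congrFun (hc (x i) (x ∘ i.succAbove) hm hm' (β i)) (β ∘ i.succAbove)
    rw [lastOut_apply, auxOut_apply, hf.move_front hD hx i hr2] at this
    rw [hs, hxi, this]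
  rw [e1, endProd, frontProd]
  congr 2
  refine List.map_congr_left fun j hj => ?_
  have hj' : i < j := by simpa using hj
  rw [hxj j hj'.ne', hxi]

/-! ### Estimates on the lattice and absolute convergence. -/

theorem exists_norm_inv_le (w : ℂ) : ∃ C : ℝ, 0 ≤ C ∧ ∀ k : ℤ, ‖(w + 2 * (k : ℂ))⁻¹‖ ≤ C := by
  -- For |k| ≥ K the modulus of w + 2k is at least 1, and the finitely many other k are bounded by
  -- their sum. A vanishing w + 2k does no harm because its inverse is 0.
  set K : ℤ := ⌈‖w‖⌉ + 1 with hK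
  refine ⟨1 + ∑ k ∈ Finset.Icc (-K) K, ‖(w + 2 * (k : ℂ))⁻¹‖,
    add_nonneg zero_le_one (Finset.sum_nonneg fun _ _ => norm_nonneg _), fun k => ?_⟩
  by_cases hk : k ∈ Finset.Icc (-K) K
  · have := Finset.single_le_sum (f := fun k : ℤ => ‖(w + 2 * (k : ℂ))⁻¹‖)
      (fun _ _ => norm_nonneg _) hk
    linarith
  · have hk' : K ≤ |k| := by
      by_contra h
      push Not at h
      exact hk (Finset.mem_Icc.mpr ⟨by linarith [neg_abs_le k], by linarith [le_abs_self k]⟩)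
    have h1 : ‖w‖ + 1 ≤ |(k : ℝ)| := by
      have h2 : ((K : ℤ) : ℝ) ≤ |(k : ℝ)| := by exact_mod_cast hk'
      have h3 : ‖w‖ ≤ ((⌈‖w‖⌉ : ℤ) : ℝ) := Int.le_ceil _
      rw [hK] at h2
      push_cast at h2
      linarith
    have h2 : ‖(2 * (k : ℂ))‖ = 2 * |(k : ℝ)| := by
      rw [norm_mul, Complex.norm_ofNat, Complex.norm_intCast]
    have h3 : 1 ≤ ‖w + 2 * (k : ℂ)‖ := by
      have := norm_sub_le (w + 2 * (k : ℂ)) w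
      rw [add_sub_cancel_left, h2] at this
      linarith [norm_nonneg w]
    rw [norm_inv]
    have := inv_le_one_of_one_le₀ h3
    linarith [Finset.sum_nonneg (s := Finset.Icc (-K) K) (f := fun k : ℤ =>
      ‖(w + 2 * (k : ℂ))⁻¹‖) fun _ _ => norm_nonneg _]

theorem exists_norm_inv_le_decay (w a : ℂ) : ∃ C : ℝ, 0 ≤ C ∧
    ∀ k : ℤ, ‖(w + 2 * (k : ℂ))⁻¹‖ ≤ C * (1 + ‖a - 2 * (k : ℂ)‖)⁻¹ := by
  obtain ⟨C, hC, h⟩ := exists_norm_inv_le w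
  refine ⟨(1 + ‖a + w‖) * C + 1, by positivity, fun k => ?_⟩
  have hpos : 0 < 1 + ‖a - 2 * (k : ℂ)‖ := by positivity
  rw [← div_eq_mul_inv, le_div_iff₀ hpos]
  have h1 : ‖a - 2 * (k : ℂ)‖ ≤ ‖a + w‖ + ‖w + 2 * (k : ℂ)‖ := by
    have := norm_sub_le (a + w) (w + 2 * (k : ℂ))
    rwa [show a + w - (w + 2 * (k : ℂ)) = a - 2 * (k : ℂ) by ring] at this
  have h2 : ‖(w + 2 * (k : ℂ))⁻¹‖ * ‖w + 2 * (k : ℂ)‖ ≤ 1 := by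
    rw [norm_inv]; exact inv_mul_le_one
  have h3 := h k
  have h4 := norm_nonneg ((w + 2 * (k : ℂ))⁻¹)
  calc ‖(w + 2 * (k : ℂ))⁻¹‖ * (1 + ‖a - 2 * (k : ℂ)‖)
      ≤ ‖(w + 2 * (k : ℂ))⁻¹‖ * ((1 + ‖a + w‖) + ‖w + 2 * (k : ℂ)‖) :=
        mul_le_mul_of_nonneg_left (by linarith) h4
    _ = (1 + ‖a + w‖) * ‖(w + 2 * (k : ℂ))⁻¹‖ +
        ‖(w + 2 * (k : ℂ))⁻¹‖ * ‖w + 2 * (k : ℂ)‖ := by ring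
    _ ≤ (1 + ‖a + w‖) * C + 1 := by gcongr

theorem exists_norm_cFun_le (N : ℕ) (w : ℂ) :
    ∃ C : ℝ, 0 ≤ C ∧ ∀ k : ℤ, ‖cFun N (w + 2 * (k : ℂ))‖ ≤ C := by
  obtain ⟨C, hC, h⟩ := exists_norm_inv_le (w - 2 / (N : ℂ))
  refine ⟨‖-2 / (N : ℂ)‖ * C, by positivity, fun k => ?_⟩
  rw [cFun, div_eq_mul_inv, norm_mul, add_sub_right_comm]
  gcongr
  exact h k

theorem exists_norm_cFun_le_decay (N : ℕ) (x a : ℂ) : ∃ C : ℝ, 0 ≤ C ∧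
    ∀ k : ℤ, ‖cFun N (x - (a - 2 * (k : ℂ)))‖ ≤ C * (1 + ‖a - 2 * (k : ℂ)‖)⁻¹ := by
  obtain ⟨C, hC, h⟩ := exists_norm_inv_le_decay (x - a - 2 / (N : ℂ)) a
  refine ⟨‖-2 / (N : ℂ)‖ * C, by positivity, fun k => ?_⟩
  rw [cFun, div_eq_mul_inv, norm_mul, mul_assoc,
    show x - (a - 2 * (k : ℂ)) - 2 / (N : ℂ) = x - a - 2 / (N : ℂ) + 2 * (k : ℂ) by ring]
  gcongr
  exact h k

theorem norm_bFun_le (N : ℕ) (z : ℂ) : ‖bFun N z‖ ≤ 1 + ‖cFun N z‖ := by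
  by_cases h : z = 2 / (N : ℂ)
  · simp only [bFun, h, sub_self, div_zero, norm_zero]; positivity
  · rw [eq_sub_of_add_eq (bFun_add_cFun h)]
    exact (norm_sub_le _ _).trans (by simp)

theorem norm_bFun_inv_le (N : ℕ) (z : ℂ) : ‖(bFun N z)⁻¹‖ ≤ 1 + ‖2 / (N : ℂ)‖ * ‖z⁻¹‖ := by
  by_cases h : z = 0
  · simp only [bFun, h, zero_div, inv_zero, norm_zero]; positivity
  · have : (bFun N z)⁻¹ = 1 - 2 / (N : ℂ) * z⁻¹ := by
      rw [bFun, inv_div, sub_div, div_self h, div_eq_mul_inv (2 / (N : ℂ)) z]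
    rw [this, ← norm_mul]
    exact (norm_sub_le _ _).trans (by simp)

theorem exists_norm_bFun_le (N : ℕ) (w : ℂ) :
    ∃ C : ℝ, 0 ≤ C ∧ ∀ k : ℤ, ‖bFun N (w + 2 * (k : ℂ))‖ ≤ C := by
  obtain ⟨C, hC, h⟩ := exists_norm_cFun_le N w
  exact ⟨1 + C, by positivity, fun k => (norm_bFun_le _ _).trans (by linarith [h k])⟩

theorem exists_norm_bFun_inv_le (N : ℕ) (w : ℂ) :
    ∃ C : ℝ, 0 ≤ C ∧ ∀ k : ℤ, ‖(bFun N (w + 2 * (k : ℂ)))⁻¹‖ ≤ C := by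
  obtain ⟨C, hC, h⟩ := exists_norm_inv_le w
  refine ⟨1 + ‖2 / (N : ℂ)‖ * C, by positivity, fun k => (norm_bFun_inv_le _ _).trans ?_⟩
  gcongr
  exact h k

theorem norm_auxOut_le {d n : ℕ} (a : Fin d) (v : TensorVec d (n + 1)) : ‖auxOut a v‖ ≤ ‖v‖ :=
  (pi_norm_le_iff_of_nonneg (norm_nonneg _)).mpr fun _ => norm_le_pi_norm v _

theorem norm_lastOut_le {d n : ℕ} (a : Fin d) (v : TensorVec d (n + 1)) : ‖lastOut a v‖ ≤ ‖v‖ :=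
  (pi_norm_le_iff_of_nonneg (norm_nonneg _)).mpr fun _ => norm_le_pi_norm v _

theorem norm_le_of_auxOut {d n : ℕ} {v : TensorVec d (n + 1)} {C : ℝ} (hC : 0 ≤ C)
    (h : ∀ a, ‖auxOut a v‖ ≤ C) : ‖v‖ ≤ C := by
  refine (pi_norm_le_iff_of_nonneg hC).mpr fun α => ?_
  have := (norm_le_pi_norm (auxOut (α 0) v) (Fin.tail α)).trans (h _)
  rwa [auxOut_apply, Fin.cons_self_tail] at this

theorem norm_rCheck_le (N : ℕ) {d n : ℕ} (i j : Fin n) (z : ℂ) (v : TensorVec d n) :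
    ‖rCheck N i j z v‖ ≤ (‖bFun N z‖ + ‖cFun N z‖) * ‖v‖ := by
  refine (pi_norm_le_iff_of_nonneg (by positivity)).mpr fun α => ?_
  rw [rCheck_apply, add_mul]
  refine (norm_add_le _ _).trans ?_
  rw [norm_mul, norm_mul]
  gcongr <;> exact norm_le_pi_norm v _

/-- Diagonal blocks are bounded and off-diagonal ones decay. This survives adding a site because a
diagonal block enters an off-diagonal one only with the decaying coefficient c. -/
theorem exists_norm_monodromyBlock_le (N : ℕ) {d n : ℕ} (x : Fin n → ℂ) (u₀ : ℂ) :
    ∃ C : ℝ, 0 ≤ C ∧ ∀ (a b : Fin d) (k : ℤ) (v : TensorVec d n),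
      ‖monodromyBlock N a b x (u₀ - 2 * (k : ℂ)) v‖ ≤
        C * (if a = b then 1 else (1 + ‖u₀ - 2 * (k : ℂ)‖)⁻¹) * ‖v‖ := by
  induction n with
  | zero =>
    refine ⟨1, zero_le_one, fun a b k v => ?_⟩
    rw [monodromyBlock_zero_sites]
    split_ifs
    · simp
    · simp only [norm_zero]; positivity
  | succ n ih =>
    obtain ⟨C, hC, h⟩ := ih (Fin.tail x)
    obtain ⟨c, hc, hcF⟩ := exists_norm_cFun_le_decay N (x 0) u₀
    -- The term with b costs (1 + c) C and the term with c costs another c C.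
    refine ⟨(1 + 2 * c) * C, by positivity, fun a b k v => ?_⟩
    set ε : ℝ := (1 + ‖u₀ - 2 * (k : ℂ)‖)⁻¹ with hε
    have hε0 : 0 ≤ ε := by positivity
    have hε1 : ε ≤ 1 := inv_le_one_of_one_le₀ (by linarith [norm_nonneg (u₀ - 2 * (k : ℂ))])
    have hif : ∀ p : Prop, [Decidable p] → (if p then (1 : ℝ) else ε) ≤ 1 ∧
        ε ≤ (if p then (1 : ℝ) else ε) := by
      intro p _; split_ifs <;> simp [hε1]
    have hif0 : 0 ≤ (if a = b then (1 : ℝ) else ε) := hε0.trans (hif _).2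
    refine norm_le_of_auxOut (by positivity) fun e => ?_
    rw [auxOut_monodromyBlock]
    refine (norm_add_le _ _).trans ?_
    rw [norm_smul, norm_smul]
    have hcε := hcF k
    have hb : ‖bFun N (x 0 - (u₀ - 2 * (k : ℂ)))‖ ≤ 1 + c := by
      refine (norm_bFun_le _ _).trans ?_
      have : c * ε ≤ c * 1 := by gcongr
      linarith
    have t1 : ‖monodromyBlock N a b (Fin.tail x) (u₀ - 2 * (k : ℂ)) (auxOut e v)‖ ≤
        C * (if a = b then 1 else ε) * ‖v‖ :=
      (h a b k _).trans (by gcongr; exact norm_auxOut_le _ _)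
    have t2 : ‖monodromyBlock N e b (Fin.tail x) (u₀ - 2 * (k : ℂ)) (auxOut a v)‖ ≤
        C * 1 * ‖v‖ :=
      (h e b k _).trans (by gcongr; exacts [(hif _).1, norm_auxOut_le _ _])
    calc _ ≤ (1 + c) * (C * (if a = b then 1 else ε) * ‖v‖) + (c * ε) * (C * 1 * ‖v‖) := by
          gcongr
      _ ≤ (1 + c) * (C * (if a = b then 1 else ε) * ‖v‖) +
          (c * (if a = b then 1 else ε)) * (C * 1 * ‖v‖) := by
          gcongr; exact (hif _).2
      _ = _ := by ring

theorem norm_bethe_le {V : Type*} [NormedAddCommGroup V] [NormedSpace ℂ V] {r m : ℕ}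
    (B : Fin r → ℂ → Module.End ℂ V) (u : Fin m → ℂ) (ε : Fin m → ℝ) (hε : ∀ k, 0 ≤ ε k)
    (hB : ∀ k β v, ‖B β (u k) v‖ ≤ ε k * ‖v‖) (w : TensorVec r m) (v : V) :
    ‖bethe B u w v‖ ≤ (r : ℝ) ^ m * (∏ k, ε k) * ‖w‖ * ‖v‖ := by
  induction m generalizing v with
  | zero =>
    rw [bethe_zero, norm_smul]
    simp only [pow_zero, Finset.univ_eq_empty, Finset.prod_empty, one_mul]
    gcongr
    exact norm_le_pi_norm w _
  | succ m ih =>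
    rw [bethe_succ]
    have hp : 0 ≤ ∏ k : Fin m, ε k.succ := Finset.prod_nonneg fun k _ => hε _
    have h0 := hε 0
    calc _ ≤ ∑ β : Fin r, ‖bethe B (Fin.tail u) (auxOut β w) (B β (u 0) v)‖ := norm_sum_le _ _
      _ ≤ ∑ _β : Fin r, (r : ℝ) ^ m * (∏ k : Fin m, ε k.succ) * ‖w‖ * (ε 0 * ‖v‖) := by
          refine Finset.sum_le_sum fun β _ => ?_
          refine (ih (Fin.tail u) (fun k => ε k.succ) (fun k => hε _) (fun k β v => hB k.succ β v)
            (auxOut β w) _).trans ?_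
          gcongr
          · exact norm_auxOut_le _ _
          · exact hB 0 β v
      _ = _ := by
          rw [Finset.sum_const, Finset.card_univ, Fintype.card_fin, nsmul_eq_mul,
            Fin.prod_univ_succ]
          ring

theorem latticePoint_sub {m : ℕ} (u₀ : Fin m → ℂ) (l : Fin m → ℤ) (i j : Fin m) :
    latticePoint u₀ l i - latticePoint u₀ l j =
      u₀ i - u₀ j + 2 * ((l j - l i : ℤ) : ℂ) := by
  simp only [latticePoint]; push_cast; ring

theorem sub_latticePoint {m : ℕ} (u₀ : Fin m → ℂ) (l : Fin m → ℤ) (x : ℂ) (j : Fin m) :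
    x - latticePoint u₀ l j = x - u₀ j + 2 * (l j : ℂ) := by
  simp only [latticePoint]; ring

theorem latticePoint_mem {m : ℕ} (u₀ : Fin m → ℂ) (l : Fin m → ℤ) :
    latticePoint u₀ l ∈ permutedLattice u₀ :=
  ⟨1, fun j => ⟨-l j, by simp [latticePoint]; ring⟩⟩

theorem permInvariant_permutedLattice {m : ℕ} (u₀ : Fin m → ℂ) :
    PermInvariant (permutedLattice u₀) := by
  rintro u ⟨σ, hσ⟩ ρ
  exact ⟨ρ.trans σ, fun j => hσ (ρ j)⟩

theorem regularSet_permutedLattice {N m : ℕ} {u₀ : Fin m → ℂ}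
    (hu : ∀ i j : Fin m, i ≠ j → ∀ k : ℤ, u₀ i - u₀ j ≠ 2 / (N : ℂ) + 2 * (k : ℂ)) :
    RegularSet N (permutedLattice u₀) where
  perm := permInvariant_permutedLattice u₀
  ne := by
    rintro u ⟨σ, hσ⟩ i j hij h
    obtain ⟨k, hk⟩ := hσ i
    obtain ⟨k', hk'⟩ := hσ j
    refine hu (σ i) (σ j) (σ.injective.ne hij) (k' - k) ?_
    rw [hk, hk'] at h
    push_cast
    linear_combination h

/-- A permutation of the arguments acts by finitely many `R`-matrices, whose coefficients are
bounded on the lattice. The convergence hypothesis at u thus also controls the permuted arguments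
that splitting off a magnon creates. -/
theorem exists_norm_comp_perm_le {N r m : ℕ} {u₀ : Fin m → ℂ}
    (hP : RegularSet N (permutedLattice u₀)) {f : (Fin m → ℂ) → TensorVec r m}
    (hf : SymmetryCondition N (permutedLattice u₀) f) (σ : Equiv.Perm (Fin m)) :
    ∃ C : ℝ, 0 ≤ C ∧ ∀ l : Fin m → ℤ,
      ‖f (latticePoint u₀ l ∘ σ)‖ ≤ C * ‖f (latticePoint u₀ l)‖ := by
  induction σ using perm_induction_adjacent with
  | h1 => exact ⟨1, zero_le_one, fun l => by simp⟩
  | hs σ i j hij ih =>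
    obtain ⟨C, hC, h⟩ := ih
    obtain ⟨b, hb0, hb⟩ := exists_norm_bFun_le N (u₀ (σ i) - u₀ (σ j))
    obtain ⟨c, hc0, hc⟩ := exists_norm_cFun_le N (u₀ (σ i) - u₀ (σ j))
    refine ⟨(b + c) * C, by positivity, fun l => ?_⟩
    have e : latticePoint u₀ l ∘ ⇑(σ * Equiv.swap i j) =
        (latticePoint u₀ l ∘ σ) ∘ Equiv.swap i j := rfl
    rw [e, hP.comp_swap hf (hP.perm _ (latticePoint_mem u₀ l) σ) hij, mul_assoc]
    refine (norm_rCheck_le _ _ _ _ _).trans ?_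
    have := h l
    simp only [Function.comp, latticePoint_sub] at *
    gcongr
    · exact hb _
    · exact hc _

/-- The scalar weights of the Bethe Ansatz sum. -/
def weight {n m : ℕ} (ψ τ : ℂ → ℂ) (x : Fin n → ℂ) (u : Fin m → ℂ) : ℂ :=
  (∏ i : Fin n, ∏ j : Fin m, ψ (x i - u j)) * ∏ j : Fin m, ∏ i ∈ Finset.Iio j, τ (u i - u j)

theorem betheTerm_eq {r n m : ℕ} (ψ τ : ℂ → ℂ) (f₁ : (Fin m → ℂ) → TensorVec r m)
    (x : Fin n → ℂ) (u : Fin m → ℂ) :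
    betheTerm ψ τ f₁ x u =
      weight ψ τ x u • bethe (fun β => bOp β x) u (f₁ u) (refState r n) := by
  rw [betheTerm, ← sum_smul_prod_eq_bethe, Finset.smul_sum]
  refine Finset.sum_congr rfl fun β _ => ?_
  rw [smul_smul]
  rfl

/-- The decay of `∏ B(x, u_j)` on the lattice. -/
def decay {m : ℕ} (u : Fin m → ℂ) : ℝ := ∏ j, (1 + ‖u j‖)⁻¹

theorem summable_majorant {r n m : ℕ} {ψ τ : ℂ → ℂ} {f₁ : (Fin m → ℂ) → TensorVec r m}
    {u₀ : Fin m → ℂ} {x : Fin n → ℂ} (hx : x ∈ convergenceDomain n ψ τ f₁ u₀) :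
    Summable fun l : Fin m → ℤ => ‖weight ψ τ x (latticePoint u₀ l)‖ *
      ‖f₁ (latticePoint u₀ l)‖ * decay (latticePoint u₀ l) := by
  have h := summable_sum (s := Finset.univ) fun β _ => hx.2 β
  have hd : ∀ l, 0 ≤ decay (latticePoint u₀ l) := fun l =>
    Finset.prod_nonneg fun j _ => by positivity
  refine Summable.of_nonneg_of_le (fun l => mul_nonneg (by positivity) (hd l)) (fun l => ?_) h
  rw [← Finset.sum_mul]
  refine mul_le_mul_of_nonneg_right ?_ (hd l)
  have e : ∀ β, ‖gFun ψ τ f₁ x (latticePoint u₀ l) β‖ =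
      ‖weight ψ τ x (latticePoint u₀ l)‖ * ‖f₁ (latticePoint u₀ l) β‖ := by
    intro β; rw [← norm_mul]; rfl
  simp only [e, ← Finset.mul_sum]
  gcongr
  refine (pi_norm_le_iff_of_nonneg (Finset.sum_nonneg fun _ _ => norm_nonneg _)).mpr fun β => ?_
  exact Finset.single_le_sum (f := fun β => ‖f₁ (latticePoint u₀ l) β‖)
    (fun _ _ => norm_nonneg _) (Finset.mem_univ β)

theorem exists_norm_bOp_le {r n m : ℕ} (x : Fin n → ℂ) (u₀ : Fin m → ℂ) :
    ∃ C : ℝ, 0 ≤ C ∧ ∀ (j : Fin m) (β : Fin r) (l : Fin m → ℤ) (v : TensorVec (r + 1) n),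
      ‖bOp β x (latticePoint u₀ l j) v‖ ≤ C * (1 + ‖latticePoint u₀ l j‖)⁻¹ * ‖v‖ := by
  choose C hC h using fun j => exists_norm_monodromyBlock_le (r + 1) (d := r + 1) x (u₀ j)
  refine ⟨∑ j, C j, Finset.sum_nonneg fun j _ => hC j, fun j β l v => ?_⟩
  have := h j 0 β.succ (l j) v
  rw [if_neg (Fin.succ_ne_zero β).symm] at this
  refine this.trans ?_
  have hle := Finset.single_le_sum (fun j _ => hC j) (Finset.mem_univ j)
  change _ ≤ (∑ j, C j) * (1 + ‖u₀ j - 2 * (l j : ℂ)‖)⁻¹ * ‖v‖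
  gcongr

theorem summable_betheTerm {r n m : ℕ} {ψ τ : ℂ → ℂ} {f₁ : (Fin m → ℂ) → TensorVec r m}
    {u₀ : Fin m → ℂ} {x : Fin n → ℂ} (hx : x ∈ convergenceDomain n ψ τ f₁ u₀) :
    Summable fun l : Fin m → ℤ => betheTerm ψ τ f₁ x (latticePoint u₀ l) := by
  obtain ⟨C, hC, h⟩ := exists_norm_bOp_le (r := r) x u₀
  refine Summable.of_norm_bounded
    ((summable_majorant hx).mul_left ((r : ℝ) ^ m * C ^ m * ‖refState r n‖)) fun l => ?_
  rw [betheTerm_eq, norm_smul]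
  have := norm_bethe_le (fun β => bOp β x) (latticePoint u₀ l)
    (fun k => C * (1 + ‖latticePoint u₀ l k‖)⁻¹) (fun k => by positivity)
    (fun k β v => h k β l v) (f₁ (latticePoint u₀ l)) (refState r n)
  rw [Finset.prod_mul_distrib, Finset.prod_const, Finset.card_univ, Fintype.card_fin] at this
  refine (mul_le_mul_of_nonneg_left this (norm_nonneg _)).trans (le_of_eq ?_)
  rw [decay]
  ring

theorem permInvariant_convergenceDomain {r n m : ℕ} (ψ τ : ℂ → ℂ)
    (f₁ : (Fin m → ℂ) → TensorVec r m) (u₀ : Fin m → ℂ) :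
    PermInvariant (convergenceDomain n ψ τ f₁ u₀) := by
  intro x hx σ
  refine ⟨fun i j k => hx.1 (σ i) j k, fun β => ?_⟩
  have e : ∀ u, gFun ψ τ f₁ (x ∘ σ) u = gFun ψ τ f₁ x u := by
    intro u
    simp only [gFun, Function.comp]
    rw [Equiv.prod_comp σ fun i => ∏ j, ψ (x i - u j)]
  simp only [e]
  exact hx.2 β

theorem sub_latticePoint_ne {r n m : ℕ} {ψ τ : ℂ → ℂ} {f₁ : (Fin m → ℂ) → TensorVec r m}
    {u₀ : Fin m → ℂ} {x : Fin n → ℂ} (hx : x ∈ convergenceDomain n ψ τ f₁ u₀) (l : Fin m → ℤ)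
    (i : Fin n) (j : Fin m) :
    x i - latticePoint u₀ l j ≠ 2 / ((r + 1 : ℕ) : ℂ) := by
  intro h
  rw [sub_latticePoint] at h
  refine hx.1 i j (-l j) ?_
  push_cast at h ⊢
  linear_combination h

/-- Each term obeys the relation by itself: the braided `R`-matrix intertwines all operators B and
fixes Ω, and the weight is symmetric in x. Continuity carries the matrix through the sum. -/
theorem symmetryCondition_betheAnsatz {r n m : ℕ} (ψ τ : ℂ → ℂ)
    (f₁ : (Fin m → ℂ) → TensorVec r m) (u₀ : Fin m → ℂ) :
    SymmetryCondition (r + 1) (convergenceDomain n ψ τ f₁ u₀) (betheAnsatz ψ τ f₁ u₀) := by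
  intro x hx i j hij hx' hne
  have key : betheAnsatz ψ τ f₁ u₀ (x ∘ Equiv.swap i j) =
      rCheck (r + 1) i j (x i - x j) (betheAnsatz ψ τ f₁ u₀ x) := by
    have hL : ∀ v, rCheck (r + 1) i j (x i - x j) v =
        LinearMap.toContinuousLinearMap (rCheck (d := r + 1) (r + 1) i j (x i - x j)) v :=
      fun _ => rfl
    rw [betheAnsatz, betheAnsatz, hL, ContinuousLinearMap.map_tsum _ (summable_betheTerm hx)]
    refine tsum_congr fun l => ?_
    rw [← hL, betheTerm_eq, betheTerm_eq, map_smul]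
    congr 1
    · simp only [weight, Function.comp]
      rw [Equiv.prod_comp (Equiv.swap i j) fun i => ∏ j, ψ (x i - latticePoint u₀ l j)]
    · have := bethe_intertwine (B := fun β : Fin r => bOp β x)
        (B' := fun β : Fin r => bOp β (x ∘ Equiv.swap i j)) (rCheck (r + 1) i j (x i - x j))
        (fun _ => 1) (latticePoint u₀ l) (fun k β v => by
          rw [one_smul]
          exact monodromyBlock_rCheck (r + 1) 0 β.succ x _ i j hij hne
            (fun i => sub_latticePoint_ne hx l i k) v)
        (f₁ (latticePoint u₀ l)) (refState r n)
      rw [rCheck_refState _ _ _ _ _ _ hne] at this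
      simpa using this
  intro α
  rw [key]
  have h : (α ∘ Equiv.swap i j) ∘ Equiv.swap i j = α := by
    funext k; simp
  rw [rCheck_apply, rMat_apply, h]

/-! ### Consequences of the functional equation of τ. -/

open Filter Topology

section Tau

variable {r : ℕ} {τ : ℂ → ℂ}

/-- The difference equation of `τ` at `x`, written without division by `x` and `2 - x`. -/
theorem tau_mul_eq (hτ : ∀ x : ℂ, x ≠ 0 → x ≠ 2 → x ≠ 2 / ((r + 1 : ℕ) : ℂ) →
      x ≠ 2 - 2 / ((r + 1 : ℕ) : ℂ) →
      τ x / bFun (r + 1) x = τ (x - 2) / bFun (r + 1) (2 - x)) {x : ℂ}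
    (h0 : x ≠ 0) (h2 : x ≠ 2) (hη : x ≠ 2 / ((r + 1 : ℕ) : ℂ))
    (hη' : x ≠ 2 - 2 / ((r + 1 : ℕ) : ℂ)) :
    τ x * (x - 2 / ((r + 1 : ℕ) : ℂ)) * (2 - x) =
      x * τ (x - 2) * (2 - x - 2 / ((r + 1 : ℕ) : ℂ)) := by
  have h := hτ x h0 h2 hη hη'
  rw [bFun, bFun] at h
  have h2' : 2 - x ≠ 0 := sub_ne_zero.mpr h2.symm
  rw [div_div_eq_mul_div, div_div_eq_mul_div, div_eq_div_iff h0 h2'] at h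
  linear_combination h

theorem two_div_ne_zero (r : ℕ) : 2 / ((r + 1 : ℕ) : ℂ) ≠ 0 :=
  div_ne_zero two_ne_zero (Nat.cast_ne_zero.mpr (Nat.succ_ne_zero r))

theorem two_div_ne_two (hr : 1 ≤ r) : 2 / ((r + 1 : ℕ) : ℂ) ≠ 2 := by
  intro h
  rw [div_eq_iff (Nat.cast_ne_zero.mpr (Nat.succ_ne_zero r))] at h
  have h1 : ((r + 1 : ℕ) : ℂ) = 1 := by linear_combination -h / 2
  have h2 : r + 1 = 1 := by exact_mod_cast h1
  omega

/-- The equation is not assumed at 0 itself. In its form without denominators, x → 0 gives -2η τ(0)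
on one side and 0 on the other, since τ stays bounded near -2. -/
theorem tau_zero (hr : 1 ≤ r) (hτ : ∀ x : ℂ, x ≠ 0 → x ≠ 2 → x ≠ 2 / ((r + 1 : ℕ) : ℂ) →
      x ≠ 2 - 2 / ((r + 1 : ℕ) : ℂ) →
      τ x / bFun (r + 1) x = τ (x - 2) / bFun (r + 1) (2 - x))
    (hc : ∀ k : ℤ, ContinuousAt τ (2 * (k : ℂ))) : τ 0 = 0 := by
  set η : ℂ := 2 / ((r + 1 : ℕ) : ℂ) with hη
  have hη0 : η ≠ 0 := two_div_ne_zero r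
  have hη2 : η ≠ 2 := two_div_ne_two hr
  have c0 : ContinuousAt τ 0 := by simpa using hc 0
  have c2 : ContinuousAt τ (0 - 2) := by simpa using hc (-1)
  have c2' : ContinuousAt (fun x : ℂ => τ (x - 2)) 0 :=
    ContinuousAt.comp (f := fun x : ℂ => x - 2) c2 (by fun_prop)
  have hev : ∀ᶠ x in 𝓝[≠] (0 : ℂ), τ x * (x - η) * (2 - x) = x * τ (x - 2) * (2 - x - η) := by
    have h1 : ∀ᶠ x in 𝓝[≠] (0 : ℂ), x ≠ 2 :=
      (eventually_ne_nhds two_ne_zero.symm).filter_mono nhdsWithin_le_nhds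
    have h2 : ∀ᶠ x in 𝓝[≠] (0 : ℂ), x ≠ η :=
      (eventually_ne_nhds hη0.symm).filter_mono nhdsWithin_le_nhds
    have h3 : ∀ᶠ x in 𝓝[≠] (0 : ℂ), x ≠ 2 - η :=
      (eventually_ne_nhds (sub_ne_zero.mpr hη2.symm).symm).filter_mono nhdsWithin_le_nhds
    filter_upwards [h1, h2, h3, self_mem_nhdsWithin] with x h1 h2 h3 h0
    exact tau_mul_eq hτ h0 h1 h2 h3
  have t1 : Tendsto (fun x => τ x * (x - η) * (2 - x)) (𝓝[≠] 0) (𝓝 (τ 0 * (0 - η) * (2 - 0))) :=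
    ((c0.mul (by fun_prop : ContinuousAt (fun x : ℂ => x - η) 0)).mul
      (by fun_prop : ContinuousAt (fun x : ℂ => 2 - x) 0)).tendsto.mono_left nhdsWithin_le_nhds
  have t2 : Tendsto (fun x => x * τ (x - 2) * (2 - x - η)) (𝓝[≠] 0)
      (𝓝 (0 * τ (0 - 2) * (2 - 0 - η))) :=
    (((by fun_prop : ContinuousAt (fun x : ℂ => x) 0).mul c2').mul
      (by fun_prop : ContinuousAt (fun x : ℂ => 2 - x - η) 0)).tendsto.mono_left nhdsWithin_le_nhds
  have := tendsto_nhds_unique (t1.congr' hev) t2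
  simpa [hη0] using this

theorem tau_neg_two (hr : 1 ≤ r) (hτ : ∀ x : ℂ, x ≠ 0 → x ≠ 2 → x ≠ 2 / ((r + 1 : ℕ) : ℂ) →
      x ≠ 2 - 2 / ((r + 1 : ℕ) : ℂ) →
      τ x / bFun (r + 1) x = τ (x - 2) / bFun (r + 1) (2 - x))
    (hc : ∀ k : ℤ, ContinuousAt τ (2 * (k : ℂ))) : τ (-2) = -τ 2 := by
  set η : ℂ := 2 / ((r + 1 : ℕ) : ℂ) with hη
  have hη0 : η ≠ 0 := two_div_ne_zero r
  have hη2 : η ≠ 2 := two_div_ne_two hr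
  have c2 : ContinuousAt τ (0 - 2) := by simpa using hc (-1)
  have c2' : ContinuousAt (fun x : ℂ => τ (x - 2)) 0 :=
    ContinuousAt.comp (f := fun x : ℂ => x - 2) c2 (by fun_prop)
  have c3 : ContinuousAt τ (2 + 0) := by simpa using hc 1
  have c3' : ContinuousAt (fun x : ℂ => τ (2 + x)) 0 :=
    ContinuousAt.comp (f := fun x : ℂ => 2 + x) c3 (by fun_prop)
  have hev : ∀ᶠ y in 𝓝[≠] (0 : ℂ), τ (2 + y) * ((2 + y - η) * (y - η) * (2 - y)) =
      τ (y - 2) * ((2 + y) * (y + η) * (2 - y - η)) := by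
    have hn : ∀ {a : ℂ}, a ≠ 0 → ∀ᶠ x in 𝓝[≠] (0 : ℂ), x ≠ a := fun {a} ha =>
      (eventually_ne_nhds ha.symm).filter_mono nhdsWithin_le_nhds
    filter_upwards [hn two_ne_zero, hn hη0, hn (sub_ne_zero.mpr hη2.symm),
      hn (neg_ne_zero.mpr (two_ne_zero (α := ℂ))), hn (sub_ne_zero.mpr hη2),
      hn (neg_ne_zero.mpr hη0), self_mem_nhdsWithin] with y h1 h2 h3 h4 h5 h6 h0
    replace h0 : y ≠ 0 := h0
    have e1 := tau_mul_eq hτ h0 h1 h2 h3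
    have e2 := tau_mul_eq hτ (x := 2 + y) (fun h => h4 (by linear_combination h))
      (fun h => h0 (by linear_combination h)) (fun h => h5 (by linear_combination h))
      (fun h => h6 (by linear_combination h))
    rw [← hη] at e1 e2
    rw [show 2 + y - 2 = y by ring] at e2
    -- Eliminating τ(y) between the equations at y and at 2 + y leaves a common factor y, which must
    -- be removed before the limit y → 0.
    refine mul_left_cancel₀ h0 ?_
    linear_combination -(y - η) * (2 - y) * e2 + (2 + y) * (y + η) * e1
  have t1 : Tendsto (fun y => τ (2 + y) * ((2 + y - η) * (y - η) * (2 - y))) (𝓝[≠] 0)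
      (𝓝 (τ (2 + 0) * ((2 + 0 - η) * (0 - η) * (2 - 0)))) :=
    (c3'.mul (by fun_prop : ContinuousAt (fun y : ℂ => (2 + y - η) * (y - η) * (2 - y)) 0)).tendsto
      |>.mono_left nhdsWithin_le_nhds
  have t2 : Tendsto (fun y => τ (y - 2) * ((2 + y) * (y + η) * (2 - y - η))) (𝓝[≠] 0)
      (𝓝 (τ (0 - 2) * ((2 + 0) * (0 + η) * (2 - 0 - η)))) :=
    (c2'.mul (by fun_prop : ContinuousAt (fun y : ℂ => (2 + y) * (y + η) * (2 - y - η)) 0)).tendsto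
      |>.mono_left nhdsWithin_le_nhds
  have h := tendsto_nhds_unique (t1.congr' hev) t2
  simp only [add_zero, zero_sub, zero_add, sub_zero] at h
  have h2 : 2 * η * (2 - η) ≠ 0 :=
    mul_ne_zero (mul_ne_zero two_ne_zero hη0) (sub_ne_zero.mpr hη2.symm)
  refine mul_right_cancel₀ h2 ?_
  linear_combination -h

/-- Formally, τ(x)/τ(-x) has period 2. It follows by comparing the equations at x and at 2 - x,
whose coefficients are mirror images. -/
theorem tau_mul_tau (hτ : ∀ x : ℂ, x ≠ 0 → x ≠ 2 → x ≠ 2 / ((r + 1 : ℕ) : ℂ) →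
      x ≠ 2 - 2 / ((r + 1 : ℕ) : ℂ) →
      τ x / bFun (r + 1) x = τ (x - 2) / bFun (r + 1) (2 - x)) {x : ℂ}
    (h0 : x ≠ 0) (h2 : x ≠ 2) (hη : x ≠ 2 / ((r + 1 : ℕ) : ℂ))
    (hη' : x ≠ 2 - 2 / ((r + 1 : ℕ) : ℂ)) : τ x * τ (2 - x) = τ (-x) * τ (x - 2) := by
  have h1 := tau_mul_eq hτ h0 h2 hη hη'
  have h3 := tau_mul_eq hτ (x := 2 - x) (sub_ne_zero.mpr h2.symm)
    (fun h => h0 (by linear_combination -h)) (fun h => hη' (by linear_combination -h))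
    (fun h => hη (by linear_combination -h))
  have hne : x * (2 - x) * (x - 2 / ((r + 1 : ℕ) : ℂ)) * (2 - x - 2 / ((r + 1 : ℕ) : ℂ)) ≠ 0 := by
    refine mul_ne_zero (mul_ne_zero (mul_ne_zero h0 (sub_ne_zero.mpr h2.symm))
      (sub_ne_zero.mpr hη)) (fun h => hη' (by linear_combination -h))
  refine mul_right_cancel₀ hne ?_
  rw [show 2 - x - 2 = -x by ring, show 2 - (2 - x) = x by ring] at h3
  linear_combination τ (2 - x) * x * (2 - x - 2 / ((r + 1 : ℕ) : ℂ)) * h1 +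
    x * τ (x - 2) * (2 - x - 2 / ((r + 1 : ℕ) : ℂ)) * h3

end Tau

/-! ### The product of the τ's under exchanges and shifts. -/

/-- Splitting off one index from a product over ordered pairs. -/
theorem prod_pairs_erase {M : Type*} [CommMonoid M] {m : ℕ} (F : Fin m → Fin m → M)
    {s : Finset (Fin m)} {j : Fin m} (hj : j ∈ s) :
    ∏ b ∈ s, ∏ a ∈ s with a < b, F a b =
      (∏ b ∈ s.erase j, ∏ a ∈ s.erase j with a < b, F a b) *
        ∏ k ∈ s.erase j, if k < j then F k j else F j k := by
  have h1 : ∏ a ∈ s with a < j, F a j = ∏ k ∈ s.erase j, if k < j then F k j else 1 := by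
    rw [← Finset.prod_filter]
    refine Finset.prod_congr ?_ fun _ _ => rfl
    ext a
    simp only [Finset.mem_filter, Finset.mem_erase]
    exact ⟨fun h => ⟨⟨h.2.ne, h.1⟩, h.2⟩, fun h => ⟨h.1.2, h.2⟩⟩
  have h2 : ∀ b ∈ s.erase j, ∏ a ∈ s with a < b, F a b =
      (∏ a ∈ s.erase j with a < b, F a b) * if b < j then 1 else F j b := by
    intro b hb
    have hbj := Finset.ne_of_mem_erase hb
    rw [Finset.filter_erase]
    split_ifs with h
    · rw [mul_one, Finset.erase_eq_of_notMem]
      simp [h.le]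
    · rw [Finset.prod_erase_mul]
      simp [hj, lt_of_le_of_ne (not_lt.mp h) hbj.symm]
  rw [← Finset.mul_prod_erase s _ hj, h1, Finset.prod_congr rfl h2, Finset.prod_mul_distrib,
    mul_left_comm, ← Finset.prod_mul_distrib]
  congr 1
  refine Finset.prod_congr rfl fun k _ => ?_
  split_ifs <;> simp

/-- `∏_{i<j} τ(u_i - u_j)`. -/
def tauProd (τ : ℂ → ℂ) {m : ℕ} (u : Fin m → ℂ) : ℂ :=
  ∏ j : Fin m, ∏ i ∈ Finset.Iio j, τ (u i - u j)

theorem tauProd_eq (τ : ℂ → ℂ) {m : ℕ} (u : Fin m → ℂ) :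
    tauProd τ u = ∏ j, ∏ i ∈ Finset.univ with i < j, τ (u i - u j) := by
  refine Finset.prod_congr rfl fun j _ => Finset.prod_congr ?_ fun _ _ => rfl
  ext i; simp

theorem tauProd_eq_zero {τ : ℂ → ℂ} (h0 : τ 0 = 0) {m : ℕ} {u : Fin m → ℂ} {i j : Fin m}
    (hij : i ≠ j) (hu : u i = u j) : tauProd τ u = 0 := by
  wlog h : i < j generalizing i j
  · exact this hij.symm hu.symm (lt_of_le_of_ne (not_lt.mp h) hij.symm)
  exact Finset.prod_eq_zero (Finset.mem_univ j) (Finset.prod_eq_zero (Finset.mem_Iio.mpr h)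
    (by rw [hu, sub_self, h0]))

/-- The pair {j, k} gives the sign. Of the other pairs only those with an index p between j and k
change orientation, and `h2` compensates them. -/
theorem tauProd_swap {τ : ℂ → ℂ} {m : ℕ} {u : Fin m → ℂ} {j k : Fin m} (hjk : k ≠ j)
    (h1 : τ (u k - u j) = -τ (u j - u k))
    (h2 : ∀ p, p ≠ j → p ≠ k →
      τ (u k - u p) * τ (u p - u j) = τ (u p - u k) * τ (u j - u p)) :
    tauProd τ (u ∘ Equiv.swap j k) = -tauProd τ u := by
  have hk : k ∈ Finset.univ.erase j := by simp [hjk]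
  rw [tauProd_eq, tauProd_eq, prod_pairs_erase _ (Finset.mem_univ j), prod_pairs_erase _ hk,
    prod_pairs_erase _ (Finset.mem_univ j), prod_pairs_erase _ hk,
    ← Finset.mul_prod_erase (Finset.univ.erase j) (fun p => if p < j then
      τ ((u ∘ Equiv.swap j k) p - (u ∘ Equiv.swap j k) j) else
      τ ((u ∘ Equiv.swap j k) j - (u ∘ Equiv.swap j k) p)) hk,
    ← Finset.mul_prod_erase (Finset.univ.erase j)
      (fun p => if p < j then τ (u p - u j) else τ (u j - u p)) hk]
  have hs : ∀ p ∈ (Finset.univ.erase j).erase k, (u ∘ Equiv.swap j k) p = u p := by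
    intro p hp
    simp only [Finset.mem_erase] at hp
    rw [Function.comp, Equiv.swap_apply_of_ne_of_ne hp.2.1 hp.1]
  have hsj : (u ∘ Equiv.swap j k) j = u k := by simp
  have hsk : (u ∘ Equiv.swap j k) k = u j := by simp
  have e1 : ∏ b ∈ (Finset.univ.erase j).erase k, ∏ a ∈ (Finset.univ.erase j).erase k with a < b,
      τ ((u ∘ Equiv.swap j k) a - (u ∘ Equiv.swap j k) b) =
      ∏ b ∈ (Finset.univ.erase j).erase k, ∏ a ∈ (Finset.univ.erase j).erase k with a < b,
      τ (u a - u b) := by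
    refine Finset.prod_congr rfl fun b hb => Finset.prod_congr rfl fun a ha => ?_
    rw [hs b hb, hs a (Finset.mem_of_mem_filter a ha)]
  have e2 : (∏ p ∈ (Finset.univ.erase j).erase k, if p < k then
        τ ((u ∘ Equiv.swap j k) p - (u ∘ Equiv.swap j k) k) else
        τ ((u ∘ Equiv.swap j k) k - (u ∘ Equiv.swap j k) p)) *
      (∏ p ∈ (Finset.univ.erase j).erase k, if p < j then
        τ ((u ∘ Equiv.swap j k) p - (u ∘ Equiv.swap j k) j) else
        τ ((u ∘ Equiv.swap j k) j - (u ∘ Equiv.swap j k) p)) =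
      (∏ p ∈ (Finset.univ.erase j).erase k, if p < k then τ (u p - u k) else τ (u k - u p)) *
      (∏ p ∈ (Finset.univ.erase j).erase k, if p < j then τ (u p - u j) else τ (u j - u p)) := by
    rw [← Finset.prod_mul_distrib, ← Finset.prod_mul_distrib]
    refine Finset.prod_congr rfl fun p hp => ?_
    rw [hs p hp, hsj, hsk]
    simp only [Finset.mem_erase] at hp
    have := h2 p hp.2.1 hp.1
    split_ifs
    · ring
    · linear_combination this
    · linear_combination -this
    · ring
  have e3 : (if k < j then τ ((u ∘ Equiv.swap j k) k - (u ∘ Equiv.swap j k) j) else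
      τ ((u ∘ Equiv.swap j k) j - (u ∘ Equiv.swap j k) k)) =
      -if k < j then τ (u k - u j) else τ (u j - u k) := by
    rw [hsj, hsk]
    split_ifs
    · rw [h1, neg_neg]
    · exact h1
  rw [e1, e3]
  linear_combination -(∏ b ∈ (Finset.univ.erase j).erase k,
    ∏ a ∈ (Finset.univ.erase j).erase k with a < b, τ (u a - u b)) *
    (if k < j then τ (u k - u j) else τ (u j - u k)) * e2

/-- Only pairs containing j change. According to the order of the indices, the equation of τ is used
at u_k - u_j or at u_j + 2 - u_k; `h1`–`h4` exclude its exceptional points. -/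
theorem tauProd_update {r : ℕ} {τ : ℂ → ℂ}
    (hτ : ∀ x : ℂ, x ≠ 0 → x ≠ 2 → x ≠ 2 / ((r + 1 : ℕ) : ℂ) →
      x ≠ 2 - 2 / ((r + 1 : ℕ) : ℂ) →
      τ x / bFun (r + 1) x = τ (x - 2) / bFun (r + 1) (2 - x)) {m : ℕ} {u : Fin m → ℂ} (j : Fin m)
    (h1 : ∀ k, k ≠ j → u k ≠ u j) (h2 : ∀ k, k ≠ j → u k ≠ u j + 2)
    (h3 : ∀ k, k ≠ j → u k - u j ≠ 2 / ((r + 1 : ℕ) : ℂ))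
    (h4 : ∀ k, k ≠ j → u j + 2 - u k ≠ 2 / ((r + 1 : ℕ) : ℂ)) :
    tauProd τ (Function.update u j (u j + 2)) *
        ∏ k ∈ Finset.univ.erase j, (bFun (r + 1) (u j + 2 - u k))⁻¹ =
      tauProd τ u * ∏ k ∈ Finset.univ.erase j, (bFun (r + 1) (u k - u j))⁻¹ := by
  rw [tauProd_eq, tauProd_eq, prod_pairs_erase _ (Finset.mem_univ j),
    prod_pairs_erase _ (Finset.mem_univ j), mul_assoc, mul_assoc]
  have hk : ∀ k ∈ Finset.univ.erase j, Function.update u j (u j + 2) k = u k :=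
    fun k hk => Function.update_of_ne (Finset.ne_of_mem_erase hk) _ _
  congr 1
  · refine Finset.prod_congr rfl fun b hb => Finset.prod_congr rfl fun a ha => ?_
    rw [hk b hb, hk a (Finset.mem_of_mem_filter a ha)]
  · rw [← Finset.prod_mul_distrib, ← Finset.prod_mul_distrib]
    refine Finset.prod_congr rfl fun k hk' => ?_
    have hkj := Finset.ne_of_mem_erase hk'
    have g1 := h1 k hkj
    have g2 := h2 k hkj
    have g3 := h3 k hkj
    have g4 := h4 k hkj
    rw [hk k hk', Function.update_self]
    split_ifs
    · have := hτ (u k - u j) (sub_ne_zero.mpr g1) (fun h => g2 (by linear_combination h)) g3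
        (fun h => g4 (by linear_combination -h))
      rw [show u k - u j - 2 = u k - (u j + 2) by ring,
        show 2 - (u k - u j) = u j + 2 - u k by ring] at this
      rw [← div_eq_mul_inv, ← div_eq_mul_inv, this]
    · have := hτ (u j + 2 - u k) (fun h => g2 (by linear_combination -h))
        (fun h => g1 (by linear_combination -h)) g4 (fun h => g3 (by linear_combination -h))
      rw [show u j + 2 - u k - 2 = u j - u k by ring,
        show 2 - (u j + 2 - u k) = u k - u j by ring] at this
      rw [← div_eq_mul_inv, ← div_eq_mul_inv, this]

/-! ### Lattice translations and cancellation of colliding terms. -/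

theorem latticePoint_add_single {m : ℕ} (u₀ : Fin m → ℂ) (l : Fin m → ℤ) (j : Fin m) (e : ℤ) :
    latticePoint u₀ (l + Pi.single j (-e)) =
      Function.update (latticePoint u₀ l) j (latticePoint u₀ l j + 2 * (e : ℂ)) := by
  funext k
  by_cases h : k = j
  · subst h; simp [latticePoint]; ring
  · simp [latticePoint, h]

/-- For coordinates differing by 2e the exchange is itself a translation of the summation index, so
it may be applied inside the sum. -/
theorem latticePoint_add_swap {m : ℕ} (u₀ : Fin m → ℂ) (l : Fin m → ℤ) {j k : Fin m} (hjk : k ≠ j)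
    (e : ℤ) (h : latticePoint u₀ l k = latticePoint u₀ l j + 2 * (e : ℂ)) :
    latticePoint u₀ (l + (Pi.single j (-e) + Pi.single k e)) =
      latticePoint u₀ l ∘ Equiv.swap j k := by
  have h1 := latticePoint_add_single u₀ (l + Pi.single j (-e)) k (-e)
  rw [neg_neg, add_assoc, latticePoint_add_single, Function.update_of_ne hjk] at h1
  rw [h1]
  funext p
  by_cases hp : p = k
  · subst hp; simp [h]
  · rw [Function.update_of_ne hp]
    by_cases hp' : p = j
    · subst hp'; simp [h]
    · simp [hp', Equiv.swap_apply_of_ne_of_ne hp' hp]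

theorem injective_update_of {β : Type*} {m : ℕ} {u : Fin m → β} (hu : Function.Injective u)
    {j : Fin m} {b : β} (h : ∀ k, k ≠ j → u k ≠ b) : Function.Injective (Function.update u j b) := by
  intro p q hpq
  by_cases hp : p = j <;> by_cases hq : q = j
  · rw [hp, hq]
  · subst hp
    rw [Function.update_self, Function.update_of_ne hq] at hpq
    exact absurd hpq.symm (h q hq)
  · subst hq
    rw [Function.update_self, Function.update_of_ne hp] at hpq
    exact absurd hpq (h p hp)
  · rw [Function.update_of_ne hp, Function.update_of_ne hq] at hpq
    exact hu hpq

open Classical in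
/-- Terms that are antisymmetric under the exchange of neighbouring lattice points cancel. -/
theorem sum_tsum_eq_of_swap {V : Type*} [NormedAddCommGroup V] [NormedSpace ℂ V] [CompleteSpace V]
    {m : ℕ} (u₀ : Fin m → ℂ) (T : Fin m → (Fin m → ℂ) → V) (e : ℤ)
    (hsum : ∀ j, Summable fun l : Fin m → ℤ =>
      if Function.Injective (latticePoint u₀ l) then T j (latticePoint u₀ l) else 0)
    (hswap : ∀ (l : Fin m → ℤ) (j k : Fin m), k ≠ j → Function.Injective (latticePoint u₀ l) →
      latticePoint u₀ l k = latticePoint u₀ l j + 2 * (e : ℂ) →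
      T k (latticePoint u₀ l ∘ Equiv.swap j k) = -T j (latticePoint u₀ l)) :
    ∑ j, ∑' l : Fin m → ℤ,
      (if Function.Injective (latticePoint u₀ l) then T j (latticePoint u₀ l) else 0) =
    ∑ j, ∑' l : Fin m → ℤ,
      if Function.Injective (latticePoint u₀ l) ∧ Function.Injective
        (Function.update (latticePoint u₀ l) j (latticePoint u₀ l j + 2 * (e : ℂ)))
      then T j (latticePoint u₀ l) else 0 := by
  set F : Fin m → (Fin m → ℤ) → V := fun j l =>
    if Function.Injective (latticePoint u₀ l) then T j (latticePoint u₀ l) else 0 with hF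
  set G : Fin m → (Fin m → ℤ) → V := fun j l =>
    if Function.Injective (latticePoint u₀ l) ∧ Function.Injective
        (Function.update (latticePoint u₀ l) j (latticePoint u₀ l j + 2 * (e : ℂ)))
      then T j (latticePoint u₀ l) else 0 with hG
  -- `A j k` collects the points at which shifting u_j by 2e makes it collide with u_k. By
  -- injectivity at most one k occurs for each j and l.
  set A : Fin m → Fin m → (Fin m → ℤ) → V := fun j k l =>
    if k ≠ j ∧ latticePoint u₀ l k = latticePoint u₀ l j + 2 * (e : ℂ) then F j l else 0 with hA
  have hGs : ∀ j, Summable (G j) := by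
    intro j
    have := (hsum j).indicator {l | Function.Injective
        (Function.update (latticePoint u₀ l) j (latticePoint u₀ l j + 2 * (e : ℂ)))}
    refine this.congr fun l => ?_
    simp only [Set.indicator_apply, Set.mem_ofPred_eq, hG]
    by_cases h1 : Function.Injective (latticePoint u₀ l) <;> by_cases h2 : Function.Injective
        (Function.update (latticePoint u₀ l) j (latticePoint u₀ l j + 2 * (e : ℂ))) <;>
      simp [h1, h2]
  have hAs : ∀ j k, Summable (A j k) := by
    intro j k
    have := (hsum j).indicator
      {l | k ≠ j ∧ latticePoint u₀ l k = latticePoint u₀ l j + 2 * (e : ℂ)}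
    refine this.congr fun l => ?_
    simp only [Set.indicator_apply, Set.mem_ofPred_eq, hA, hF]
  have hsplit : ∀ j l, F j l = G j l + ∑ k, A j k l := by
    intro j l
    by_cases h1 : Function.Injective (latticePoint u₀ l)
    · by_cases h2 : ∃ k, k ≠ j ∧ latticePoint u₀ l k = latticePoint u₀ l j + 2 * (e : ℂ)
      · obtain ⟨k, hk, hk'⟩ := h2
        have hG0 : G j l = 0 := by
          simp only [hG]
          rw [if_neg]
          rintro ⟨-, h⟩
          refine hk (h ?_)
          rw [Function.update_self, Function.update_of_ne hk, hk']
        rw [hG0, zero_add, Finset.sum_eq_single k]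
        · simp only [hA]; rw [if_pos ⟨hk, hk'⟩]
        · intro k' _ hne
          simp only [hA]
          rw [if_neg]
          rintro ⟨-, h⟩
          exact hne (h1 (h.trans hk'.symm))
        · simp
      · push Not at h2
        have hA0 : ∑ k, A j k l = 0 := Finset.sum_eq_zero fun k _ => by
          simp only [hA]
          rw [if_neg]
          rintro ⟨h, h'⟩
          exact h2 k h h'
        rw [hA0, add_zero]
        simp only [hF, hG]
        rw [if_pos h1, if_pos ⟨h1, injective_update_of h1 h2⟩]
    · have hA0 : ∑ k, A j k l = 0 := Finset.sum_eq_zero fun k _ => by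
        simp [hA, hF, h1]
      rw [hA0]
      simp [hF, hG, h1]
  -- The translation that realises the exchange of u_j and u_k carries one collision set to the
  -- other, and `hswap` supplies the sign.
  have hanti : ∀ j k, ∑' l, A k j l = -∑' l, A j k l := by
    intro j k
    by_cases hjk : k = j
    · subst hjk; simp [hA]
    rw [← (Equiv.addRight (Pi.single j (-e) + Pi.single k e : Fin m → ℤ)).tsum_eq (A k j),
      ← tsum_neg]
    refine tsum_congr fun l => ?_
    simp only [Equiv.coe_addRight, hA]
    by_cases h : latticePoint u₀ l k = latticePoint u₀ l j + 2 * (e : ℂ)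
    · rw [latticePoint_add_swap u₀ l hjk e h]
      have hinj : Function.Injective (latticePoint u₀ l ∘ Equiv.swap j k) ↔
          Function.Injective (latticePoint u₀ l) := Equiv.injective_comp _ _
      have h' : j ≠ k ∧ (latticePoint u₀ l ∘ Equiv.swap j k) j =
          (latticePoint u₀ l ∘ Equiv.swap j k) k + 2 * (e : ℂ) := ⟨Ne.symm hjk, by simp [h]⟩
      have h'' : k ≠ j ∧ latticePoint u₀ l k = latticePoint u₀ l j + 2 * (e : ℂ) := ⟨hjk, h⟩
      rw [if_pos h', if_pos h'']
      simp only [hF]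
      rw [latticePoint_add_swap u₀ l hjk e h]
      simp only [hinj]
      split_ifs with h1
      · exact hswap l j k hjk h1 h
      · simp
    · rw [if_neg, if_neg (fun h' => h h'.2), neg_zero]
      rintro ⟨-, h'⟩
      refine h ?_
      simp only [latticePoint, Pi.add_apply, Pi.single_eq_same, Pi.single_eq_of_ne hjk,
        Pi.single_eq_of_ne (Ne.symm hjk), add_zero, zero_add] at h' ⊢
      push_cast at h'
      linear_combination -h'
  have hzero : ∑ j, ∑ k, ∑' l, A j k l = 0 := by
    have h1 : ∑ j, ∑ k, ∑' l, A j k l = -∑ j, ∑ k, ∑' l, A j k l := by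
      conv_lhs => rw [Finset.sum_comm]
      simp only [← Finset.sum_neg_distrib]
      exact Finset.sum_congr rfl fun j _ => Finset.sum_congr rfl fun k _ => hanti j k
    have h2 : (2 : ℂ) • ∑ j, ∑ k, ∑' l, A j k l = 0 := by
      rw [two_smul]
      nth_rewrite 1 [h1]
      exact neg_add_cancel _
    exact (smul_eq_zero.mp h2).resolve_left two_ne_zero
  have hF' : ∀ j, ∑' l, F j l = ∑' l, G j l + ∑ k, ∑' l, A j k l := by
    intro j
    rw [← Summable.tsum_finsetSum (fun k _ => hAs j k), ← (hGs j).tsum_add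
      (summable_sum fun k _ => hAs j k)]
    exact tsum_congr (hsplit j)
  rw [Finset.sum_congr rfl fun j _ => hF' j, Finset.sum_add_distrib, hzero, add_zero]

/-! ### The weights of the Ansatz at coinciding and neighbouring lattice points. -/

/-- The hypotheses of the off-shell Bethe Ansatz. -/
structure AnsatzData {r m : ℕ} (ψ τ : ℂ → ℂ) (f₁ : (Fin m → ℂ) → TensorVec r m)
    (u₀ : Fin m → ℂ) : Prop where
  one_le : 1 ≤ r
  psi : ∀ x : ℂ, x ≠ 2 / ((r + 1 : ℕ) : ℂ) → bFun (r + 1) x * ψ x = ψ (x - 2)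
  tau : ∀ x : ℂ, x ≠ 0 → x ≠ 2 → x ≠ 2 / ((r + 1 : ℕ) : ℂ) → x ≠ 2 - 2 / ((r + 1 : ℕ) : ℂ) →
    τ x / bFun (r + 1) x = τ (x - 2) / bFun (r + 1) (2 - x)
  generic : ∀ i j : Fin m, i ≠ j → ∀ k : ℤ, u₀ i - u₀ j ≠ 2 / ((r + 1 : ℕ) : ℂ) + 2 * (k : ℂ)
  continuousAt : (∃ i j : Fin m, i ≠ j ∧ ∃ k : ℤ, u₀ i - u₀ j = 2 * (k : ℂ)) →
    ∀ k : ℤ, ContinuousAt τ (2 * (k : ℂ))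
  symm : SymmetryCondition (r + 1) (permutedLattice u₀) f₁
  diff : DifferenceEquations (r + 1) (permutedLattice u₀) f₁

theorem update_mem_permutedLattice {m : ℕ} {u₀ u : Fin m → ℂ} (hu : u ∈ permutedLattice u₀)
    (j : Fin m) (e : ℤ) :
    Function.update u j (u j + 2 * (e : ℂ)) ∈ permutedLattice u₀ := by
  obtain ⟨σ, hσ⟩ := hu
  refine ⟨σ, fun p => ?_⟩
  obtain ⟨k, hk⟩ := hσ p
  by_cases h : p = j
  · subst h
    exact ⟨k + e, by rw [Function.update_self, hk]; push_cast; ring⟩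
  · exact ⟨k, by rw [Function.update_of_ne h, hk]⟩

theorem sub_ne_of_mem_permutedLattice {r n m : ℕ} {ψ τ : ℂ → ℂ}
    {f₁ : (Fin m → ℂ) → TensorVec r m} {u₀ : Fin m → ℂ} {x : Fin n → ℂ}
    (hx : x ∈ convergenceDomain n ψ τ f₁ u₀) {u : Fin m → ℂ} (hu : u ∈ permutedLattice u₀)
    (i : Fin n) (j : Fin m) : x i - u j ≠ 2 / ((r + 1 : ℕ) : ℂ) := by
  obtain ⟨σ, hσ⟩ := hu
  obtain ⟨k, hk⟩ := hσ j
  intro h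
  refine hx.1 i (σ j) k ?_
  rw [hk] at h
  linear_combination h

namespace AnsatzData

variable {r m : ℕ} {ψ τ : ℂ → ℂ}

theorem regular {f₁ : (Fin m → ℂ) → TensorVec r m} {u₀ : Fin m → ℂ}
    (h : AnsatzData ψ τ f₁ u₀) : RegularSet (r + 1) (permutedLattice u₀) :=
  regularSet_permutedLattice h.generic

/-- Coordinates that meet modulo 2ℤ on the lattice belong to coinciding classes, the case in which
continuity of τ is assumed. -/
theorem continuousAt_of_sub {f₁ : (Fin m → ℂ) → TensorVec r m} {u₀ : Fin m → ℂ}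
    (h : AnsatzData ψ τ f₁ u₀) {l : Fin m → ℤ} {i j : Fin m} (hij : i ≠ j) {e : ℤ}
    (he : latticePoint u₀ l i = latticePoint u₀ l j + 2 * (e : ℂ)) (k : ℤ) :
    ContinuousAt τ (2 * (k : ℂ)) := by
  refine h.continuousAt ⟨i, j, hij, e + l i - l j, ?_⟩ k
  simp only [latticePoint] at he
  push_cast
  linear_combination he

/-- Because of τ(0) = 0, the interpolation formulas are needed only for distinct u_j. -/
theorem weight_eq_zero {n : ℕ} {f₁ : (Fin m → ℂ) → TensorVec r m} {u₀ : Fin m → ℂ}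
    (h : AnsatzData ψ τ f₁ u₀) (x : Fin n → ℂ) {l : Fin m → ℤ}
    (hl : ¬Function.Injective (latticePoint u₀ l)) : weight ψ τ x (latticePoint u₀ l) = 0 := by
  simp only [Function.Injective, not_forall] at hl
  obtain ⟨i, j, hij, hne⟩ := hl
  have hc := fun k => h.continuousAt_of_sub hne (e := 0) (by simpa using hij) k
  have := tauProd_eq_zero (tau_zero h.one_le h.tau hc) hne hij
  change _ * tauProd τ _ = 0
  rw [this, mul_zero]

theorem weight_swap {n : ℕ} {f₁ : (Fin m → ℂ) → TensorVec r m} {u₀ : Fin m → ℂ}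
    (h : AnsatzData ψ τ f₁ u₀) (x : Fin n → ℂ) {l : Fin m → ℤ}
    (hl : Function.Injective (latticePoint u₀ l)) {j k : Fin m} (hjk : k ≠ j) {e : ℤ}
    (he : e = 1 ∨ e = -1) (hu : latticePoint u₀ l k = latticePoint u₀ l j + 2 * (e : ℂ)) :
    weight ψ τ x (latticePoint u₀ l ∘ Equiv.swap j k) = -weight ψ τ x (latticePoint u₀ l) := by
  have hne : ∀ p q, p ≠ q →
      latticePoint u₀ l p - latticePoint u₀ l q ≠ 2 / ((r + 1 : ℕ) : ℂ) :=
    fun p q hpq => h.regular.ne _ (latticePoint_mem u₀ l) p q hpq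
  have hτ2 := tau_neg_two h.one_le h.tau fun i => h.continuousAt_of_sub hjk hu i
  set u := latticePoint u₀ l with hud
  have hV : tauProd τ (u ∘ Equiv.swap j k) = -tauProd τ u := by
    refine tauProd_swap hjk ?_ ?_
    · rcases he with rfl | rfl
      · rw [show u k - u j = 2 by rw [hu]; push_cast; ring,
          show u j - u k = -2 by rw [hu]; push_cast; ring, hτ2, neg_neg]
      · rw [show u k - u j = -2 by rw [hu]; push_cast; ring,
          show u j - u k = 2 by rw [hu]; push_cast; ring, hτ2]
    · intro p hpj hpk
      have a1 := hl.ne hpj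
      have a2 := hl.ne hpk
      rcases he with rfl | rfl
      · push_cast at hu
        have := tau_mul_tau h.tau (x := u k - u p) (sub_ne_zero.mpr a2.symm)
          (fun h => a1 (by linear_combination hu - h)) (hne _ _ hpk.symm)
          (fun h => hne p j hpj (by linear_combination hu - h))
        rw [show 2 - (u k - u p) = u p - u j by rw [hu]; ring,
          show -(u k - u p) = u p - u k by ring,
          show u k - u p - 2 = u j - u p by rw [hu]; ring] at this
        exact this
      · push_cast at hu
        have := tau_mul_tau h.tau (x := u j - u p) (sub_ne_zero.mpr a1.symm)
          (fun h => a2 (by linear_combination -hu - h)) (hne _ _ hpj.symm)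
          (fun h => hne p k hpk (by linear_combination -hu - h))
        rw [show 2 - (u j - u p) = u p - u k by rw [hu]; ring,
          show -(u j - u p) = u p - u j by ring,
          show u j - u p - 2 = u k - u p by rw [hu]; ring] at this
        linear_combination -this
  change _ * tauProd τ _ = -(_ * tauProd τ _)
  rw [hV, mul_neg]
  congr 2
  refine Finset.prod_congr rfl fun i _ => ?_
  exact Equiv.prod_comp (Equiv.swap j k) fun k => ψ (x i - u k)

end AnsatzData

/-! ### Matching the terms of the first and the last site. -/

/-- The Bethe vector of level `m` in which the first magnon, of colour `γ`, is split off. -/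
def excited {r n m : ℕ} (f₁ : (Fin (m + 1) → ℂ) → TensorVec r (m + 1)) (t : Fin n → ℂ) (γ : Fin r)
    (v : Fin (m + 1) → ℂ) : TensorVec (r + 1) n :=
  bethe (fun β => bOp β t) (Fin.tail v) (auxOut γ (f₁ v)) (refState r n)

theorem excited_comp {r n m : ℕ} {P : Set (Fin (m + 1) → ℂ)} (hP : RegularSet (r + 1) P)
    {f₁ : (Fin (m + 1) → ℂ) → TensorVec r (m + 1)} (hf : SymmetryCondition (r + 1) P f₁)
    {t : Fin n → ℂ} {v : Fin (m + 1) → ℂ} (hv : v ∈ P)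
    (ht : ∀ i k, t i - v k ≠ 2 / ((r + 1 : ℕ) : ℂ)) (γ : Fin r) {ρ : Equiv.Perm (Fin (m + 1))}
    (hρ : ρ 0 = 0) : excited f₁ t γ (v ∘ ρ) = excited f₁ t γ v := by
  obtain ⟨⟨p, ρ'⟩, rfl⟩ := Equiv.Perm.decomposeFin.symm.surjective ρ
  obtain rfl : p = 0 := by simpa using hρ
  have h1 : v ∘ Equiv.Perm.decomposeFin.symm (0, ρ') = Fin.cons (v 0) (Fin.tail v ∘ ρ') := by
    funext k
    refine Fin.cases ?_ (fun k => ?_) k <;> simp [Fin.tail]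
  have hB : ∀ i j, i ≠ j → RowExchange (2 / ((r + 1 : ℕ) : ℂ)) (fun β : Fin r => bOp β t)
      (Fin.tail v i) (Fin.tail v j) :=
    fun i j _ β β' w => (RTT_monodromyBlock (r + 1) (d := r + 1) t _ _
      (fun l => ht l i.succ) (fun l => ht l j.succ)).rowExchange 0 β.succ β'.succ w
  have := bethe_perm (hP.cons_preimage (v 0)) (hf.cons_preimage (v 0) γ) (u := Fin.tail v)
    (by change _ ∈ P; rwa [Fin.cons_self_tail]) hB ρ' (refState r n)
  rw [Fin.cons_self_tail] at this
  rw [excited, excited, h1, Fin.tail_cons]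
  exact this

/-- Both tuples begin with u_j and differ by a permutation of the other entries, in which the
remaining Bethe vector is symmetric. -/
theorem excited_swap {r n m : ℕ} {P : Set (Fin (m + 1) → ℂ)} (hP : RegularSet (r + 1) P)
    {f₁ : (Fin (m + 1) → ℂ) → TensorVec r (m + 1)} (hf : SymmetryCondition (r + 1) P f₁)
    {t : Fin n → ℂ} {u : Fin (m + 1) → ℂ} (hu : u ∈ P)
    (ht : ∀ i k, t i - u k ≠ 2 / ((r + 1 : ℕ) : ℂ)) (γ : Fin r) (j k : Fin (m + 1)) :
    excited f₁ t γ ((u ∘ Equiv.swap j k) ∘ Equiv.swap 0 k) =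
      excited f₁ t γ (u ∘ Equiv.swap 0 j) := by
  have h : (u ∘ Equiv.swap j k) ∘ Equiv.swap 0 k =
      (u ∘ Equiv.swap 0 j) ∘ (Equiv.swap 0 j * Equiv.swap j k * Equiv.swap 0 k : Equiv.Perm _) := by
    funext p
    simp
  rw [h]
  exact excited_comp hP hf (hP.perm u hu _) (fun i p => ht i _) γ (by simp)

/-- The summand of the first component of the Bethe sum in which the magnon `j` sits on the first
site, whose argument is `a`. -/
def firstTerm {r n m : ℕ} (ψ τ : ℂ → ℂ) (f₁ : (Fin (m + 1) → ℂ) → TensorVec r (m + 1)) (a : ℂ)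
    (t : Fin n → ℂ) (γ : Fin r) (j : Fin (m + 1)) (u : Fin (m + 1) → ℂ) : TensorVec (r + 1) n :=
  (weight ψ τ (Fin.cons a t : Fin (n + 1) → ℂ) u * (cFun (r + 1) (a - u j) *
    (∏ k ∈ Finset.univ.erase j, (bFun (r + 1) (u k - u j))⁻¹) *
    ∏ i, bFun (r + 1) (t i - u j))) • excited f₁ t γ (u ∘ Equiv.swap 0 j)

/-- The summand of the last component of the Bethe sum in which the magnon `j` sits on the last
site, whose argument is `a`. -/
def lastTerm {r n m : ℕ} (ψ τ : ℂ → ℂ) (f₁ : (Fin (m + 1) → ℂ) → TensorVec r (m + 1)) (a : ℂ)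
    (t : Fin n → ℂ) (γ : Fin r) (j : Fin (m + 1)) (u : Fin (m + 1) → ℂ) : TensorVec (r + 1) n :=
  (weight ψ τ (Fin.snoc t a : Fin (n + 1) → ℂ) u * (cFun (r + 1) (a - u j) *
    ∏ k ∈ Finset.univ.erase j, (bFun (r + 1) (a - u k) * (bFun (r + 1) (u j - u k))⁻¹))) •
    excited f₁ t γ (Function.update u j (u j - 2) ∘ Equiv.swap 0 j)

theorem weight_cons {n m : ℕ} (ψ τ : ℂ → ℂ) (a : ℂ) (t : Fin n → ℂ) (u : Fin m → ℂ) :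
    weight ψ τ (Fin.cons a t : Fin (n + 1) → ℂ) u =
      (∏ j, ψ (a - u j)) * (∏ i, ∏ j, ψ (t i - u j)) * tauProd τ u := by
  rw [weight, Fin.prod_univ_succ]
  rfl

theorem weight_snoc {n m : ℕ} (ψ τ : ℂ → ℂ) (a : ℂ) (t : Fin n → ℂ) (u : Fin m → ℂ) :
    weight ψ τ (Fin.snoc t a : Fin (n + 1) → ℂ) u =
      (∏ j, ψ (a - u j)) * (∏ i, ∏ j, ψ (t i - u j)) * tauProd τ u := by
  rw [weight, Fin.prod_univ_castSucc]
  simp only [Fin.snoc_castSucc, Fin.snoc_last, tauProd]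
  ring

theorem update_comp_swap {β : Type*} {m : ℕ} (u : Fin m → β) (j k : Fin m) (b : β) :
    Function.update (u ∘ Equiv.swap j k) k b = Function.update u j b ∘ Equiv.swap j k := by
  rw [← Equiv.swap_comm, Function.update_comp_equiv]
  simp

theorem prod_erase_comp_swap {M : Type*} [CommMonoid M] {m : ℕ} (g : Fin m → M) (j k : Fin m) :
    ∏ p ∈ Finset.univ.erase k, g (Equiv.swap j k p) = ∏ p ∈ Finset.univ.erase j, g p := by
  refine Finset.prod_equiv (Equiv.swap j k) (fun p => ?_) fun p _ => rfl
  simp [Equiv.swap_apply_eq_iff]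

theorem comp_finRotate_eq_snoc {β : Type*} {m : ℕ} (v : Fin (m + 1) → β) :
    v ∘ finRotate (m + 1) = Fin.snoc (Fin.tail v) (v 0) := by
  rw [snoc_eq_cons_comp_finRotate, Fin.cons_self_tail]

theorem update_zero_eq_cons_tail {β : Type*} {m : ℕ} (v : Fin (m + 1) → β) (b : β) :
    Function.update v 0 b = Fin.cons b (Fin.tail v) := by
  funext k
  refine Fin.cases ?_ (fun k => ?_) k <;> simp [Fin.tail]

namespace AnsatzData

variable {r n m : ℕ} {ψ τ : ℂ → ℂ} {f₁ : (Fin (m + 1) → ℂ) → TensorVec r (m + 1)}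
  {u₀ : Fin (m + 1) → ℂ} {a : ℂ} {t : Fin n → ℂ} {γ : Fin r}

/-- Here the difference equations of f⁽¹⁾ enter, in their cyclic form: a magnon rotated to the last
place returns to the first with its parameter lowered by 2. -/
theorem lastOut_rotate (h : AnsatzData ψ τ f₁ u₀) (γ : Fin r) {v : Fin (m + 1) → ℂ}
    (hv : v ∈ permutedLattice u₀) :
    lastOut γ (f₁ (Fin.snoc (Fin.tail v) (v 0))) =
      auxOut γ (f₁ (Function.update v 0 (v 0 - 2))) := by
  have hD := permInvariant_permutedLattice u₀
  have hc := h.diff.cyclic hD h.symm h.regular.ne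
  have h1 := update_mem_permutedLattice hv 0 (-1)
  rw [show v 0 + 2 * ((-1 : ℤ) : ℂ) = v 0 - 2 by push_cast; ring] at h1
  rw [update_zero_eq_cons_tail] at h1 ⊢
  have := hc (v 0 - 2) (Fin.tail v) h1
    (by rw [sub_add_cancel, hD.snoc_mem_iff, Fin.cons_self_tail]; exact hv) γ
  rwa [sub_add_cancel] at this

theorem excited_update (h : AnsatzData ψ τ f₁ u₀) (γ : Fin r) {u : Fin (m + 1) → ℂ}
    (hu : u ∈ permutedLattice u₀) (j : Fin (m + 1)) :
    excited f₁ t γ (Function.update u j (u j - 2) ∘ Equiv.swap 0 j) =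
      bethe (fun β => bOp β t) (Fin.tail (u ∘ Equiv.swap 0 j))
        (lastOut γ (f₁ (Fin.snoc (Fin.tail (u ∘ Equiv.swap 0 j)) (u j)))) (refState r n) := by
  have := h.lastOut_rotate γ (h.regular.perm _ hu (Equiv.swap 0 j))
  have e := update_comp_swap u j 0 (u j - 2)
  rw [Equiv.swap_comm] at e
  simp only [Function.comp_apply, Equiv.swap_apply_left] at this
  rw [this, excited, ← e, update_zero_eq_cons_tail, Fin.tail_cons]

/-- After u_j → u_j + 2 both excited vectors and both factors c agree. In the scalars, `F1` and `F2`
use the equation of ψ, for the unmoved sites and for the moved one, and `F3` uses that of τ. -/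
theorem lastTerm_update (h : AnsatzData ψ τ f₁ u₀)
    (hx : ∀ u ∈ permutedLattice u₀, ∀ k, a + 2 - u k ≠ 2 / ((r + 1 : ℕ) : ℂ))
    (ht : ∀ u ∈ permutedLattice u₀, ∀ i k, t i - u k ≠ 2 / ((r + 1 : ℕ) : ℂ))
    (j : Fin (m + 1)) {u : Fin (m + 1) → ℂ} (hu : u ∈ permutedLattice u₀)
    (hinj : Function.Injective u) (hinj' : Function.Injective (Function.update u j (u j + 2))) :
    lastTerm ψ τ f₁ (a + 2) t γ j (Function.update u j (u j + 2)) =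
      firstTerm ψ τ f₁ a t γ j u := by
  have hu' := update_mem_permutedLattice hu j 1
  rw [Int.cast_one, mul_one] at hu'
  have e0 : Function.update (Function.update u j (u j + 2)) j (u j + 2 - 2) = u := by
    simp
  have hk : ∀ k ∈ Finset.univ.erase j, Function.update u j (u j + 2) k = u k :=
    fun k hk => Function.update_of_ne (Finset.ne_of_mem_erase hk) _ _
  rw [lastTerm, firstTerm, weight_snoc, weight_cons]
  simp only [Function.update_self]
  rw [e0]
  congr 1
  have F1 : ∏ i, ∏ k, ψ (t i - Function.update u j (u j + 2) k) =
      (∏ i, bFun (r + 1) (t i - u j)) * ∏ i, ∏ k, ψ (t i - u k) := by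
    rw [← Finset.prod_mul_distrib]
    refine Finset.prod_congr rfl fun i _ => ?_
    rw [← Finset.mul_prod_erase _ _ (Finset.mem_univ j),
      ← Finset.mul_prod_erase _ (fun k => ψ (t i - u k)) (Finset.mem_univ j), ← mul_assoc,
      h.psi _ (ht u hu i j), Function.update_self, sub_add_eq_sub_sub]
    congr 1
    exact Finset.prod_congr rfl fun k hk' => by rw [hk k hk']
  have F2 : (∏ k, ψ (a + 2 - Function.update u j (u j + 2) k)) *
      ∏ k ∈ Finset.univ.erase j, bFun (r + 1) (a + 2 - u k) = ∏ k, ψ (a - u k) := by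
    rw [← Finset.mul_prod_erase _ _ (Finset.mem_univ j),
      ← Finset.mul_prod_erase _ (fun k => ψ (a - u k)) (Finset.mem_univ j), mul_assoc,
      ← Finset.prod_mul_distrib, Function.update_self, add_sub_add_right_eq_sub]
    congr 1
    refine Finset.prod_congr rfl fun k hk' => ?_
    rw [hk k hk', mul_comm, h.psi _ (hx u hu k)]
    congr 1
    ring
  have F3 := tauProd_update h.tau j (fun k hk => hinj.ne hk)
    (fun k hkj h' => hinj'.ne hkj (by simp [hkj, h']))
    (fun k hkj => h.regular.ne u hu k j hkj)
    (fun k hkj => by simpa [hkj] using h.regular.ne _ hu' j k hkj.symm)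
  have e1 : ∏ k ∈ Finset.univ.erase j, (bFun (r + 1) (a + 2 - Function.update u j (u j + 2) k) *
      (bFun (r + 1) (u j + 2 - Function.update u j (u j + 2) k))⁻¹) =
      (∏ k ∈ Finset.univ.erase j, bFun (r + 1) (a + 2 - u k)) *
        ∏ k ∈ Finset.univ.erase j, (bFun (r + 1) (u j + 2 - u k))⁻¹ := by
    rw [← Finset.prod_mul_distrib]
    exact Finset.prod_congr rfl fun k hk' => by rw [hk k hk']
  rw [e1, F1, add_sub_add_right_eq_sub, ← F2]
  set A := ∏ k, ψ (a + 2 - Function.update u j (u j + 2) k)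
  set B := ∏ k ∈ Finset.univ.erase j, bFun (r + 1) (a + 2 - u k)
  linear_combination A * B * (∏ i, bFun (r + 1) (t i - u j)) * (∏ i, ∏ k, ψ (t i - u k)) *
    cFun (r + 1) (a - u j) * F3

theorem firstTerm_swap (h : AnsatzData ψ τ f₁ u₀)
    (ht : ∀ u ∈ permutedLattice u₀, ∀ i k, t i - u k ≠ 2 / ((r + 1 : ℕ) : ℂ))
    {l : Fin (m + 1) → ℤ} {j k : Fin (m + 1)} (hjk : k ≠ j)
    (hl : Function.Injective (latticePoint u₀ l)) {e : ℤ} (he : e = 1 ∨ e = -1)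
    (hu : latticePoint u₀ l k = latticePoint u₀ l j + 2 * (e : ℂ)) :
    firstTerm ψ τ f₁ a t γ k (latticePoint u₀ l ∘ Equiv.swap j k) =
      -firstTerm ψ τ f₁ a t γ j (latticePoint u₀ l) := by
  have hmem := latticePoint_mem u₀ l
  rw [firstTerm, firstTerm, excited_swap h.regular h.symm hmem (ht _ hmem), ← neg_smul,
    h.weight_swap _ hl hjk he hu, neg_mul]
  simp only [Function.comp, Equiv.swap_apply_right]
  rw [prod_erase_comp_swap (fun p => (bFun (r + 1) (latticePoint u₀ l p - latticePoint u₀ l j))⁻¹)]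

theorem lastTerm_swap (h : AnsatzData ψ τ f₁ u₀)
    (ht : ∀ u ∈ permutedLattice u₀, ∀ i k, t i - u k ≠ 2 / ((r + 1 : ℕ) : ℂ))
    {l : Fin (m + 1) → ℤ} {j k : Fin (m + 1)} (hjk : k ≠ j)
    (hl : Function.Injective (latticePoint u₀ l)) {e : ℤ} (he : e = 1 ∨ e = -1)
    (hu : latticePoint u₀ l k = latticePoint u₀ l j + 2 * (e : ℂ)) :
    lastTerm ψ τ f₁ a t γ k (latticePoint u₀ l ∘ Equiv.swap j k) =
      -lastTerm ψ τ f₁ a t γ j (latticePoint u₀ l) := by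
  have hmem := latticePoint_mem u₀ l
  have hmem' := update_mem_permutedLattice hmem j (-1)
  rw [Int.cast_neg, Int.cast_one, mul_neg_one, ← sub_eq_add_neg] at hmem'
  rw [lastTerm, lastTerm, update_comp_swap, h.weight_swap _ hl hjk he hu, neg_mul, neg_smul]
  simp only [Function.comp_apply, Equiv.swap_apply_right]
  rw [excited_swap h.regular h.symm hmem' (ht _ hmem'), prod_erase_comp_swap (fun p =>
    bFun (r + 1) (a - latticePoint u₀ l p) *
      (bFun (r + 1) (latticePoint u₀ l j - latticePoint u₀ l p))⁻¹)]

open Classical in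
theorem auxOut_succ_betheTerm (h : AnsatzData ψ τ f₁ u₀)
    (hx : (Fin.cons a t : Fin (n + 1) → ℂ) ∈ convergenceDomain (n + 1) ψ τ f₁ u₀)
    (γ : Fin r) (l : Fin (m + 1) → ℤ) :
    auxOut γ.succ (betheTerm ψ τ f₁ (Fin.cons a t : Fin (n + 1) → ℂ) (latticePoint u₀ l)) =
      ∑ j, if Function.Injective (latticePoint u₀ l) then
        firstTerm ψ τ f₁ a t γ j (latticePoint u₀ l) else 0 := by
  rw [betheTerm_eq, map_smul]
  split_ifs with hl
  · rw [auxOut_succ_bethe _ h.regular h.symm (latticePoint_mem u₀ l) hl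
      (sub_latticePoint_ne hx l), Finset.smul_sum]
    refine Finset.sum_congr rfl fun j _ => ?_
    rw [smul_smul]
    rfl
  · rw [h.weight_eq_zero _ hl, zero_smul, Finset.sum_const_zero]

open Classical in
theorem lastOut_succ_betheTerm (h : AnsatzData ψ τ f₁ u₀)
    (hx : (Fin.snoc t a : Fin (n + 1) → ℂ) ∈ convergenceDomain (n + 1) ψ τ f₁ u₀)
    (γ : Fin r) (l : Fin (m + 1) → ℤ) :
    lastOut γ.succ (betheTerm ψ τ f₁ (Fin.snoc t a : Fin (n + 1) → ℂ) (latticePoint u₀ l)) =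
      ∑ j, if Function.Injective (latticePoint u₀ l) then
        lastTerm ψ τ f₁ a t γ j (latticePoint u₀ l) else 0 := by
  rw [betheTerm_eq, map_smul]
  split_ifs with hl
  · rw [lastOut_succ_bethe _ h.regular h.symm (latticePoint_mem u₀ l) hl
      (sub_latticePoint_ne hx l), Finset.smul_sum]
    refine Finset.sum_congr rfl fun j _ => ?_
    rw [smul_smul, lastTerm, Fin.init_snoc, Fin.snoc_last]
    rw [← h.excited_update γ (latticePoint_mem u₀ l) j]
  · rw [h.weight_eq_zero _ hl, zero_smul, Finset.sum_const_zero]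

end AnsatzData

/-! ### Summability after splitting off a magnon. -/

theorem exists_norm_prod_le {α ι : Type*} (s : Finset ι) (F : ι → α → ℂ)
    (h : ∀ i, ∃ C : ℝ, 0 ≤ C ∧ ∀ x, ‖F i x‖ ≤ C) :
    ∃ C : ℝ, 0 ≤ C ∧ ∀ x, ‖∏ i ∈ s, F i x‖ ≤ C := by
  choose C hC hF using h
  refine ⟨∏ i ∈ s, C i, Finset.prod_nonneg fun i _ => hC i, fun x => ?_⟩
  rw [norm_prod]
  exact Finset.prod_le_prod (fun _ _ => norm_nonneg _) fun i _ => hF i x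

theorem exists_norm_mul_le {α : Type*} {F G : α → ℂ} (hF : ∃ C : ℝ, 0 ≤ C ∧ ∀ x, ‖F x‖ ≤ C)
    (hG : ∃ C : ℝ, 0 ≤ C ∧ ∀ x, ‖G x‖ ≤ C) : ∃ C : ℝ, 0 ≤ C ∧ ∀ x, ‖F x * G x‖ ≤ C := by
  obtain ⟨C, hC, hF⟩ := hF
  obtain ⟨C', hC', hG⟩ := hG
  refine ⟨C * C', by positivity, fun x => ?_⟩
  rw [norm_mul]
  exact mul_le_mul (hF x) (hG x) (norm_nonneg _) hC

theorem exists_norm_bethe_tail_le {r n m : ℕ} (t : Fin n → ℂ) (u₀ : Fin (m + 1) → ℂ)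
    (j : Fin (m + 1)) : ∃ C : ℝ, 0 ≤ C ∧ ∀ (l : Fin (m + 1) → ℤ) (w : TensorVec r m),
      ‖bethe (fun β => bOp β t) (Fin.tail (latticePoint u₀ l ∘ Equiv.swap 0 j)) w
        (refState r n)‖ ≤
      C * (∏ k ∈ Finset.univ.erase j, (1 + ‖latticePoint u₀ l k‖)⁻¹) * ‖w‖ := by
  obtain ⟨C, hC, h⟩ := exists_norm_bOp_le (r := r) t u₀
  refine ⟨(r : ℝ) ^ m * C ^ m * ‖refState r n‖, by positivity, fun l w => ?_⟩
  have := norm_bethe_le (fun β => bOp β t) (Fin.tail (latticePoint u₀ l ∘ Equiv.swap 0 j))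
    (fun k => C * (1 + ‖latticePoint u₀ l (Equiv.swap 0 j k.succ)‖)⁻¹) (fun k => by positivity)
    (fun k β v => h (Equiv.swap 0 j k.succ) β l v) w (refState r n)
  rw [Finset.prod_mul_distrib, Finset.prod_const, Finset.card_univ, Fintype.card_fin,
    prod_tail_comp_swap (fun k => (1 + ‖latticePoint u₀ l k‖)⁻¹)] at this
  exact this.trans (le_of_eq (by ring))

open Classical in
/-- Splitting off the magnon `j` does not destroy the convergence of the Bethe sum. -/
theorem summable_of_factor {r n n' m : ℕ} {ψ τ : ℂ → ℂ}
    {f₁ : (Fin (m + 1) → ℂ) → TensorVec r (m + 1)} {u₀ : Fin (m + 1) → ℂ} {x : Fin n' → ℂ}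
    (hx : x ∈ convergenceDomain n' ψ τ f₁ u₀) (t : Fin n → ℂ) (a : ℂ) (j : Fin (m + 1))
    (T : (Fin (m + 1) → ℤ) → TensorVec (r + 1) n) (q : (Fin (m + 1) → ℤ) → ℂ)
    (w : (Fin (m + 1) → ℤ) → TensorVec r m)
    (hT : ∀ l, T l = (weight ψ τ x (latticePoint u₀ l) *
      (cFun (r + 1) (a - latticePoint u₀ l j) * q l)) •
      bethe (fun β => bOp β t) (Fin.tail (latticePoint u₀ l ∘ Equiv.swap 0 j)) (w l)
        (refState r n))
    (hq : ∃ C : ℝ, 0 ≤ C ∧ ∀ l, ‖q l‖ ≤ C)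
    (hw : ∃ C : ℝ, 0 ≤ C ∧ ∀ l, ‖w l‖ ≤ C * ‖f₁ (latticePoint u₀ l)‖) :
    Summable fun l => if Function.Injective (latticePoint u₀ l) then T l else 0 := by
  obtain ⟨Cq, hCq, hq⟩ := hq
  obtain ⟨Cw, hCw, hw⟩ := hw
  obtain ⟨Cc, hCc, hc⟩ := exists_norm_cFun_le_decay (r + 1) a (u₀ j)
  obtain ⟨Cb, hCb, hb⟩ := exists_norm_bethe_tail_le (r := r) t u₀ j
  refine Summable.of_norm_bounded ((summable_majorant hx).mul_left (Cc * Cq * (Cb * Cw)))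
    fun l => ?_
  -- The coefficient c supplies the decay in u_j that the missing operator B would have given; the
  -- remaining operators supply the rest.
  have hd : decay (latticePoint u₀ l) = (1 + ‖latticePoint u₀ l j‖)⁻¹ *
      ∏ k ∈ Finset.univ.erase j, (1 + ‖latticePoint u₀ l k‖)⁻¹ :=
    (Finset.mul_prod_erase _ _ (Finset.mem_univ j)).symm
  have hp : 0 ≤ ∏ k ∈ Finset.univ.erase j, (1 + ‖latticePoint u₀ l k‖)⁻¹ :=
    Finset.prod_nonneg fun k _ => by positivity
  have hc' : ‖cFun (r + 1) (a - latticePoint u₀ l j)‖ ≤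
      Cc * (1 + ‖latticePoint u₀ l j‖)⁻¹ := hc (l j)
  have main : ‖T l‖ ≤ Cc * Cq * (Cb * Cw) * (‖weight ψ τ x (latticePoint u₀ l)‖ *
      ‖f₁ (latticePoint u₀ l)‖ * decay (latticePoint u₀ l)) := by
    rw [hT, norm_smul, norm_mul, norm_mul]
    calc _ ≤ ‖weight ψ τ x (latticePoint u₀ l)‖ *
          ((Cc * (1 + ‖latticePoint u₀ l j‖)⁻¹) * Cq) *
          (Cb * (∏ k ∈ Finset.univ.erase j, (1 + ‖latticePoint u₀ l k‖)⁻¹) *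
            (Cw * ‖f₁ (latticePoint u₀ l)‖)) := by
          gcongr
          · exact hq l
          · exact (hb l (w l)).trans (by gcongr; exact hw l)
      _ = _ := by rw [hd]; ring
  split_ifs
  · exact main
  · rw [norm_zero]; exact (norm_nonneg _).trans main

theorem exists_norm_bFun_sub_inv_le {m : ℕ} (u₀ : Fin m → ℂ) (N : ℕ) (p q : Fin m) :
    ∃ C : ℝ, 0 ≤ C ∧ ∀ l : Fin m → ℤ,
      ‖(bFun N (latticePoint u₀ l p - latticePoint u₀ l q))⁻¹‖ ≤ C := by
  obtain ⟨C, hC, h⟩ := exists_norm_bFun_inv_le N (u₀ p - u₀ q)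
  exact ⟨C, hC, fun l => by rw [latticePoint_sub]; exact h _⟩

theorem exists_norm_bFun_sub_le {m : ℕ} (u₀ : Fin m → ℂ) (N : ℕ) (z : ℂ) (p : Fin m) :
    ∃ C : ℝ, 0 ≤ C ∧ ∀ l : Fin m → ℤ, ‖bFun N (z - latticePoint u₀ l p)‖ ≤ C := by
  obtain ⟨C, hC, h⟩ := exists_norm_bFun_le N (z - u₀ p)
  exact ⟨C, hC, fun l => by rw [sub_latticePoint]; exact h _⟩

namespace AnsatzData

variable {r n m : ℕ} {ψ τ : ℂ → ℂ} {f₁ : (Fin (m + 1) → ℂ) → TensorVec r (m + 1)}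
  {u₀ : Fin (m + 1) → ℂ} {a : ℂ} {t : Fin n → ℂ} {γ : Fin r}

open Classical in
theorem summable_firstTerm (h : AnsatzData ψ τ f₁ u₀)
    (hx : (Fin.cons a t : Fin (n + 1) → ℂ) ∈ convergenceDomain (n + 1) ψ τ f₁ u₀)
    (γ : Fin r) (j : Fin (m + 1)) :
    Summable fun l => if Function.Injective (latticePoint u₀ l) then
      firstTerm ψ τ f₁ a t γ j (latticePoint u₀ l) else 0 := by
  refine summable_of_factor hx t a j _
    (fun l => (∏ k ∈ Finset.univ.erase j,
      (bFun (r + 1) (latticePoint u₀ l k - latticePoint u₀ l j))⁻¹) *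
      ∏ i, bFun (r + 1) (t i - latticePoint u₀ l j))
    (fun l => auxOut γ (f₁ (latticePoint u₀ l ∘ Equiv.swap 0 j)))
    (fun l => by rw [firstTerm, excited, mul_assoc (cFun _ _)]) ?_ ?_
  · exact exists_norm_mul_le
      (exists_norm_prod_le _ _ fun k => exists_norm_bFun_sub_inv_le u₀ _ k j)
      (exists_norm_prod_le _ _ fun i => exists_norm_bFun_sub_le u₀ _ (t i) j)
  · obtain ⟨C, hC, hC'⟩ := exists_norm_comp_perm_le h.regular h.symm (Equiv.swap 0 j)
    exact ⟨C, hC, fun l => (norm_auxOut_le _ _).trans (hC' l)⟩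

open Classical in
theorem summable_lastTerm (h : AnsatzData ψ τ f₁ u₀)
    (hx : (Fin.snoc t a : Fin (n + 1) → ℂ) ∈ convergenceDomain (n + 1) ψ τ f₁ u₀)
    (γ : Fin r) (j : Fin (m + 1)) :
    Summable fun l => if Function.Injective (latticePoint u₀ l) then
      lastTerm ψ τ f₁ a t γ j (latticePoint u₀ l) else 0 := by
  refine summable_of_factor hx t a j _
    (fun l => ∏ k ∈ Finset.univ.erase j, (bFun (r + 1) (a - latticePoint u₀ l k) *
      (bFun (r + 1) (latticePoint u₀ l j - latticePoint u₀ l k))⁻¹))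
    (fun l => lastOut γ (f₁ (Fin.snoc (Fin.tail (latticePoint u₀ l ∘ Equiv.swap 0 j))
      (latticePoint u₀ l j))))
    (fun l => by rw [lastTerm, h.excited_update γ (latticePoint_mem u₀ l)]) ?_ ?_
  · exact exists_norm_prod_le _ _ fun k => exists_norm_mul_le
      (exists_norm_bFun_sub_le u₀ _ a k) (exists_norm_bFun_sub_inv_le u₀ _ j k)
  -- The colour vector is taken at u with u_j moved to the last place, which is again a permutation
  -- of u.
  · obtain ⟨C, hC, hC'⟩ := exists_norm_comp_perm_le h.regular h.symm
      (Equiv.swap 0 j * finRotate (m + 1))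
    refine ⟨C, hC, fun l => (norm_lastOut_le _ _).trans ?_⟩
    have e := comp_finRotate_eq_snoc (latticePoint u₀ l ∘ Equiv.swap 0 j)
    rw [Function.comp_apply, Equiv.swap_apply_left] at e
    rw [← e]
    exact hC' l

/-! ### Cyclicity of the Bethe Ansatz and conclusion. -/

open Classical in
theorem sum_tsum_lastTerm_eq (h : AnsatzData ψ τ f₁ u₀)
    (hL : (Fin.cons a t : Fin (n + 1) → ℂ) ∈ convergenceDomain (n + 1) ψ τ f₁ u₀)
    (hR : (Fin.snoc t (a + 2) : Fin (n + 1) → ℂ) ∈ convergenceDomain (n + 1) ψ τ f₁ u₀)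
    (γ : Fin r) :
    ∑ j, ∑' l, (if Function.Injective (latticePoint u₀ l) then
      lastTerm ψ τ f₁ (a + 2) t γ j (latticePoint u₀ l) else 0) =
    ∑ j, ∑' l, if Function.Injective (latticePoint u₀ l) then
      firstTerm ψ τ f₁ a t γ j (latticePoint u₀ l) else 0 := by
  have ht : ∀ u ∈ permutedLattice u₀, ∀ i k, t i - u k ≠ 2 / ((r + 1 : ℕ) : ℂ) :=
    fun u hu i k => by simpa using sub_ne_of_mem_permutedLattice hL hu i.succ k
  have ha : ∀ u ∈ permutedLattice u₀, ∀ k, a + 2 - u k ≠ 2 / ((r + 1 : ℕ) : ℂ) :=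
    fun u hu k => by simpa using sub_ne_of_mem_permutedLattice hR hu (Fin.last n) k
  -- Collisions are removed for the shift by +2 on one side and by -2 on the other. The remaining
  -- conditions ask for distinct coordinates before and after the shift, so the translation matches
  -- them.
  rw [sum_tsum_eq_of_swap u₀ (fun j u => firstTerm ψ τ f₁ a t γ j u) 1
      (h.summable_firstTerm hL γ)
      (fun l j k hjk hl hu => h.firstTerm_swap ht hjk hl (Or.inl rfl) hu),
    sum_tsum_eq_of_swap u₀ (fun j u => lastTerm ψ τ f₁ (a + 2) t γ j u) (-1)
      (h.summable_lastTerm hR γ)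
      (fun l j k hjk hl hu => h.lastTerm_swap ht hjk hl (Or.inr rfl) hu)]
  refine Finset.sum_congr rfl fun j _ => ?_
  rw [← (Equiv.addRight (Pi.single j (-1) : Fin (m + 1) → ℤ)).tsum_eq]
  refine tsum_congr fun l => ?_
  have e0 : Function.update (Function.update (latticePoint u₀ l) j (latticePoint u₀ l j + 2)) j
      (latticePoint u₀ l j + 2 + 2 * ((-1 : ℤ) : ℂ)) = latticePoint u₀ l := by
    rw [Function.update_idem]
    convert Function.update_eq_self j (latticePoint u₀ l)
    push_cast
    ring
  have e1 := latticePoint_add_single u₀ l j 1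
  simp only [Int.cast_one, mul_one] at e1
  simp only [Equiv.coe_addRight, e1, Function.update_self, e0, Int.cast_one, mul_one]
  by_cases h1 : Function.Injective (latticePoint u₀ l)
  · by_cases h2 : Function.Injective
      (Function.update (latticePoint u₀ l) j (latticePoint u₀ l j + 2))
    · rw [if_pos ⟨h2, h1⟩, if_pos ⟨h1, h2⟩]
      exact h.lastTerm_update ha ht j (latticePoint_mem u₀ l) h1 h2
    · rw [if_neg fun h' => h2 h'.1, if_neg fun h' => h2 h'.2]
  · rw [if_neg fun h' => h1 h'.2, if_neg fun h' => h1 h'.1]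

/-- The factors b picked up at the unexcited last site turn ψ(a + 2 - u_j) into ψ(a - u_j), so no
rearrangement of the sum is needed. -/
theorem lastOut_zero_betheTerm {m : ℕ} {f₁ : (Fin m → ℂ) → TensorVec r m} {u₀ : Fin m → ℂ}
    (h : AnsatzData ψ τ f₁ u₀)
    (hL : (Fin.cons a t : Fin (n + 1) → ℂ) ∈ convergenceDomain (n + 1) ψ τ f₁ u₀)
    (hR : (Fin.snoc t (a + 2) : Fin (n + 1) → ℂ) ∈ convergenceDomain (n + 1) ψ τ f₁ u₀)
    (l : Fin m → ℤ) :
    lastOut 0 (betheTerm ψ τ f₁ (Fin.snoc t (a + 2) : Fin (n + 1) → ℂ) (latticePoint u₀ l)) =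
      auxOut 0 (betheTerm ψ τ f₁ (Fin.cons a t : Fin (n + 1) → ℂ) (latticePoint u₀ l)) := by
  rw [betheTerm_eq, betheTerm_eq, map_smul, map_smul,
    auxOut_zero_bethe _ _ (sub_latticePoint_ne hL l 0), lastOut_zero_bethe, smul_smul,
    Fin.init_snoc, Fin.tail_cons, Fin.snoc_last, weight_snoc, weight_cons]
  congr 1
  have : (∏ j, ψ (a + 2 - latticePoint u₀ l j)) *
      ∏ j, bFun (r + 1) (a + 2 - latticePoint u₀ l j) = ∏ j, ψ (a - latticePoint u₀ l j) := by
    rw [← Finset.prod_mul_distrib]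
    refine Finset.prod_congr rfl fun k _ => ?_
    have hne := sub_latticePoint_ne hR l (Fin.last n) k
    rw [Fin.snoc_last] at hne
    rw [mul_comm, h.psi _ hne]
    congr 1
    ring
  rw [← this]
  ring

theorem lastOut_betheAnsatz {m : ℕ} {f₁ : (Fin m → ℂ) → TensorVec r m} {u₀ : Fin m → ℂ}
    {x : Fin (n + 1) → ℂ} (hx : x ∈ convergenceDomain (n + 1) ψ τ f₁ u₀) (e : Fin (r + 1)) :
    lastOut e (betheAnsatz ψ τ f₁ u₀ x) =
      ∑' l, lastOut e (betheTerm ψ τ f₁ x (latticePoint u₀ l)) :=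
  ContinuousLinearMap.map_tsum (LinearMap.toContinuousLinearMap
    (lastOut (n := n) e)) (summable_betheTerm hx)

theorem auxOut_betheAnsatz {m : ℕ} {f₁ : (Fin m → ℂ) → TensorVec r m} {u₀ : Fin m → ℂ}
    {x : Fin (n + 1) → ℂ} (hx : x ∈ convergenceDomain (n + 1) ψ τ f₁ u₀) (e : Fin (r + 1)) :
    auxOut e (betheAnsatz ψ τ f₁ u₀ x) =
      ∑' l, auxOut e (betheTerm ψ τ f₁ x (latticePoint u₀ l)) :=
  ContinuousLinearMap.map_tsum (LinearMap.toContinuousLinearMap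
    (auxOut (n := n) e)) (summable_betheTerm hx)

theorem cyclic {m : ℕ} {f₁ : (Fin m → ℂ) → TensorVec r m} {u₀ : Fin m → ℂ}
    (h : AnsatzData ψ τ f₁ u₀) :
    Cyclic (convergenceDomain (n + 1) ψ τ f₁ u₀) (betheAnsatz ψ τ f₁ u₀) := by
  intro a t hL hR e
  rw [lastOut_betheAnsatz hR, auxOut_betheAnsatz hL]
  obtain rfl | ⟨γ, rfl⟩ := Fin.eq_zero_or_eq_succ e
  · exact tsum_congr fun l => h.lastOut_zero_betheTerm hL hR l
  obtain _ | m := m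
  -- Without magnons the Bethe vector is a multiple of Ω, and both excited components vanish.
  · refine tsum_congr fun l => ?_
    simp [betheTerm_eq, bethe_zero, auxOut_refState, lastOut_refState]
  · classical
    simp only [h.lastOut_succ_betheTerm hR, h.auxOut_succ_betheTerm hL]
    rw [Summable.tsum_finsetSum fun j _ => h.summable_lastTerm hR γ j,
      Summable.tsum_finsetSum fun j _ => h.summable_firstTerm hL γ j]
    exact h.sum_tsum_lastTerm_eq hL hR γ

theorem differenceEquations {m : ℕ} {f₁ : (Fin m → ℂ) → TensorVec r m} {u₀ : Fin m → ℂ}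
    (h : AnsatzData ψ τ f₁ u₀) (n : ℕ) :
    DifferenceEquations (r + 1) (convergenceDomain n ψ τ f₁ u₀) (betheAnsatz ψ τ f₁ u₀) := by
  obtain _ | n := n
  · exact fun _ _ i => i.elim0
  · exact h.cyclic.differenceEquations (permInvariant_convergenceDomain ψ τ f₁ u₀)
      (symmetryCondition_betheAnsatz ψ τ f₁ u₀)

end AnsatzData

end OffShellBethe

end

theorem theorem3p1 (r n m : ℕ) (hr : 1 ≤ r)
    (ψ τ : ℂ → ℂ) (f₁ : (Fin m → ℂ) → OffShellBethe.TensorVec r m) (u₀ : Fin m → ℂ)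
    (hψ : ∀ x : ℂ, x ≠ 2 / ((r + 1 : ℕ) : ℂ) →
      OffShellBethe.bFun (r + 1) x * ψ x = ψ (x - 2))
    (hτ : ∀ x : ℂ, x ≠ 0 → x ≠ 2 → x ≠ 2 / ((r + 1 : ℕ) : ℂ) → x ≠ 2 - 2 / ((r + 1 : ℕ) : ℂ) →
      τ x / OffShellBethe.bFun (r + 1) x = τ (x - 2) / OffShellBethe.bFun (r + 1) (2 - x))
    (hu : ∀ i j : Fin m, i ≠ j → ∀ k : ℤ,
      u₀ i - u₀ j ≠ 2 / ((r + 1 : ℕ) : ℂ) + 2 * (k : ℂ))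
    (hτc : (∃ i j : Fin m, i ≠ j ∧ ∃ k : ℤ, u₀ i - u₀ j = 2 * (k : ℂ)) →
      ∀ k : ℤ, ContinuousAt τ (2 * (k : ℂ)))
    (hsymm : OffShellBethe.SymmetryCondition (r + 1) (OffShellBethe.permutedLattice u₀) f₁)
    (hdiff : OffShellBethe.DifferenceEquations (r + 1) (OffShellBethe.permutedLattice u₀) f₁) :
    (∀ x ∈ OffShellBethe.convergenceDomain n ψ τ f₁ u₀,
      Summable fun l : Fin m → ℤ =>
        OffShellBethe.betheTerm ψ τ f₁ x (OffShellBethe.latticePoint u₀ l)) ∧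
    OffShellBethe.SymmetryCondition (r + 1) (OffShellBethe.convergenceDomain n ψ τ f₁ u₀)
      (OffShellBethe.betheAnsatz ψ τ f₁ u₀) ∧
    OffShellBethe.DifferenceEquations (r + 1) (OffShellBethe.convergenceDomain n ψ τ f₁ u₀)
      (OffShellBethe.betheAnsatz ψ τ f₁ u₀) := by
  refine ⟨fun x hx => OffShellBethe.summable_betheTerm hx,
    OffShellBethe.symmetryCondition_betheAnsatz ψ τ f₁ u₀, ?_⟩
  exact OffShellBethe.AnsatzData.differenceEquations ⟨hr, hψ, hτ, hu, hτc, hsymm, hdiff⟩ n
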